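/- **Setting.** Let $n\in\{2,3\}$ and let $\Omega\subset\mathbb R^n$ be a (nonempty, open, connected) bounded Lipschitz domain, for instance a polygonal or polyhedral one. Let $\nu>0$ and let $\boldsymbol\beta\in \mathrm W^{1,\infty}(\Omega;\mathbb R^n)$ be divergence free. Put $\mathbf Q:=\mathrm L^2(\Omega;\mathbb C^n)$, $\mathbb H:=\{\boldsymbol\tau\in \mathrm L^2(\Omega;\mathbb C^{n\times n}) : \mathbf{div}\,\boldsymbol\tau\in\mathbf Q\}$ (row-wise weak divergence), $\|\boldsymbol\tau\|_{\mathbf{div}}^2:=\|\boldsymbol\tau\|_0^2+\|\mathbf{div}\,\boldsymbol\tau\|_0^2$ and $\mathbb H_0:=\{\boldsymbol\tau\in\mathbb H:\int_\Omega\mathrm{tr}\,\boldsymbol\tau=0\}$. For complex vectors and matrices write $\boldsymbol s\cdot\boldsymbol r=\sum_i s_i\overline{r_i}$, $A:B=\sum_{i,j}A_{ij}\overline{B_{ij}}$, $A^{\mathtt d}=A-\frac1n\mathrm{tr}(A)\,\mathbb I$, and $(\boldsymbol s\otimes\boldsymbol\beta)_{ij}=s_i\beta_j$; $(\cdot,\cdot)$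 is the inner product of $\mathbf Q$. Let $c_1\ge 0$ be the largest constant such that $c_1\|\boldsymbol\tau\|_{\mathbf{div}}^2\le\|\boldsymbol\tau^{\mathtt d}\|_0^2+\|\mathbf{div}\,\boldsymbol\tau\|_0^2$ for all $\boldsymbol\tau\in\mathbb H_0$, and $\gamma\ge 0$ the largest constant such that $\gamma\|\boldsymbol q\|_0\le\sup_{\boldsymbol\tau\in\mathbb H_0}\big|\int_\Omega\mathbf{div}\,\boldsymbol\tau\cdot\boldsymbol q\big|/\|\boldsymbol\tau\|_{\mathbf{div}}$ for all $\boldsymbol q\in\mathbf Q$. Assume that the data are small in the sense that $\|\boldsymbol\beta\|_{\mathrm L^\infty(\Omega)}<\gamma\min\{\nu,c_1\}$ (for $c_1>0$ this says $\|\boldsymbol\beta\|_{\mathrm L^\infty(\Omega)}\max\{1/\nu,1/c_1\}<\gamma$). **Solution operators.** $\mathbf T:\mathbf Q\to\mathbf Q$ maps $\boldsymbol f$ to $\widehat{\boldsymbol u}$, where $(\widehat{\boldsymbol\sigma},\widehat{\boldsymbol u})\in\mathbb H_0\times\mathbf Q$ solves $$\frac1\nu\int_\Omega\widehat{\boldsymbol\sigma}^{\mathtt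 d}:\boldsymbol\tau^{\mathtt d}+\int_\Omega\widehat{\boldsymbol u}\cdot\mathbf{div}\,\boldsymbol\tau+\frac1\nu\int_\Omega(\widehat{\boldsymbol u}\otimes\boldsymbol\beta)^{\mathtt d}:\boldsymbol\tau=0,\qquad \int_\Omega\mathbf{div}\,\widehat{\boldsymbol\sigma}\cdot\boldsymbol v=-(\boldsymbol f,\boldsymbol v)$$ for all $\boldsymbol\tau\in\mathbb H_0$, $\boldsymbol v\in\mathbf Q$. $\mathbf T^*:\mathbf Q\to\mathbf Q$ maps $\boldsymbol f$ to $\widehat{\boldsymbol u}^*$, where $(\widehat{\boldsymbol\sigma}^*,\widehat{\boldsymbol u}^*)\in\mathbb H_0\times\mathbf Q$ solves $$\frac1\nu\int_\Omega\boldsymbol\tau^{\mathtt d}:\widehat{\boldsymbol\sigma}^{*,\mathtt d}+\int_\Omega\mathbf{div}\,\boldsymbol\tau\cdot\widehat{\boldsymbol u}^*-\frac1\nu\int_\Omega\boldsymbol\tau:(\widehat{\boldsymbol u}^*\otimes\boldsymbol\beta)^{\mathtt d}=0,\qquad \int_\Omega\boldsymbol v\cdot\mathbf{div}\,\widehat{\boldsymbol\sigma}^*=-(\boldsymbol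 v,\boldsymbol f)$$ for all $\boldsymbol\tau\in\mathbb H_0$, $\boldsymbol v\in\mathbf Q$. **Statement (Spectral characterization of $\mathbf T^*$).** Both source problems have exactly one solution for every $\boldsymbol f\in\mathbf Q$; $\mathbf T$ and $\mathbf T^*$ are bounded linear operators and $\mathbf T^*$ is the Hilbert space adjoint of $\mathbf T$. There is a sequence $(\kappa_k^*)_{k\in\mathbb N}$ of nonzero complex eigenvalues of $\mathbf T^*$ with $\kappa_k^*\to0$ and $$\mathrm{sp}(\mathbf T^*)=\{0\}\cup\{\kappa_k^*\}_{k\in\mathbb N},$$ in which each eigenvalue is repeated according to its multiplicity: for every $\mu\neq0$ the generalized eigenspace $\bigcup_j\ker(\mathbf T^*-\mu)^j$ is finite dimensional and its dimension is the number of indices $k$ with $\kappa_k^*=\mu$. Moreover, $\kappa\in\mathbb C$ is an eigenvalue of $\mathbf T$ if and only if $\overline\kappa$ is an eigenvalue of $\mathbf T^*$, with the same algebraic and geometric multiplicities. -/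

import Mathlib

open MeasureTheory Filter Topology
open scoped ContDiff ComplexConjugate

noncomputable section

namespace Oseen

/-! ## The domain and the convective velocity -/

/-- Points of the physical space. -/
abbrev Pt (n : ℕ) := EuclideanSpace ℝ (Fin n)

/-- A bounded Lipschitz domain: a nonempty bounded connected open set such that, near each boundary
point and for a suitable unit direction `e`, the set is exactly the region lying strictly on the
`e`-side of the graph of a Lipschitz function of the component of the point orthogonal to `e`. -/
structure IsLipschitzDomain {n : ℕ} (Ω : Set (Pt n)) : Prop where
  isOpen : IsOpen Ω
  isConnected : IsConnected Ω
  isBounded : Bornology.IsBounded Ω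
  lipschitz_boundary : ∀ x₀ ∈ frontier Ω, ∃ (e : Pt n) (K : NNReal) (φ : Pt n → ℝ),
    ‖e‖ = 1 ∧ LipschitzWith K φ ∧
      ∀ᶠ y in 𝓝 x₀, y ∈ Ω ↔ φ (y - inner ℝ e y • e) < inner ℝ e y

/-- Smooth real functions with compact support contained in `Ω`. -/
structure IsTest {n : ℕ} (Ω : Set (Pt n)) (φ : Pt n → ℝ) : Prop where
  smooth : ContDiff ℝ ∞ φ
  compact : HasCompactSupport φ
  support : tsupport φ ⊆ Ω

/-- The partial derivative of `φ` in the `j`-th coordinate. -/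
def pderiv {n : ℕ} (j : Fin n) (φ : Pt n → ℝ) (x : Pt n) : ℝ :=
  fderiv ℝ φ x (EuclideanSpace.single j 1)

/-- `β` belongs to `W^{1,∞}(Ω)` (essentially bounded, with essentially bounded weak first
derivatives `D i j = ∂ⱼ βᵢ`) and has vanishing divergence almost everywhere in `Ω`. -/
def IsSolenoidalLipschitz {n : ℕ} (Ω : Set (Pt n)) (β : Pt n → Pt n) : Prop :=
  MemLp β ⊤ (volume.restrict Ω) ∧
    ∃ D : Fin n → Fin n → Pt n → ℝ,
      (∀ i j, MemLp (D i j) ⊤ (volume.restrict Ω)) ∧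
      (∀ i j φ, IsTest Ω φ →
        ∫ x in Ω, β x i * pderiv j φ x = -∫ x in Ω, D i j x * φ x) ∧
      ∀ᵐ x ∂(volume.restrict Ω), ∑ i, D i i x = 0

/-- The essential supremum over `Ω` of the Euclidean length of `β`. -/
def supNorm {n : ℕ} (Ω : Set (Pt n)) (β : Pt n → Pt n) : ℝ :=
  (eLpNorm β ⊤ (volume.restrict Ω)).toReal

/-! ## Complex vectors and tensors -/

/-- Complex vectors. -/
abbrev Vec (n : ℕ) := EuclideanSpace ℂ (Fin n)

/-- Complex square tensors, with the Frobenius norm. -/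
abbrev Ten (n : ℕ) := EuclideanSpace ℂ (Fin n × Fin n)

/-- `s · r = ∑ sᵢ conj rᵢ`. -/
def dot {n : ℕ} (s r : Vec n) : ℂ := ∑ i, s i * conj (r i)

/-- `A : B = ∑ Aᵢⱼ conj Bᵢⱼ`. -/
def ddot {n : ℕ} (A B : Ten n) : ℂ := ∑ p, A p * conj (B p)

/-- The trace. -/
def tr {n : ℕ} (A : Ten n) : ℂ := ∑ i, A (i, i)

/-- The deviatoric part `A - (1/n) tr(A) I`. -/
def dev {n : ℕ} (A : Ten n) : Ten n :=
  WithLp.toLp 2 fun p => A p - if p.1 = p.2 then tr A / n else 0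

/-- The dyadic product `v ⊗ b` of a complex vector with a real vector. -/
def dyad {n : ℕ} (v : Vec n) (b : Pt n) : Ten n :=
  WithLp.toLp 2 fun p => v p.1 * (b p.2 : ℂ)

/-! ## Function spaces -/

/-- The space `Q = L²(Ω; ℂⁿ)`. -/
abbrev VecL2 {n : ℕ} (Ω : Set (Pt n)) := Lp (Vec n) 2 (volume.restrict Ω)

/-- The space `L²(Ω; ℂⁿˣⁿ)`. -/
abbrev TenL2 {n : ℕ} (Ω : Set (Pt n)) := Lp (Ten n) 2 (volume.restrict Ω)

/-- `g` is the distributional row-wise divergence of `τ` in `Ω`. -/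
def IsWeakDiv {n : ℕ} (Ω : Set (Pt n)) (τ : TenL2 Ω) (g : VecL2 Ω) : Prop :=
  ∀ (φ : Pt n → ℝ), IsTest Ω φ → ∀ i : Fin n,
    ∫ x in Ω, ∑ j, τ x (i, j) * (pderiv j φ x : ℂ) = -∫ x in Ω, g x i * (φ x : ℂ)

/-- The divergence of an element of `H(div; Ω)`; see `weakDiv_eq`. -/
def weakDiv {n : ℕ} {Ω : Set (Pt n)} (τ : TenL2 Ω) : VecL2 Ω :=
  Classical.epsilon (IsWeakDiv Ω τ)

/-- The space `H(div; Ω)` of square integrable tensors with square integrable divergence. -/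
def HDiv {n : ℕ} (Ω : Set (Pt n)) : Set (TenL2 Ω) := {τ | ∃ g, IsWeakDiv Ω τ g}

/-- The space `H₀` of elements of `H(div; Ω)` whose trace has mean value zero. -/
def HDiv0 {n : ℕ} (Ω : Set (Pt n)) : Set (TenL2 Ω) :=
  {τ | τ ∈ HDiv Ω ∧ ∫ x in Ω, tr (τ x) = 0}

/-- The norm of `H(div; Ω)`. -/
def divNorm {n : ℕ} {Ω : Set (Pt n)} (τ : TenL2 Ω) : ℝ :=
  Real.sqrt (‖τ‖ ^ 2 + ‖weakDiv τ‖ ^ 2)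

/-- The weak divergence is unique. -/
theorem IsWeakDiv.unique {n : ℕ} {Ω : Set (Pt n)} (hΩ : IsOpen Ω) {τ : TenL2 Ω}
    {g g' : VecL2 Ω} (h : IsWeakDiv Ω τ g) (h' : IsWeakDiv Ω τ g') : g = g' := by
  have hmem : ∀ (g : VecL2 Ω) (i : Fin n), MemLp (fun x => g x i) 2 (volume.restrict Ω) :=
    fun g i => (Lp.memLp g).continuousLinearMap_comp (EuclideanSpace.proj i : Vec n →L[ℂ] ℂ)
  have hloc : ∀ (g : VecL2 Ω) (i : Fin n),
      LocallyIntegrableOn (fun x => g x i) Ω volume := fun g i =>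
    locallyIntegrableOn_of_locallyIntegrable_restrict
      ((hmem g i).locallyIntegrable (by norm_num))
  have key : ∀ i : Fin n, ∀ᵐ x ∂volume, x ∈ Ω → g x i - g' x i = 0 := by
    intro i
    refine hΩ.ae_eq_zero_of_integral_contDiff_smul_eq_zero ((hloc g i).sub (hloc g' i)) ?_
    intro φ hφ hc hs
    have e1 := h φ ⟨hφ, hc, hs⟩ i
    have e2 := h' φ ⟨hφ, hc, hs⟩ i
    have hφ2 : MemLp (fun x => (φ x : ℂ)) 2 (volume.restrict Ω) :=
      (hφ.continuous.memLp_of_hasCompactSupport (μ := volume.restrict Ω) hc).ofReal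
    have hint : ∀ g : VecL2 Ω,
        Integrable (fun x => g x i * (φ x : ℂ)) (volume.restrict Ω) :=
      fun g => (hmem g i).integrable_mul hφ2
    have hzero : ∀ x, x ∉ Ω → φ x • (g x i - g' x i) = 0 := fun x hx => by
      rw [image_eq_zero_of_notMem_tsupport fun hx' => hx (hs hx'), zero_smul]
    rw [← setIntegral_eq_integral_of_forall_compl_eq_zero hzero]
    have e3 : ∫ x in Ω, φ x • (g x i - g' x i) =
        ∫ x in Ω, (g x i * (φ x : ℂ) - g' x i * (φ x : ℂ)) :=
      integral_congr_ae (Eventually.of_forall fun x => by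
        simp only [Complex.real_smul]; ring)
    rw [e3, integral_sub (hint g) (hint g')]
    have e4 := e1.symm.trans e2
    rw [neg_inj] at e4
    rw [e4, sub_self]
  refine Lp.ext ?_
  refine (ae_restrict_iff' hΩ.measurableSet).2 ?_
  filter_upwards [ae_all_iff.2 key] with x hx hxΩ
  ext i
  exact sub_eq_zero.1 (hx i hxΩ)

/-- `weakDiv` picks the distributional divergence. -/
theorem weakDiv_eq {n : ℕ} {Ω : Set (Pt n)} (hΩ : IsOpen Ω) {τ : TenL2 Ω} {g : VecL2 Ω}
    (h : IsWeakDiv Ω τ g) : weakDiv τ = g :=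
  (Classical.epsilon_spec (p := IsWeakDiv Ω τ) ⟨g, h⟩).unique hΩ h

/-! ## The sesquilinear forms -/

/-- The `L²` product `(f, v) = ∫ f · v`, linear in `f` and conjugate linear in `v`. -/
def l2 {n : ℕ} {Ω : Set (Pt n)} (f v : VecL2 Ω) : ℂ := ∫ x in Ω, dot (f x) (v x)

/-- `a(ρ, τ) = (1/ν) ∫ dev ρ : dev τ`. -/
def formA {n : ℕ} {Ω : Set (Pt n)} (ν : ℝ) (ρ τ : TenL2 Ω) : ℂ :=
  (1 / ν : ℝ) * ∫ x in Ω, ddot (dev (ρ x)) (dev (τ x))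

/-- `b(τ, v) = ∫ div τ · v`. -/
def formB {n : ℕ} {Ω : Set (Pt n)} (τ : TenL2 Ω) (v : VecL2 Ω) : ℂ :=
  ∫ x in Ω, dot (weakDiv τ x) (v x)

/-- `c(v, τ) = (1/ν) ∫ dev (v ⊗ β) : τ`. -/
def formC {n : ℕ} {Ω : Set (Pt n)} (ν : ℝ) (β : Pt n → Pt n) (v : VecL2 Ω) (τ : TenL2 Ω) : ℂ :=
  (1 / ν : ℝ) * ∫ x in Ω, ddot (dev (dyad (v x) (β x))) (τ x)

/-- The best constant `c₁` with `c₁ ‖τ‖²_div ≤ ‖dev τ‖² + ‖div τ‖²` for all `τ ∈ H₀`. -/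
def coercivityConst {n : ℕ} (Ω : Set (Pt n)) : ℝ :=
  sSup {c : ℝ | ∀ τ ∈ HDiv0 Ω,
    c * divNorm τ ^ 2 ≤ (∫ x in Ω, ‖dev (τ x)‖ ^ 2) + ‖weakDiv τ‖ ^ 2}

/-- The best constant `γ` with `γ ‖q‖ ≤ sup_{τ ∈ H₀} |b(τ, q)| / ‖τ‖_div` for all `q ∈ Q`. -/
def infSupConst {n : ℕ} (Ω : Set (Pt n)) : ℝ :=
  sSup {γ : ℝ | ∀ q : VecL2 Ω, γ * ‖q‖ ≤ ⨆ τ : HDiv0 Ω, ‖formB τ.1 q‖ / divNorm τ.1}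

/-! ## The source problems

The test function of the first equation enters conjugate linearly in the primal problem and
linearly in the adjoint problem, hence the conjugates on the terms whose arguments would
otherwise be in the opposite order. -/

/-- `(σ, u) ∈ H₀ × Q` solves the pseudostress Oseen source problem with datum `f`:
`a(σ,τ) + ∫ u · div τ + c(u,τ) = 0` for `τ ∈ H₀` and `b(σ,v) = -(f,v)` for `v ∈ Q`. -/
structure IsSource {n : ℕ} (Ω : Set (Pt n)) (ν : ℝ) (β : Pt n → Pt n)
    (f : VecL2 Ω) (σ : TenL2 Ω) (u : VecL2 Ω) : Prop where
  mem : σ ∈ HDiv0 Ω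
  eq₁ : ∀ τ ∈ HDiv0 Ω, formA ν σ τ + conj (formB τ u) + formC ν β u τ = 0
  eq₂ : ∀ v : VecL2 Ω, formB σ v = -l2 f v

/-- `(σ, u) ∈ H₀ × Q` solves the adjoint source problem with datum `f`:
`a(τ,σ) + b(τ,u) - (1/ν) ∫ τ : dev (u ⊗ β) = 0` for `τ ∈ H₀` and
`∫ v · div σ = -(v,f)` for `v ∈ Q`. -/
structure IsAdjointSource {n : ℕ} (Ω : Set (Pt n)) (ν : ℝ) (β : Pt n → Pt n)
    (f : VecL2 Ω) (σ : TenL2 Ω) (u : VecL2 Ω) : Prop where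
  mem : σ ∈ HDiv0 Ω
  eq₁ : ∀ τ ∈ HDiv0 Ω, formA ν τ σ + formB τ u - conj (formC ν β u τ) = 0
  eq₂ : ∀ v : VecL2 Ω, conj (formB σ v) = -l2 v f

/-! ## Spectral notions -/

/-- The eigenspace of a bounded operator. -/
abbrev eigSpace {n : ℕ} {Ω : Set (Pt n)} (S : VecL2 Ω →L[ℂ] VecL2 Ω) (κ : ℂ) :
    Submodule ℂ (VecL2 Ω) :=
  Module.End.eigenspace (S : VecL2 Ω →ₗ[ℂ] VecL2 Ω) κ

/-- The generalized eigenspace `⋃ₖ ker (S - κ)ᵏ`, whose dimension is the algebraic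
multiplicity. -/
abbrev rootSpace {n : ℕ} {Ω : Set (Pt n)} (S : VecL2 Ω →L[ℂ] VecL2 Ω) (κ : ℂ) :
    Submodule ℂ (VecL2 Ω) :=
  Module.End.maxGenEigenspace (S : VecL2 Ω →ₗ[ℂ] VecL2 Ω) κ

end Oseen

end

/-! Both source problems are instances of one saddle point problem; conjugating the first adjoint
equation gives the primal one with the convection reversed. The first equation says that `u` has the
weak gradient `g = (dev σ + dev (u ⊗ β)) / ν`. Eliminating `σ` leaves the form `ν (g, g') - (dev (u
⊗ β), g')` on pairs (gradient, field). It is coercive there, because the inf-sup condition gives `γ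
‖u‖ ≤ ‖g‖` and the data satisfy `‖β‖ < γ ν`. Lax-Milgram yields `u`, and `σ` is recovered because
the coercivity inequality closes the range of `σ ↦ (dev σ, div σ)`. Since `β` is divergence free,
the convective term is skew on these pairs, which makes the two solution operators adjoint to each
other.

For a compact `T`, equality of multiplicities at `κ ≠ 0` follows from index zero of the powers of `T
- κ`. At `κ = 0` it follows from the equality of the kernels of `T` and `T*`: where the velocity
vanishes the convection plays no role. Equal kernels also make the eigenvalue zero semisimple for
both operators.

The hard point is that there are infinitely many nonzero eigenvalues: `T` is not self-adjoint, and a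
compact operator may have none. Three facts combine. (1) `T` gains one derivative, as measured by
plane waves on a torus containing the domain. As `∑ (1 + |k|²)⁻²` converges for `n < 4`, `T²` is
Hilbert-Schmidt. (2) The convection is of lower order than the diffusion, so `‖z‖ ‖T (1 - zT)⁻¹‖`
stays bounded for large `z` outside an arbitrarily narrow sector about the positive half line. (3)
`T` has infinite rank, since it annihilates no nonzero rotated gradient of a test function. If there
were only finitely many nonzero eigenvalues, their root vectors could be split off by a polynomial
in `T`. On the invariant complement `T` is quasi-nilpotent, so by (1) its resolvent is an entire
function of order at most four (`norm_pow_le_of_quasinilpotent`). By (2) and Phragmén-Lindelöf it is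
bounded, by Liouville it is constant, and by its decay it vanishes (`eq_zero_of_quasinilpotent`).
Then `T` has finite rank, against (3). -/

namespace CompactOp

/-! ### Riesz-Schauder theory in a Hilbert space. -/

variable {H : Type*} [NormedAddCommGroup H] [InnerProductSpace ℂ H]

/-- A compact operator is approximated in norm by its compositions with projections onto
finite-dimensional subspaces. -/
theorem exists_finiteDimensional_norm_sub_le {T : H →L[ℂ] H} (hT : IsCompactOperator T)
    {ε : ℝ} (hε : 0 < ε) :
    ∃ (V : Submodule ℂ H) (_ : FiniteDimensional ℂ V), ‖T - V.starProjection ∘L T‖ ≤ ε := by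
  obtain ⟨K, hK, hKT⟩ := hT.image_closedBall_subset_compact (𝕜₁ := ℂ) (f := (T : H →ₗ[ℂ] H)) 1
  obtain ⟨t, -, htf, htc⟩ := hK.finite_cover_balls hε
  have := htf.to_subtype
  -- The span of an `ε`-net of the image of the unit ball: projecting onto it moves a point no
  -- farther than its distance to the net.
  let V := Submodule.span ℂ t
  have : FiniteDimensional ℂ V := FiniteDimensional.span_of_finite ℂ htf
  refine ⟨V, inferInstance, ContinuousLinearMap.opNorm_le_of_unit_norm hε.le fun x hx => ?_⟩
  have hx' : T x ∈ K := hKT ⟨x, by simp [hx], rfl⟩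
  obtain ⟨y, hyt, hy⟩ := Set.mem_iUnion₂.1 (htc hx')
  have h1 : ‖T x - V.starProjection (T x)‖ ≤ ‖T x - y‖ := by
    rw [Submodule.starProjection_minimal]
    exact ciInf_le ⟨0, by rintro _ ⟨w, rfl⟩; exact norm_nonneg _⟩
      (⟨y, Submodule.subset_span hyt⟩ : V)
  calc _ ≤ ‖T x - y‖ := by simpa using h1
    _ ≤ ε := by rw [← dist_eq_norm]; exact (Metric.mem_ball.1 hy).le

theorem isCompactOperator_starProjection (V : Submodule ℂ H) [FiniteDimensional ℂ V] :
    IsCompactOperator V.starProjection := by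
  have h : IsCompactOperator (V.orthogonalProjectionOnto : H →L[ℂ] V) :=
    isCompactOperator_of_locallyCompactSpace_dom V.orthogonalProjectionOnto
  exact h.clm_comp V.subtypeL

/-- The adjoint of a compact operator is compact. -/
theorem isCompactOperator_adjoint [CompleteSpace H] {T : H →L[ℂ] H} (hT : IsCompactOperator T) :
    IsCompactOperator (ContinuousLinearMap.adjoint T) := by
  have h : ∀ k : ℕ, ∃ S : H →L[ℂ] H, IsCompactOperator S ∧
      ‖ContinuousLinearMap.adjoint T - S‖ ≤ 1 / ((k : ℝ) + 1) := by
    intro k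
    obtain ⟨V, hV, hVT⟩ := exists_finiteDimensional_norm_sub_le hT
      (Nat.one_div_pos_of_nat (n := k) (α := ℝ))
    -- The adjoint of the finite rank approximation `P T` is `T* P`, again of finite rank, and
    -- taking adjoints preserves the error.
    refine ⟨ContinuousLinearMap.adjoint T ∘L V.starProjection,
      (isCompactOperator_starProjection V).clm_comp (ContinuousLinearMap.adjoint T), ?_⟩
    have e : ContinuousLinearMap.adjoint T - ContinuousLinearMap.adjoint T ∘L V.starProjection =
        ContinuousLinearMap.adjoint (T - V.starProjection ∘L T) := by
      rw [map_sub, ContinuousLinearMap.adjoint_comp]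
      congr 2
      exact (ContinuousLinearMap.isSelfAdjoint_iff'.1 (isSelfAdjoint_starProjection V)).symm
    rw [e, LinearIsometryEquiv.norm_map]
    exact hVT
  choose S hS hST using h
  refine isCompactOperator_of_tendsto (l := atTop) (F := S) ?_ (Eventually.of_forall hS)
  rw [tendsto_iff_norm_sub_tendsto_zero]
  refine squeeze_zero (fun _ => norm_nonneg _) (fun k => ?_) tendsto_one_div_add_atTop_nhds_zero_nat
  rw [norm_sub_rev]
  exact hST k

/-- A compact operator maps no bounded sequence to a uniformly separated one. -/
theorem not_separated {T : H →L[ℂ] H} (hT : IsCompactOperator T) (x : ℕ → H)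
    (hx : ∀ m, ‖x m‖ ≤ 1) {ε : ℝ} (hε : 0 < ε)
    (h : ∀ l m, l < m → ε ≤ ‖T (x m) - T (x l)‖) : False := by
  obtain ⟨K, hK, hKT⟩ := hT.image_closedBall_subset_compact (𝕜₁ := ℂ) (f := (T : H →ₗ[ℂ] H)) 1
  obtain ⟨y, -, φ, hφ, hy⟩ := hK.tendsto_subseq (x := fun m => T (x m))
    fun m => hKT ⟨x m, by simp [hx], rfl⟩
  have hc := hy.cauchySeq
  obtain ⟨N, hN⟩ := Metric.cauchySeq_iff.1 hc ε hε
  have h1 := hN (N + 1) (by simp) N le_rfl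
  rw [dist_eq_norm] at h1
  exact absurd (h _ _ (hφ (Nat.lt_succ_self N))) (not_le.2 h1)

/-- A compact operator has no infinite strictly increasing invariant flag whose successive
diagonal entries stay away from zero. -/
theorem no_flag {T : H →L[ℂ] H} (hT : IsCompactOperator T) (V : ℕ → Submodule ℂ H)
    (hfin : ∀ m, FiniteDimensional ℂ (V m)) (hV : StrictMono V) (κ : ℕ → ℂ) {ε : ℝ} (hε : 0 < ε)
    (hκ : ∀ m, ε ≤ ‖κ m‖) (hinv : ∀ m, ∀ x ∈ V m, T x ∈ V m)
    (hdiag : ∀ m, ∀ x ∈ V (m + 1), T x - κ m • x ∈ V m) : False := by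
  -- Unit vectors of `V (m + 1)` orthogonal to `V m`. For `l < m` the difference `T (x m) - T (x l)`
  -- is `κ m • x m` plus a vector of `V m`, so by Pythagoras its norm is at least `ε`.
  have hex : ∀ m, ∃ x ∈ V (m + 1), ‖x‖ = 1 ∧ ∀ y ∈ V m, inner ℂ y x = 0 := by
    intro m
    obtain ⟨z, hz, hzn⟩ := SetLike.exists_of_lt (hV (Nat.lt_succ_self m))
    set w := z - (V m).starProjection z with hw
    have hw0 : w ≠ 0 := by
      intro h0
      rw [hw, sub_eq_zero] at h0
      exact hzn (h0 ▸ Submodule.starProjection_apply_mem _ _)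
    have hwm : w ∈ V (m + 1) := sub_mem hz
      (hV.monotone (Nat.le_succ m) (Submodule.starProjection_apply_mem _ _))
    have hwo : ∀ y ∈ V m, inner ℂ y w = 0 := fun y hy =>
      (Submodule.mem_orthogonal _ _).1 (Submodule.sub_starProjection_mem_orthogonal z) y hy
    refine ⟨((‖w‖⁻¹ : ℝ) : ℂ) • w, Submodule.smul_mem _ _ hwm, ?_, fun y hy => ?_⟩
    · rw [norm_smul]
      simp [norm_ne_zero_iff.2 hw0]
    · rw [inner_smul_right, hwo y hy, mul_zero]
  choose x hxm hx1 hxo using hex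
  refine not_separated hT x (fun m => (hx1 m).le) hε fun l m hlm => ?_
  have hy : (T (x m) - κ m • x m) - T (x l) ∈ V m :=
    sub_mem (hdiag m _ (hxm m)) (hV.monotone (Nat.succ_le_of_lt hlm) (hinv _ _ (hxm l)))
  set y := (T (x m) - κ m • x m) - T (x l) with hydef
  have e : T (x m) - T (x l) = y + κ m • x m := by rw [hydef]; abel
  have ho : inner ℂ y (κ m • x m) = 0 := by rw [inner_smul_right, hxo m y hy, mul_zero]
  have hp := norm_add_sq_eq_norm_sq_add_norm_sq_of_inner_eq_zero _ _ ho
  have h2 : ‖κ m • x m‖ = ‖κ m‖ := by rw [norm_smul, hx1, mul_one]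
  rw [e]
  refine (hκ m).trans ?_
  rw [← h2]
  nlinarith [norm_nonneg (y + κ m • x m), norm_nonneg (κ m • x m), mul_self_nonneg ‖y‖]

/-- The kernel of a nonzero scalar plus a compact operator is finite-dimensional. -/
theorem finiteDimensional_ker {K : H →L[ℂ] H} [CompleteSpace H] (hK : IsCompactOperator K) {c : ℂ}
    (hc : c ≠ 0) : FiniteDimensional ℂ (LinearMap.ker ((K - c • 1 : H →L[ℂ] H) : H →ₗ[ℂ] H)) := by
  have h := ContinuousLinearMap.finite_dimensional_eigenspace hK c hc
  have e : LinearMap.ker ((K - c • 1 : H →L[ℂ] H) : H →ₗ[ℂ] H) =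
      Module.End.eigenspace (K : H →ₗ[ℂ] H) c := by
    ext x
    simp [sub_eq_zero]
  rw [e]
  exact h

/-- Powers of a scalar plus a compact operator are of the same form. -/
theorem exists_compact_pow {K : H →L[ℂ] H} (hK : IsCompactOperator K) (c : ℂ) (m : ℕ) :
    ∃ K' : H →L[ℂ] H, IsCompactOperator K' ∧
      (K - c • (1 : H →L[ℂ] H)) ^ m = K' - (-(-c) ^ m) • (1 : H →L[ℂ] H) := by
  induction m with
  | zero => exact ⟨0, isCompactOperator_zero, by simp⟩
  | succ m ih =>
    obtain ⟨K', hK', e⟩ := ih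
    -- The scalar part of the power is `(-c) ^ m`; the double sign puts it in the form "compact
    -- minus scalar" used by the kernel lemmas.
    refine ⟨(K' - (-(-c) ^ m) • (1 : H →L[ℂ] H)) ∘L K + -(c • K'), ?_, ?_⟩
    · exact (hK.clm_comp (K' - (-(-c) ^ m) • (1 : H →L[ℂ] H))).add (hK'.smul c).neg
    · rw [pow_succ, e]
      ext x
      simp only [mul_apply_eq_comp, sub_apply,
        add_apply, neg_apply,
        smul_apply, one_apply_eq_self,
        ContinuousLinearMap.comp_apply, map_sub, map_smul, pow_succ]
      module

/-- The ascent of a nonzero scalar plus a compact operator is finite. -/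
theorem exists_ker_pow_stable {K : H →L[ℂ] H} [CompleteSpace H] (hK : IsCompactOperator K) {c : ℂ}
    (hc : c ≠ 0) : ∃ m, ∀ x, ((K - c • (1 : H →L[ℂ] H)) ^ (m + 1)) x = 0 →
      ((K - c • (1 : H →L[ℂ] H)) ^ m) x = 0 := by
  by_contra! hcon
  set A := K - c • 1 with hA
  -- If the kernels of the powers never stabilized, they would form a flag with all diagonal entries
  -- equal to `c`, contrary to `no_flag`.
  let V : ℕ → Submodule ℂ H := fun m => LinearMap.ker ((A ^ m : H →L[ℂ] H) : H →ₗ[ℂ] H)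
  have hmem : ∀ m x, x ∈ V m ↔ (A ^ m) x = 0 := fun m x => Iff.rfl
  have hcomm : ∀ m x, (A ^ (m + 1)) x = (A ^ m) (A x) := fun m x => by rw [pow_succ]; rfl
  have hfin : ∀ m, FiniteDimensional ℂ (V m) := by
    intro m
    obtain ⟨K', hK', e⟩ := exists_compact_pow hK c m
    have h : ∀ B : H →L[ℂ] H, B = K' - (-(-c) ^ m) • (1 : H →L[ℂ] H) →
        FiniteDimensional ℂ (LinearMap.ker (B : H →ₗ[ℂ] H)) := by
      rintro _ rfl
      exact finiteDimensional_ker hK' (neg_ne_zero.2 (pow_ne_zero _ (neg_ne_zero.2 hc)))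
    exact h _ e
  have hlt : StrictMono V := strictMono_nat_of_lt_succ fun m => by
    refine lt_of_le_of_ne (fun x hx => ?_) fun he => ?_
    · rw [hmem] at hx ⊢
      rw [pow_succ', mul_apply_eq_comp, hx, map_zero]
    · obtain ⟨x, hx, hx'⟩ := hcon m
      exact hx' ((hmem m x).1 (he ▸ (hmem (m + 1) x).2 hx))
  have hAx : ∀ x, A x = K x - c • x := fun x => by simp [hA]
  have hdiag : ∀ m, ∀ x ∈ V (m + 1), K x - c • x ∈ V m := fun m x hx => by
    rw [hmem, ← hAx, ← hcomm]
    exact hx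
  refine no_flag hK V hfin hlt (fun _ => c) (norm_pos_iff.2 hc) (fun _ => le_rfl) (fun m x hx => ?_)
    hdiag
  have h1 : K x - c • x ∈ V m := hdiag m x (hlt.monotone (Nat.le_succ m) hx)
  simpa using add_mem h1 (Submodule.smul_mem _ c hx)

/-- Eigenvalues of a compact operator accumulate only at zero. -/
theorem finite_eigenvalues {T : H →L[ℂ] H} (hT : IsCompactOperator T) {ε : ℝ} (hε : 0 < ε) :
    {κ : ℂ | ε ≤ ‖κ‖ ∧ Module.End.HasEigenvalue (T : H →ₗ[ℂ] H) κ}.Finite := by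
  by_contra hinf
  let f := Set.Infinite.natEmbedding _ hinf
  let κ : ℕ → ℂ := fun m => (f m).1
  have hκinj : Function.Injective κ := fun a b h => f.injective (Subtype.ext h)
  have hκ : ∀ m, ε ≤ ‖κ m‖ := fun m => (f m).2.1
  have hev : ∀ m, Module.End.HasEigenvalue (T : H →ₗ[ℂ] H) (κ m) := fun m => (f m).2.2
  choose x hx using fun m => (hev m).exists_hasEigenvector
  have hTx : ∀ m, T (x m) = κ m • x m := fun m => (hx m).apply_eq_smul
  have hli : LinearIndependent ℂ x :=
    Module.End.eigenvectors_linearIndependent' (T : H →ₗ[ℂ] H) κ hκinj x hx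
  -- Infinitely many eigenvalues of modulus at least `ε` would give a forbidden flag: the spans of
  -- the first `m` eigenvectors.
  let V : ℕ → Submodule ℂ H := fun m => Submodule.span ℂ (x '' Set.Iio m)
  have hmono : Monotone V := fun a b hab =>
    Submodule.span_mono (Set.image_mono (Set.Iio_subset_Iio hab))
  have hinv : ∀ m, ∀ y ∈ V m, T y ∈ V m := by
    intro m y hy
    have : V m ≤ (V m).comap (T : H →ₗ[ℂ] H) := by
      refine Submodule.span_le.2 ?_
      rintro _ ⟨l, hl, rfl⟩
      change T (x l) ∈ V m
      rw [hTx]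
      exact Submodule.smul_mem _ _ (Submodule.subset_span ⟨l, hl, rfl⟩)
    exact this hy
  refine no_flag hT V (fun m => FiniteDimensional.span_of_finite ℂ ((Set.finite_Iio m).image x))
    (strictMono_nat_of_lt_succ fun m => lt_of_le_of_ne (hmono (Nat.le_succ m)) fun he => ?_)
    κ hε hκ hinv fun m y hy => ?_
  · have h1 : x m ∈ V m := by
      rw [he]; exact Submodule.subset_span ⟨m, Nat.lt_succ_self m, rfl⟩
    exact (hli.notMem_span_image (s := Set.Iio m) (by simp)) h1
  · have : V (m + 1) ≤ (V m).comap ((T : H →ₗ[ℂ] H) - κ m • LinearMap.id) := by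
      refine Submodule.span_le.2 ?_
      rintro _ ⟨l, hl, rfl⟩
      change T (x l) - κ m • x l ∈ V m
      rcases (Nat.lt_succ_iff.1 hl).lt_or_eq with h | rfl
      · have hm : x l ∈ V m := Submodule.subset_span ⟨l, h, rfl⟩
        exact sub_mem (hinv m _ hm) (Submodule.smul_mem _ _ hm)
      · rw [hTx, sub_self]; exact zero_mem _
    exact this hy

/-- Injectivity implies bijectivity for a nonzero scalar plus a compact operator. -/
theorem isUnit_of_injective [CompleteSpace H] {K : H →L[ℂ] H} (hK : IsCompactOperator K) {c : ℂ}
    (hc : c ≠ 0) (hinj : ∀ x, (K - c • 1) x = 0 → x = 0) : IsUnit (K - c • 1) := by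
  rcases hK.hasEigenvalue_or_mem_resolventSet hc with h | h
  · obtain ⟨x, hx⟩ := h.exists_hasEigenvector
    refine absurd (hinj x ?_) hx.2
    have := hx.apply_eq_smul
    simpa [sub_eq_zero] using this
  · rw [spectrum.mem_resolventSet_iff, ← IsUnit.neg_iff] at h
    convert h using 1
    ext x
    simp

/-- If the kernel of the adjoint were larger, an injective but not surjective map from the kernel
`N` to the adjoint kernel `M`, preceded by the projection onto `N`, would be a finite rank `F` with
`A + F` injective, hence bijective by the Fredholm alternative. But the range of `A` is orthogonal
to `M`, so the part of `M` missed by `F` could not be reached. -/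
theorem finrank_ker_adjoint_le [CompleteSpace H] {K : H →L[ℂ] H} (hK : IsCompactOperator K) {c : ℂ}
    (hc : c ≠ 0) :
    Module.finrank ℂ
      (LinearMap.ker ((ContinuousLinearMap.adjoint (K - c • 1) : H →L[ℂ] H) : H →ₗ[ℂ] H)) ≤
    Module.finrank ℂ (LinearMap.ker ((K - c • 1 : H →L[ℂ] H) : H →ₗ[ℂ] H)) := by
  set A := K - c • 1 with hA
  set N := LinearMap.ker (A : H →ₗ[ℂ] H) with hN
  set M := LinearMap.ker ((ContinuousLinearMap.adjoint A : H →L[ℂ] H) : H →ₗ[ℂ] H) with hM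
  have hMo : ∀ y ∈ M, ∀ x, inner ℂ y (A x) = 0 := fun y hy x => by
    rw [← ContinuousLinearMap.adjoint_inner_left]
    have : ContinuousLinearMap.adjoint A y = 0 := hy
    rw [this, inner_zero_left]
  have : FiniteDimensional ℂ N := finiteDimensional_ker hK hc
  have : FiniteDimensional ℂ M := by
    have h := finiteDimensional_ker (isCompactOperator_adjoint hK) (c := conj c) (by simpa using hc)
    have e : ContinuousLinearMap.adjoint A = ContinuousLinearMap.adjoint K - conj c • 1 := by
      rw [hA, map_sub]
      congr 1
      have : ContinuousLinearMap.adjoint (1 : H →L[ℂ] H) = 1 := star_one (H →L[ℂ] H)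
      rw [map_smulₛₗ, this]
    rw [hM, e]
    exact h
  by_contra! hlt
  obtain ⟨Φ, hΦ⟩ := Module.Free.exists_linearMap_injective_of_rank_lt (R := ℂ) (M := N) (N := M) (by
    rw [← Module.finrank_eq_rank, ← Module.finrank_eq_rank]; exact_mod_cast hlt)
  have hns : ¬ Function.Surjective Φ := fun hs => by
    have := LinearMap.finrank_le_finrank_of_surjective hs
    omega
  let F : H →L[ℂ] H := M.subtypeL ∘L (LinearMap.toContinuousLinearMap Φ) ∘L N.orthogonalProjectionOnto
  have hF : IsCompactOperator F := by
    have h : IsCompactOperator (N.orthogonalProjectionOnto : H →L[ℂ] N) :=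
      isCompactOperator_of_locallyCompactSpace_dom N.orthogonalProjectionOnto
    exact h.clm_comp (M.subtypeL ∘L (LinearMap.toContinuousLinearMap Φ))
  have hFM : ∀ x, F x ∈ M := fun x => (Φ (N.orthogonalProjectionOnto x)).2
  have hsum : ∀ x, ∀ y ∈ M, A x + y = 0 → A x = 0 ∧ y = 0 := by
    intro x y hy h
    have h1 : inner ℂ y (A x + y) = 0 := by rw [h, inner_zero_right]
    rw [inner_add_right, hMo y hy, zero_add, inner_self_eq_zero] at h1
    exact ⟨by simpa [h1] using h, h1⟩
  have hu : IsUnit (K + F - c • 1) := by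
    refine isUnit_of_injective (hK.add hF) hc fun x hx => ?_
    have hx' : A x + F x = 0 := by
      rw [← hx, hA]; simp only [sub_apply, add_apply]; abel
    obtain ⟨h1, h2⟩ := hsum x _ (hFM x) hx'
    have h3 : N.orthogonalProjectionOnto x = 0 := by
      apply hΦ
      rw [map_zero]
      exact Subtype.ext h2
    have h4 : x ∈ N := h1
    have h5 := Submodule.orthogonalProjectionOnto_mem_subspace_eq_self (⟨x, h4⟩ : N)
    simp only at h5
    rw [h3] at h5
    exact congrArg Subtype.val h5.symm
  refine hns fun y => ?_
  obtain ⟨x, hx⟩ := ((ContinuousLinearMap.isUnit_iff_bijective).1 hu).2 (y : H)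
  have hx' : A x + (F x - y) = 0 := by
    rw [← hx, hA]; simp only [sub_apply, add_apply]; abel
  obtain ⟨-, h2⟩ := hsum x _ (sub_mem (hFM x) y.2) hx'
  exact ⟨N.orthogonalProjectionOnto x, Subtype.ext (sub_eq_zero.1 h2)⟩

/-- A nonzero scalar plus a compact operator has index zero. -/
theorem finrank_ker_adjoint [CompleteSpace H] {K : H →L[ℂ] H} (hK : IsCompactOperator K) {c : ℂ}
    (hc : c ≠ 0) :
    Module.finrank ℂ
      (LinearMap.ker ((ContinuousLinearMap.adjoint (K - c • 1) : H →L[ℂ] H) : H →ₗ[ℂ] H)) =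
    Module.finrank ℂ (LinearMap.ker ((K - c • 1 : H →L[ℂ] H) : H →ₗ[ℂ] H)) := by
  refine le_antisymm (finrank_ker_adjoint_le hK hc) ?_
  have e : ContinuousLinearMap.adjoint (K - c • 1) =
      ContinuousLinearMap.adjoint K - conj c • 1 := by
    rw [map_sub]
    congr 1
    have : ContinuousLinearMap.adjoint (1 : H →L[ℂ] H) = 1 := star_one (H →L[ℂ] H)
    rw [map_smulₛₗ, this]
  have h := finrank_ker_adjoint_le (isCompactOperator_adjoint hK) (c := conj c) (by simpa using hc)
  rw [← e, ContinuousLinearMap.adjoint_adjoint] at h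
  exact h

end CompactOp

/-! ### Schur triangularization and factorial decay of powers of quasi-nilpotent operators. -/

namespace CompactOp

/-- Schur triangularization with respect to an orthonormal basis. -/
theorem exists_triangular (d : ℕ) {V : Type*} [NormedAddCommGroup V] [InnerProductSpace ℂ V]
    [FiniteDimensional ℂ V] (hd : Module.finrank ℂ V = d) (M : V →ₗ[ℂ] V) :
    ∃ b : OrthonormalBasis (Fin d) ℂ V, (∀ i j, j < i → inner ℂ (b i) (M (b j)) = 0) ∧
      ∀ i, Module.End.HasEigenvalue M (inner ℂ (b i) (M (b i))) := by
  induction d generalizing V with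
  | zero => exact ⟨(stdOrthonormalBasis ℂ V).reindex (finCongr hd), fun i => i.elim0, fun i => i.elim0⟩
  | succ d ih =>
    have hnt : Nontrivial V := Module.nontrivial_of_finrank_pos (R := ℂ) (by omega)
    obtain ⟨κ, hκ⟩ := Module.End.exists_eigenvalue M
    have hnsurj : LinearMap.range (M - κ • LinearMap.id) ≠ ⊤ := fun h => by
      obtain ⟨x, hx⟩ := hκ.exists_hasEigenvector
      refine hx.2 ((LinearMap.injective_iff_surjective.2 (LinearMap.range_eq_top.1 h)) ?_)
      simp [hx.apply_eq_smul]
    -- A vector orthogonal to the range of `M - κ` is an eigenvector of the adjoint, so its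
    -- orthogonal complement is invariant. It is placed last in the basis, which keeps the matrix
    -- upper triangular.
    obtain ⟨e₀, he₀, he₀n⟩ : ∃ e ∈ (LinearMap.range (M - κ • LinearMap.id))ᗮ, e ≠ 0 := by
      by_contra! h
      exact hnsurj (Submodule.orthogonal_eq_bot_iff.1 ((Submodule.eq_bot_iff _).2 h))
    set e : V := ((‖e₀‖⁻¹ : ℝ) : ℂ) • e₀ with he
    have hen : ‖e‖ = 1 := by
      rw [he, norm_smul]
      simp [norm_ne_zero_iff.2 he₀n]
    have heo : ∀ x, inner ℂ e (M x) = κ * inner ℂ e x := fun x => by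
      have h : inner ℂ ((M - κ • (LinearMap.id : V →ₗ[ℂ] V)) x) e = 0 :=
        (Submodule.mem_orthogonal _ _).1 (Submodule.smul_mem _ _ he₀) _ ⟨x, rfl⟩
      rw [inner_eq_zero_symm] at h
      simpa [inner_sub_right, inner_smul_right, sub_eq_zero] using h
    let W : Submodule ℂ V := (ℂ ∙ e)ᗮ
    have hW : ∀ x, x ∈ W ↔ inner ℂ e x = 0 := fun x => Submodule.mem_orthogonal_singleton_iff_inner_right
    have hfact : Fact (Module.finrank ℂ V = d + 1) := ⟨hd⟩
    have hWd : Module.finrank ℂ W = d :=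
      Submodule.finrank_orthogonal_span_singleton (n := d) (fun h => by simp [h] at hen)
    have hinv : ∀ x ∈ W, M x ∈ W := fun x hx => by
      rw [hW] at hx ⊢
      rw [heo, hx, mul_zero]
    obtain ⟨b', htri, hev⟩ := ih hWd (M.restrict hinv)
    let f : Fin (d + 1) → V := Fin.snoc (fun i => (b' i : V)) e
    have hfc : ∀ i : Fin d, f i.castSucc = b' i := fun i => by simp [f]
    have hfl : f (Fin.last d) = e := by simp [f]
    have hWe : ∀ w : W, inner ℂ e (w : V) = 0 := fun w => (hW _).1 w.2
    have hon : Orthonormal ℂ f := by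
      rw [orthonormal_iff_ite]
      intro i j
      induction i using Fin.lastCases with
      | last =>
        induction j using Fin.lastCases with
        | last => simp [hfl, inner_self_eq_norm_sq_to_K, hen]
        | cast j => rw [hfl, hfc, hWe, if_neg (Fin.castSucc_lt_last j).ne']
      | cast i =>
        induction j using Fin.lastCases with
        | last =>
          rw [hfl, hfc, inner_eq_zero_symm.1 (hWe _), if_neg (Fin.castSucc_lt_last i).ne]
        | cast j =>
          have := (orthonormal_iff_ite.1 b'.orthonormal) i j
          rw [hfc, hfc, ← Submodule.coe_inner, this]
          simp
    have hspan : ⊤ ≤ Submodule.span ℂ (Set.range f) :=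
      (hon.linearIndependent.span_eq_top_of_card_eq_finrank' (by simp [hd])).ge
    refine ⟨OrthonormalBasis.mk hon hspan, ?_, ?_⟩
    · intro i j hij
      simp only [OrthonormalBasis.coe_mk]
      induction j using Fin.lastCases with
      | last => exact absurd hij (not_lt.2 (Fin.le_last i))
      | cast j =>
        induction i using Fin.lastCases with
        | last => rw [hfl, hfc]; exact hWe ⟨_, hinv _ (b' j).2⟩
        | cast i => rw [hfc, hfc]; exact htri i j (by simpa using hij)
    · intro i
      simp only [OrthonormalBasis.coe_mk]
      induction i using Fin.lastCases with
      | last =>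
        rw [hfl, heo, inner_self_eq_norm_sq_to_K, hen]
        simpa using hκ
      | cast i =>
        rw [hfc]
        obtain ⟨x, hx⟩ := (hev i).exists_hasEigenvector
        refine Module.End.hasEigenvalue_of_hasEigenvector (x := (x : V)) ⟨?_, by simpa using hx.2⟩
        rw [Module.End.mem_eigenspace_iff]
        have := congrArg Subtype.val hx.apply_eq_smul
        exact this

/-- These are the first two terms of the binomial expansion; the omitted ones are nonnegative. -/
theorem pow_succ_add_le {x r : ℝ} (hx : 0 ≤ x) (hr : 0 ≤ r) (k : ℕ) :
    x ^ (k + 1) + (k + 1) * (r * x ^ k) ≤ (r + x) ^ (k + 1) := by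
  induction k with
  | zero => simp [add_comm]
  | succ k ih =>
    have h1 : (0 : ℝ) ≤ r * x ^ k := by positivity
    have h2 := mul_le_mul_of_nonneg_right ih (add_nonneg hr hx)
    have h3 : (0 : ℝ) ≤ (k + 1) * (r * x ^ k) * r := by positivity
    push_cast
    rw [pow_succ (r + x)]
    refine le_trans ?_ h2
    have e : (x ^ (k + 1) + (k + 1) * (r * x ^ k)) * (r + x) =
      x ^ (k + 1 + 1) + (k + 1 + 1) * (r * x ^ (k + 1)) + (k + 1) * (r * x ^ k) * r := by ring
    rw [e]
    linarith

/-- Discrete form of `∫ R' R ^ k = R ^ (k + 1) / (k + 1)`, with `R` the strict tail sum. The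
induction inserts a new minimum, whose tail is the whole previous set. Iterating the bound produces
the factorial in the decay of powers. -/
theorem sum_mul_tail_pow_le {ι : Type*} [LinearOrder ι] (r : ι → ℝ) (hr : ∀ i, 0 ≤ r i) (k : ℕ)
    (s : Finset ι) :
    ∑ j ∈ s, r j * (∑ l ∈ s with j < l, r l) ^ k ≤ (∑ j ∈ s, r j) ^ (k + 1) / (k + 1) := by
  have hk : (0 : ℝ) < k + 1 := by positivity
  induction s using Finset.induction_on_min with
  | empty => simp
  | insert a s ha ih =>
    have hna : a ∉ s := fun h => lt_irrefl _ (ha a h)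
    rw [Finset.sum_insert hna, Finset.sum_insert hna]
    have e1 : (insert a s).filter (a < ·) = s := by
      ext l
      simp only [Finset.mem_filter, Finset.mem_insert]
      constructor
      · rintro ⟨rfl | h, h'⟩
        · exact absurd h' (lt_irrefl _)
        · exact h
      · exact fun h => ⟨Or.inr h, ha l h⟩
    have e2 : ∀ j ∈ s, (insert a s).filter (j < ·) = s.filter (j < ·) := by
      intro j hj
      ext l
      simp only [Finset.mem_filter, Finset.mem_insert]
      constructor
      · rintro ⟨rfl | h, h'⟩
        · exact absurd h' (ha j hj).le.not_gt
        · exact ⟨h, h'⟩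
      · exact fun h => ⟨Or.inr h.1, h.2⟩
    have e3 : ∑ j ∈ s, r j * (∑ l ∈ insert a s with j < l, r l) ^ k =
        ∑ j ∈ s, r j * (∑ l ∈ s with j < l, r l) ^ k :=
      Finset.sum_congr rfl fun j hj => by rw [e2 j hj]
    rw [e1, e3]
    have h1 := pow_succ_add_le (Finset.sum_nonneg fun j (_ : j ∈ s) => hr j) (hr a) k
    rw [le_div_iff₀ hk] at ih ⊢
    nlinarith

variable {V : Type*} [NormedAddCommGroup V] [InnerProductSpace ℂ V]

/-- Powers of a strictly triangular operator decay factorially in terms of its Hilbert-Schmidt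
norm. -/
theorem norm_pow_sq_le_of_strictly_triangular {d : ℕ} (b : OrthonormalBasis (Fin d) ℂ V)
    (N : V →ₗ[ℂ] V) (hN : ∀ i j, j ≤ i → inner ℂ (b i) (N (b j)) = 0) {S : ℝ}
    (hS : ∑ i, ∑ j, ‖(inner ℂ (b i) (N (b j)) : ℂ)‖ ^ 2 ≤ S) (k : ℕ) (x : V) :
    ‖(N ^ k) x‖ ^ 2 ≤ S ^ k / k.factorial * ‖x‖ ^ 2 := by
  set r : Fin d → ℝ := fun i => ∑ j, ‖(inner ℂ (b i) (N (b j)) : ℂ)‖ ^ 2 with hr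
  have hr0 : ∀ i, 0 ≤ r i := fun i => Finset.sum_nonneg fun j _ => by positivity
  -- Strict triangularity: coordinate `i` of `N y` involves only the coordinates `j > i` of `y`.
  have hexp : ∀ i y, inner ℂ (b i) (N y) =
      ∑ j ∈ Finset.univ.filter (i < ·), inner ℂ (b j) y * inner ℂ (b i) (N (b j)) := by
    intro i y
    conv_lhs => rw [← b.sum_repr' y]
    rw [map_sum, inner_sum, Finset.sum_filter]
    refine Finset.sum_congr rfl fun j _ => ?_
    rw [map_smul, inner_smul_right]
    split_ifs with h
    · rfl
    · rw [hN i j (not_lt.1 h), mul_zero]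
  have hstep : ∀ i y, ‖(inner ℂ (b i) (N y) : ℂ)‖ ^ 2 ≤
      r i * ∑ j ∈ Finset.univ.filter (i < ·), ‖(inner ℂ (b j) y : ℂ)‖ ^ 2 := by
    intro i y
    rw [hexp]
    calc _ ≤ (∑ j ∈ Finset.univ.filter (i < ·), ‖(inner ℂ (b i) (N (b j)) : ℂ)‖ *
          ‖(inner ℂ (b j) y : ℂ)‖) ^ 2 := by
          gcongr
          refine (norm_sum_le _ _).trans (le_of_eq ?_)
          exact Finset.sum_congr rfl fun j _ => by rw [norm_mul, mul_comm]
      _ ≤ _ := Finset.sum_mul_sq_le_sq_mul_sq _ _ _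
      _ ≤ _ := by
        refine mul_le_mul_of_nonneg_right ?_ (Finset.sum_nonneg fun j _ => by positivity)
        exact Finset.sum_le_sum_of_subset_of_nonneg (Finset.filter_subset _ _)
          fun _ _ _ => by positivity
  -- Cauchy-Schwarz in each row, iterated: every further power contributes a row norm summed over a
  -- strictly later tail, so increasing chains of indices appear and yield `1 / k!`.
  have hpt : ∀ (k : ℕ) i, ‖(inner ℂ (b i) ((N ^ (k + 1)) x) : ℂ)‖ ^ 2 ≤
      r i * ((∑ l ∈ Finset.univ.filter (i < ·), r l) ^ k / k.factorial * ‖x‖ ^ 2) := by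
    intro k
    induction k with
    | zero =>
      intro i
      refine (hstep i _).trans (mul_le_mul_of_nonneg_left ?_ (hr0 i))
      simp only [pow_zero, Nat.factorial_zero, Nat.cast_one, div_one, one_mul]
      rw [← b.sum_sq_norm_inner_right x]
      exact Finset.sum_le_sum_of_subset_of_nonneg (Finset.filter_subset _ _)
          fun _ _ _ => by positivity
    | succ k ih =>
      intro i
      rw [pow_succ' N, Module.End.mul_apply]
      refine (hstep i _).trans (mul_le_mul_of_nonneg_left ?_ (hr0 i))
      refine (Finset.sum_le_sum fun j _ => ih j).trans ?_
      have h1 := sum_mul_tail_pow_le r hr0 k (Finset.univ.filter (i < ·))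
      have e1 : ∑ j ∈ Finset.univ.filter (i < ·),
          r j * ((∑ l ∈ Finset.univ.filter (j < ·), r l) ^ k / k.factorial * ‖x‖ ^ 2) =
          (∑ j ∈ Finset.univ.filter (i < ·),
            r j * (∑ l ∈ (Finset.univ.filter (i < ·)) with j < l, r l) ^ k) *
            ((k.factorial : ℝ)⁻¹ * ‖x‖ ^ 2) := by
        rw [Finset.sum_mul]
        refine Finset.sum_congr rfl fun j hj => ?_
        have : (Finset.univ.filter (i < ·)).filter (j < ·) = Finset.univ.filter (j < ·) := by
          ext l
          simp only [Finset.mem_filter, Finset.mem_univ, true_and] at hj ⊢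
          exact ⟨fun h => h.2, fun h => ⟨hj.trans h, h⟩⟩
        rw [this]; ring
      rw [e1]
      refine (mul_le_mul_of_nonneg_right h1 (by positivity)).trans (le_of_eq ?_)
      rw [Nat.factorial_succ]
      push_cast
      field_simp
  have hSr : ∑ i, r i ≤ S := hS
  cases k with
  | zero => simp
  | succ k =>
    rw [← b.sum_sq_norm_inner_right ((N ^ (k + 1)) x)]
    refine (Finset.sum_le_sum fun i _ => hpt k i).trans ?_
    have h1 := sum_mul_tail_pow_le r hr0 k Finset.univ
    have h2 : (∑ i, r i) ^ (k + 1) ≤ S ^ (k + 1) :=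
      pow_le_pow_left₀ (Finset.sum_nonneg fun i _ => hr0 i) hSr _
    calc _ = (∑ j, r j * (∑ l ∈ Finset.univ.filter (j < ·), r l) ^ k) *
            ((k.factorial : ℝ)⁻¹ * ‖x‖ ^ 2) := by
          rw [Finset.sum_mul]
          exact Finset.sum_congr rfl fun j _ => by ring
      _ ≤ (S ^ (k + 1) / (k + 1)) * ((k.factorial : ℝ)⁻¹ * ‖x‖ ^ 2) := by
          refine mul_le_mul_of_nonneg_right (h1.trans ?_) (by positivity)
          gcongr
      _ = _ := by
        rw [Nat.factorial_succ]
        push_cast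
        field_simp

/-- Powers of an operator on a finite-dimensional space whose eigenvalues are small. -/
theorem norm_pow_le_of_small_eigenvalues [FiniteDimensional ℂ V] (M : V →ₗ[ℂ] V) {C δ B : ℝ}
    (hC : 0 ≤ C)
    (hHS : ∀ (d : ℕ) (e : Fin d → V), Orthonormal ℂ e → ∑ i, ‖M (e i)‖ ^ 2 ≤ C ^ 2)
    (hδ : 0 ≤ δ) (hev : ∀ κ, Module.End.HasEigenvalue M κ → ‖κ‖ ≤ δ)
    (hMB : ∀ x, ‖M x‖ + δ * ‖x‖ ≤ B * ‖x‖) (hB : 1 ≤ B) (k : ℕ) (x : V) :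
    ‖(M ^ k) x‖ ≤ (C ^ k / √(k.factorial) + k * δ * B ^ k) * ‖x‖ := by
  obtain ⟨b, htri, hdiag⟩ := exists_triangular _ rfl M
  set κ : Fin (Module.finrank ℂ V) → ℂ := fun i => inner ℂ (b i) (M (b i)) with hκ
  -- The diagonal of the triangular form. Its entries are eigenvalues of `M`, so its norm is at most
  -- `δ`; the rest `N` is strictly triangular with Hilbert-Schmidt norm at most that of `M`.
  let D : V →ₗ[ℂ] V := b.toBasis.constr ℂ fun j => κ j • b j
  have hDb : ∀ j, D (b j) = κ j • b j := fun j => by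
    simpa only [OrthonormalBasis.coe_toBasis] using
      b.toBasis.constr_basis ℂ (fun j => κ j • b j) j
  have hDi : ∀ i y, inner ℂ (b i) (D y) = κ i * inner ℂ (b i) y := by
    intro i y
    conv_lhs => rw [← b.sum_repr' y]
    rw [map_sum, inner_sum, Finset.sum_eq_single i]
    · rw [map_smul, hDb, inner_smul_right, inner_smul_right, b.inner_eq_one]; ring
    · intro j _ hji
      rw [map_smul, hDb, inner_smul_right, inner_smul_right, b.inner_eq_zero hji.symm]; ring
    · simp
  have hDn : ∀ y, ‖D y‖ ≤ δ * ‖y‖ := by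
    intro y
    refine le_of_sq_le_sq ?_ (by positivity)
    rw [mul_pow, ← b.sum_sq_norm_inner_right (D y), ← b.sum_sq_norm_inner_right y, Finset.mul_sum]
    refine Finset.sum_le_sum fun i _ => ?_
    rw [hDi, norm_mul, mul_pow]
    gcongr
    exact hev _ (hdiag i)
  let N : V →ₗ[ℂ] V := M - D
  have hN : ∀ i j, j ≤ i → inner ℂ (b i) (N (b j)) = 0 := by
    intro i j hij
    simp only [N, LinearMap.sub_apply, inner_sub_right, hDb, inner_smul_right]
    rcases hij.lt_or_eq with h | rfl
    · rw [htri i j h, b.inner_eq_zero h.ne']; ring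
    · rw [b.inner_eq_one]; simp [hκ]
  have hNle : ∀ i j, ‖(inner ℂ (b i) (N (b j)) : ℂ)‖ ^ 2 ≤ ‖(inner ℂ (b i) (M (b j)) : ℂ)‖ ^ 2 := by
    intro i j
    rcases le_or_gt j i with h | h
    · rw [hN i j h]; simp
    · simp only [N, LinearMap.sub_apply, inner_sub_right, hDb, inner_smul_right]
      rw [b.inner_eq_zero h.ne]; simp
  have hNS : ∑ i, ∑ j, ‖(inner ℂ (b i) (N (b j)) : ℂ)‖ ^ 2 ≤ C ^ 2 := by
    refine (Finset.sum_le_sum fun i _ => Finset.sum_le_sum fun j _ => hNle i j).trans ?_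
    rw [Finset.sum_comm]
    refine le_trans (le_of_eq ?_) (hHS _ b b.orthonormal)
    exact Finset.sum_congr rfl fun j _ => b.sum_sq_norm_inner_right _
  have hNk : ∀ (k : ℕ) y, ‖(N ^ k) y‖ ≤ C ^ k / √(k.factorial) * ‖y‖ := by
    intro k y
    refine le_of_sq_le_sq ?_ (by positivity)
    refine (norm_pow_sq_le_of_strictly_triangular b N hN hNS k y).trans (le_of_eq ?_)
    rw [mul_pow, div_pow, Real.sq_sqrt (by positivity)]
    ring
  have hMB' : ∀ y, ‖M y‖ ≤ B * ‖y‖ := fun y => by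
    have := hMB y
    have : 0 ≤ δ * ‖y‖ := by positivity
    linarith
  have hNB : ∀ y, ‖N y‖ ≤ B * ‖y‖ := fun y => by
    refine (norm_sub_le _ _).trans ?_
    linarith [hMB y, hDn y]
  have hNkB : ∀ (k : ℕ) y, ‖(N ^ k) y‖ ≤ B ^ k * ‖y‖ := by
    intro k y
    induction k with
    | zero => simp
    | succ k ih =>
      rw [pow_succ', Module.End.mul_apply, pow_succ', mul_assoc]
      exact (hNB _).trans (mul_le_mul_of_nonneg_left ih (by linarith))
  -- Telescoping `M ^ (k + 1) - N ^ (k + 1) = M (M ^ k - N ^ k) + D N ^ k`. The condition `1 ≤ B`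
  -- absorbs the last term into the power `B ^ (k + 1)`.
  have hdiff : ∀ (k : ℕ) y, ‖(M ^ k) y - (N ^ k) y‖ ≤ k * δ * B ^ k * ‖y‖ := by
    intro k y
    induction k with
    | zero => simp
    | succ k ih =>
      have e : (M ^ (k + 1)) y - (N ^ (k + 1)) y =
          M ((M ^ k) y - (N ^ k) y) + D ((N ^ k) y) := by
        rw [pow_succ', pow_succ', Module.End.mul_apply, Module.End.mul_apply, map_sub]
        simp only [N, LinearMap.sub_apply]
        abel
      rw [e]
      refine (norm_add_le _ _).trans ?_
      have h1 := (hMB' _).trans (mul_le_mul_of_nonneg_left ih (by linarith : 0 ≤ B))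
      have h2 := (hDn _).trans (mul_le_mul_of_nonneg_left (hNkB k y) hδ)
      have h3 : δ * (B ^ k * ‖y‖) ≤ δ * (B ^ (k + 1) * ‖y‖) := by
        gcongr
        · exact Nat.le_succ k
      push_cast
      calc _ ≤ B * (k * δ * B ^ k * ‖y‖) + δ * (B ^ (k + 1) * ‖y‖) := by linarith
        _ = _ := by ring
  calc ‖(M ^ k) x‖ = ‖(N ^ k) x + ((M ^ k) x - (N ^ k) x)‖ := by congr 1; abel
    _ ≤ _ := norm_add_le _ _
    _ ≤ _ := by rw [add_mul]; exact add_le_add (hNk k x) (hdiff k x)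

/-- Powers of a quasi-nilpotent Hilbert-Schmidt operator decay factorially. -/
theorem norm_pow_le_of_quasinilpotent [CompleteSpace V] {S : V →L[ℂ] V} (hS : IsCompactOperator S)
    (hev : ∀ κ, κ ≠ 0 → ¬ Module.End.HasEigenvalue (S : V →ₗ[ℂ] V) κ) {C : ℝ} (hC : 0 ≤ C)
    (hHS : ∀ (d : ℕ) (e : Fin d → V), Orthonormal ℂ e → ∑ i, ‖S (e i)‖ ^ 2 ≤ C ^ 2)
    (k : ℕ) (x : V) :
    ‖(S ^ (k + 1)) x‖ ≤ C ^ k / √(k.factorial) * (‖S‖ * ‖x‖) := by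
  have hspec : spectrum ℂ S ⊆ {0} := fun κ hκ => by
    by_contra h0
    exact hev κ h0 ((hS.hasEigenvalue_iff_mem_spectrum h0).2 hκ)
  set B := ‖S‖ + 1 with hB
  have hBp : 1 ≤ B := by rw [hB]; linarith [norm_nonneg S]
  -- Finite rank compressions `T` of `S` with small eigenvalues obey the finite-dimensional estimate
  -- with an error proportional to `δ`. For fixed `k` this error disappears as `δ → 0`.
  have key : ∀ δ : ℝ, 0 < δ → δ ≤ 1 → ∃ T : V →L[ℂ] V, ‖S - T‖ ≤ δ ∧
      ‖(T ^ (k + 1)) x‖ ≤ (C ^ k / √(k.factorial) + k * δ * B ^ k) * (‖S‖ * ‖x‖) := by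
    intro δ hδ hδ1
    have hopen : IsOpen (Metric.ball (0 : ℂ) δ) := Metric.isOpen_ball
    have hus := (upperHemicontinuous_spectrum ℂ (V →L[ℂ] V)).upperHemicontinuousAt S
    -- Upper semicontinuity of the spectrum: operators close to `S` have their spectrum close to
    -- `{0}`, so the eigenvalues of a compression are small.
    have hnh : ∀ᶠ T in 𝓝 S, spectrum ℂ T ⊆ Metric.ball (0 : ℂ) δ := by
      have := hus.forall_isOpen (Metric.ball (0 : ℂ) δ) hopen (hspec.trans (by simpa using hδ))
      exact this
    obtain ⟨η, hη, hηs⟩ := Metric.eventually_nhds_iff.1 hnh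
    obtain ⟨W, hW, hWS⟩ := exists_finiteDimensional_norm_sub_le hS (ε := min δ (η / 2)) (by positivity)
    set T := W.starProjection ∘L S with hT
    have hTspec := hηs (y := T) (by
      rw [dist_comm, dist_eq_norm]
      exact (hWS.trans (min_le_right _ _)).trans_lt (by linarith))
    have hTn : ∀ y, ‖T y‖ ≤ ‖S y‖ := fun y => W.norm_starProjection_apply_le _
    have hTW : ∀ y, T y ∈ W := fun y => Submodule.starProjection_apply_mem _ _
    let M : W →ₗ[ℂ] W := (T : V →ₗ[ℂ] V).restrict fun y _ => hTW y
    have hMT : ∀ y : W, ((M y : W) : V) = T y := fun y => rfl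
    have hMk : ∀ (j : ℕ) (y : W), (((M ^ j) y : W) : V) = (T ^ j) y := by
      intro j
      induction j with
      | zero => intro y; simp
      | succ j ih => intro y; rw [pow_succ, pow_succ, Module.End.mul_apply, ih, hMT]; rfl
    -- The estimate lives on `W`, so one application of `T` is spent to carry `x` into `W`; hence
    -- the exponent `k + 1` against `k!`.
    have hfin := norm_pow_le_of_small_eigenvalues M (δ := δ) (B := B) hC ?_ hδ.le ?_ ?_ hBp k
      ⟨T x, hTW x⟩
    · refine ⟨T, hWS.trans (min_le_left _ _), ?_⟩
      have h1 : ‖(M ^ k) ⟨T x, hTW x⟩‖ = ‖(T ^ (k + 1)) x‖ := by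
        rw [pow_succ, mul_apply_eq_comp]
        exact congrArg norm (hMk k ⟨T x, hTW x⟩)
      rw [← h1]
      refine hfin.trans (mul_le_mul_of_nonneg_left ?_ (by positivity))
      exact (hTn x).trans (S.le_opNorm x)
    · intro d e he
      have he' : Orthonormal ℂ (fun i => (e i : V)) := he.comp_linearIsometry W.subtypeₗᵢ
      refine (Finset.sum_le_sum fun i _ => ?_).trans (hHS d _ he')
      have h1 : ‖M (e i)‖ = ‖T (e i)‖ := rfl
      rw [h1]
      gcongr
      exact hTn _
    · intro κ hκ
      obtain ⟨y, hy⟩ := hκ.exists_hasEigenvector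
      have h1 : Module.End.HasEigenvalue (T : V →ₗ[ℂ] V) κ := by
        refine Module.End.hasEigenvalue_of_hasEigenvector (x := (y : V)) ⟨?_, by simpa using hy.2⟩
        rw [Module.End.mem_eigenspace_iff]
        exact congrArg Subtype.val hy.apply_eq_smul
      by_cases h0 : κ = 0
      · simp [h0, hδ.le]
      · have hTc : IsCompactOperator T := hS.clm_comp W.starProjection
        have := hTspec ((hTc.hasEigenvalue_iff_mem_spectrum h0).1 h1)
        simpa using (Metric.mem_ball.1 this).le
    · intro y
      have h1 : ‖M y‖ = ‖T y‖ := rfl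
      have h2 : ‖T y‖ ≤ ‖S‖ * ‖y‖ := (hTn y).trans (S.le_opNorm y)
      rw [h1, hB]
      nlinarith [norm_nonneg y]
  choose! T hTS hTx using key
  let δ : ℕ → ℝ := fun n => 1 / ((n : ℝ) + 1)
  have hδ0 : ∀ n, 0 < δ n := fun n => Nat.one_div_pos_of_nat
  have hδ1 : ∀ n, δ n ≤ 1 := fun n => by
    simp only [δ]
    rw [div_le_one (by positivity)]
    linarith [Nat.cast_nonneg (α := ℝ) n]
  have hδt : Tendsto δ atTop (𝓝 0) := tendsto_one_div_add_atTop_nhds_zero_nat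
  have hTt : Tendsto (fun n => T (δ n)) atTop (𝓝 S) := by
    rw [tendsto_iff_norm_sub_tendsto_zero]
    refine squeeze_zero (fun _ => norm_nonneg _) (fun n => ?_) hδt
    rw [norm_sub_rev]
    exact hTS _ (hδ0 n) (hδ1 n)
  have h1 : Tendsto (fun n => ‖((T (δ n)) ^ (k + 1)) x‖) atTop (𝓝 ‖(S ^ (k + 1)) x‖) :=
    (((ContinuousLinearMap.apply ℂ V x).continuous.tendsto _).comp (hTt.pow (k + 1))).norm
  have h2 : Tendsto (fun n => (C ^ k / √(k.factorial) + k * δ n * B ^ k) * (‖S‖ * ‖x‖)) atTop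
      (𝓝 ((C ^ k / √(k.factorial) + k * 0 * B ^ k) * (‖S‖ * ‖x‖))) :=
    (((hδt.const_mul (k : ℝ)).mul_const (B ^ k)).const_add _).mul_const _
  have := le_of_tendsto_of_tendsto' h1 h2 fun n => hTx _ (hδ0 n) (hδ1 n)
  simpa using this

end CompactOp

/-! ### Phragmén-Lindelöf in a narrow sector. -/

namespace CompactOp

/-- Phragmén-Lindelöf for an entire function of order at most four, bounded outside a narrow
sector around the positive real axis. -/
theorem norm_le_of_bounded_outside_sector {E : Type*} [NormedAddCommGroup E] [NormedSpace ℂ E]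
    {F : ℂ → E} (hd : Differentiable ℂ F) {A B C : ℝ}
    (hg : ∀ z, ‖F z‖ ≤ A * Real.exp (B * ‖z‖ ^ 4))
    (hb : ∀ z : ℂ, z.re ≤ Real.cos (Real.pi / 16) * ‖z‖ → ‖F z‖ ≤ C) (z : ℂ) : ‖F z‖ ≤ C := by
  rcases le_or_gt z.re (Real.cos (Real.pi / 16) * ‖z‖) with hz | hz
  · exact hb z hz
  have hpi := Real.pi_pos
  -- `w ↦ w ^ (1 / 4) * ρ` maps the closed first quadrant onto the sector `|arg| ≤ π / 16`: the
  -- fourth root has argument in `[0, π / 8]`, and `ρ` rotates by `-π / 16`.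
  set ρ : ℂ := Complex.exp (-(Real.pi / 16 : ℝ) * Complex.I) with hρ
  have hρn : ‖ρ‖ = 1 := by
    rw [hρ, ← Complex.ofReal_neg, Complex.norm_exp_ofReal_mul_I]
  let g : ℂ → ℂ := fun w => w ^ (1 / 4 : ℂ) * ρ
  have hgn : ∀ w : ℂ, ‖g w‖ = ‖w‖ ^ (1 / 4 : ℝ) := fun w => by
    simp only [g]
    rw [norm_mul, hρn, mul_one]
    have : (1 / 4 : ℂ) = ((1 / 4 : ℝ) : ℂ) := by push_cast; rfl
    rw [this, Complex.norm_cpow_real]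
  have hgn4 : ∀ w : ℂ, ‖g w‖ ^ 4 = ‖w‖ := fun w => by
    rw [hgn, ← Real.rpow_natCast, ← Real.rpow_mul (norm_nonneg _)]
    norm_num
  have hgc : ∀ w : ℂ, 0 ≤ w.re → ContinuousAt g w := fun w hw => by
    have h1 : ContinuousAt (fun p : ℂ × ℂ => p.1 ^ p.2) (w, (1 / 4 : ℂ)) :=
      Complex.continuousAt_cpow_of_re_pos (Or.inl hw) (by norm_num)
    have h2 : ContinuousAt (fun w : ℂ => (w, (1 / 4 : ℂ))) w := by fun_prop
    exact (ContinuousAt.comp (f := fun w : ℂ => (w, (1 / 4 : ℂ)))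
      (g := fun p : ℂ × ℂ => p.1 ^ p.2) h1 h2).mul continuousAt_const
  have hdc : DiffContOnCl ℂ (F ∘ g) (Set.Ioi 0 ×ℂ Set.Ioi 0) := by
    refine ⟨fun w hw => ?_, fun w hw => ?_⟩
    · have hw' : w ∈ Complex.slitPlane := Or.inl (Complex.mem_reProdIm.1 hw).1
      have h1 : DifferentiableAt ℂ g w :=
        ((differentiableAt_id).cpow_const hw').mul_const ρ
      exact (DifferentiableAt.comp w (hd (g w)) h1).differentiableWithinAt
    · rw [Complex.closure_reProdIm, closure_Ioi, Complex.mem_reProdIm] at hw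
      exact ((hd.continuous.continuousAt).comp (hgc w hw.1)).continuousWithinAt
  have hgrow : ∃ c < (2 : ℝ), ∃ B, (F ∘ g) =O[Bornology.cobounded ℂ ⊓ 𝓟 (Set.Ioi 0 ×ℂ Set.Ioi 0)]
      fun z => Real.exp (B * ‖z‖ ^ c) := by
    -- Since `‖g w‖ ^ 4 = ‖w‖`, growth of order four becomes order one, below the critical order two
    -- of a quadrant.
    refine ⟨1, by norm_num, B, Asymptotics.IsBigO.of_bound A (Eventually.of_forall fun w => ?_)⟩
    rw [Function.comp_apply, Real.norm_of_nonneg (Real.exp_pos _).le, Real.rpow_one]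
    simpa [hgn4] using hg (g w)
  have hpl := fun w => PhragmenLindelof.quadrant_I (z := w) (C := C) hdc hgrow ?_ ?_
  · have hz0 : z ≠ 0 := by
      rintro rfl
      simp at hz
    have hcos : Real.cos (Real.pi / 16) < Real.cos z.arg := by
      rw [Complex.cos_arg hz0, lt_div_iff₀ (norm_pos_iff.2 hz0)]
      exact hz
    have harg : |z.arg| < Real.pi / 16 := by
      by_contra! h
      have := Real.cos_le_cos_of_nonneg_of_le_pi (by positivity) (Complex.abs_arg_le_pi z) h
      rw [Real.cos_abs] at this
      linarith
    obtain ⟨ha1, ha2⟩ := abs_lt.1 harg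
    set θ : ℝ := z.arg + Real.pi / 16 with hθ
    have hθ1 : 0 < θ := by rw [hθ]; linarith
    have hθ2 : θ < Real.pi / 8 := by rw [hθ]; linarith
    -- The preimage of `z` in the quadrant: undo the rotation, then take the fourth power.
    set w : ℂ := (‖z‖ ^ 4 : ℝ) * Complex.exp ((4 * θ : ℝ) * Complex.I) with hw
    have hwe : g w = z := by
      have h1 : w ^ (1 / 4 : ℂ) = ‖z‖ * Complex.exp ((θ : ℝ) * Complex.I) := by
        have h4 : w = (‖z‖ * Complex.exp ((θ : ℝ) * Complex.I)) ^ (4 : ℕ) := by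
          rw [hw, mul_pow, ← Complex.exp_nat_mul]
          push_cast
          ring_nf
        have harg' : Complex.arg (‖z‖ * Complex.exp ((θ : ℝ) * Complex.I)) = θ :=
          by
          rw [Complex.exp_mul_I]
          exact Complex.arg_mul_cos_add_sin_mul_I (norm_pos_iff.2 hz0) ⟨by linarith, by linarith⟩
        rw [h4]
        have := Complex.pow_cpow_nat_inv (n := 4)
          (x := ‖z‖ * Complex.exp ((θ : ℝ) * Complex.I)) (by norm_num)
          (by rw [harg']; push_cast; linarith) (by rw [harg']; push_cast; linarith)
        convert this using 2
        norm_num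
      simp only [g]
      rw [h1, hρ, mul_assoc, ← Complex.exp_add]
      conv_rhs => rw [← Complex.norm_mul_exp_arg_mul_I z]
      congr 2
      rw [hθ]; push_cast; ring
    have h1 := hpl w ?_ ?_
    · rwa [Function.comp_apply, hwe] at h1
    · rw [hw, Complex.re_ofReal_mul, Complex.exp_ofReal_mul_I_re]
      have : 0 ≤ Real.cos (4 * θ) :=
        Real.cos_nonneg_of_mem_Icc ⟨by linarith, by linarith⟩
      positivity
    · rw [hw, Complex.im_ofReal_mul, Complex.exp_ofReal_mul_I_im]
      have : 0 ≤ Real.sin (4 * θ) := Real.sin_nonneg_of_mem_Icc ⟨by linarith, by linarith⟩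
      positivity
  -- The two boundary half lines go to the rays of argument `∓π / 16`, where the hypothesis on the
  -- real part holds with equality.
  · intro x hx
    refine hb _ (le_of_eq ?_)
    rw [hgn]
    simp only [g]
    have h1 : (x : ℂ) ^ (1 / 4 : ℂ) = ((x ^ (1 / 4 : ℝ) : ℝ) : ℂ) := by
      rw [Complex.ofReal_cpow hx]; push_cast; rfl
    rw [h1, Complex.re_ofReal_mul, hρ, ← Complex.ofReal_neg, Complex.exp_ofReal_mul_I_re,
      Real.cos_neg, Complex.norm_real, Real.norm_of_nonneg hx, mul_comm]
  · intro x hx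
    refine hb _ (le_of_eq ?_)
    rw [hgn]
    simp only [g]
    have h0 : Complex.I ^ (1 / 4 : ℂ) = Complex.exp ((Real.pi / 8 : ℝ) * Complex.I) := by
      rw [Complex.cpow_def_of_ne_zero Complex.I_ne_zero, Complex.log_I]
      congr 1
      push_cast; ring
    have h1 : ((x : ℂ) * Complex.I) ^ (1 / 4 : ℂ) =
        ((x ^ (1 / 4 : ℝ) : ℝ) : ℂ) * Complex.exp ((Real.pi / 8 : ℝ) * Complex.I) := by
      rcases hx.eq_or_lt with rfl | hx'
      · norm_num
      · have hx0 : (x : ℂ) ≠ 0 := by exact_mod_cast hx'.ne'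
        rw [Complex.cpow_def_of_ne_zero (mul_ne_zero hx0 Complex.I_ne_zero),
          Complex.log_ofReal_mul hx' Complex.I_ne_zero, add_mul, Complex.exp_add, ← h0,
          Complex.cpow_def_of_ne_zero Complex.I_ne_zero, Complex.ofReal_cpow hx,
          Complex.cpow_def_of_ne_zero hx0, Complex.ofReal_log hx]
        push_cast; rfl
    rw [h1, mul_assoc, hρ, ← Complex.exp_add, Complex.re_ofReal_mul]
    have h2 : ((Real.pi / 8 : ℝ) : ℂ) * Complex.I + -((Real.pi / 16 : ℝ) : ℂ) * Complex.I =
        ((Real.pi / 16 : ℝ) : ℂ) * Complex.I := by push_cast; ring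
    rw [h2, Complex.exp_ofReal_mul_I_re, norm_mul, Complex.norm_real, Complex.norm_I, mul_one,
      Real.norm_of_nonneg hx, mul_comm]

variable {H : Type*} [NormedAddCommGroup H] [InnerProductSpace ℂ H]

/-- After squaring, this is one term of the series of `exp (2 x²)`. The factor two is spent on a
geometric factor, which makes the Neumann series summable with an explicit Gaussian bound. -/
theorem pow_div_sqrt_factorial_le (x : ℝ) (k : ℕ) :
    x ^ k / √(k.factorial) ≤ (√2⁻¹) ^ k * Real.exp (x ^ 2) := by
  refine le_of_sq_le_sq ?_ (by positivity)
  rw [div_pow, mul_pow, Real.sq_sqrt (by positivity), ← pow_mul, mul_comm k 2, pow_mul, ← pow_mul (√2⁻¹),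
    mul_comm k 2, pow_mul (√2⁻¹), Real.sq_sqrt (by positivity), ← Real.exp_nat_mul]
  have h := Real.pow_div_factorial_le_exp (2 * x ^ 2) (by positivity) k
  rw [mul_pow] at h
  have h2 : (2⁻¹ : ℝ) ^ k * 2 ^ k = 1 := by rw [← mul_pow]; norm_num
  calc (x ^ 2) ^ k / k.factorial = 2⁻¹ ^ k * (2 ^ k * (x ^ 2) ^ k / k.factorial) := by
        rw [mul_div_assoc, ← mul_assoc, h2, one_mul]
    _ ≤ _ := by
      push_cast
      gcongr

end CompactOp

/-! ### Entire resolvents and operators with finitely many nonzero eigenvalues. -/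

namespace CompactOp

variable {H : Type*} [NormedAddCommGroup H] [InnerProductSpace ℂ H]

/-- A compact operator without nonzero eigenvalues whose square is Hilbert-Schmidt vanishes as soon
as its resolvent decays outside a narrow sector. -/
theorem eq_zero_of_quasinilpotent [CompleteSpace H] {T : H →L[ℂ] H} (hT : IsCompactOperator T)
    {C : ℝ} (hC : 0 ≤ C)
    (hHS : ∀ (d : ℕ) (e : Fin d → H), Orthonormal ℂ e → ∑ i, ‖T (T (e i))‖ ^ 2 ≤ C ^ 2)
    {R K : ℝ} (hres : ∀ z : ℂ, R ≤ ‖z‖ → z.re ≤ Real.cos (Real.pi / 16) * ‖z‖ →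
      ∀ y, ‖z‖ * ‖T y‖ ≤ K * ‖y - z • T y‖)
    (hev : ∀ κ : ℂ, κ ≠ 0 → ∀ x, T x = κ • x → x = 0) (f : H) : T f = 0 := by
  set S : H →L[ℂ] H := T ∘L T with hS
  have hSc : IsCompactOperator S := hT.clm_comp T
  -- Factor `T² - μ² = (T - μ) (T + μ)`: an eigenvector of `T²` would produce one of `T` for `μ` or
  -- `-μ`.
  have hSev : ∀ κ, κ ≠ 0 → ¬ Module.End.HasEigenvalue (S : H →ₗ[ℂ] H) κ := by
    intro κ hκ h
    obtain ⟨x, hx⟩ := h.exists_hasEigenvector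
    obtain ⟨μ, hμ⟩ := IsAlgClosed.exists_pow_nat_eq κ two_pos
    have hμ0 : μ ≠ 0 := by rintro rfl; exact hκ (by simpa using hμ.symm)
    have hTT : T (T x) = κ • x := hx.apply_eq_smul
    have h1 : T (T x + μ • x) = μ • (T x + μ • x) := by
      rw [map_add, map_smul, hTT, ← hμ, smul_add, smul_smul, ← sq]; abel
    have h2 := hev μ hμ0 _ h1
    have h3 : T x = (-μ) • x := by rw [neg_smul]; exact eq_neg_of_add_eq_zero_left h2
    exact hx.2 (hev (-μ) (neg_ne_zero.2 hμ0) x h3)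
  have hSk := fun k => norm_pow_le_of_quasinilpotent hSc hSev hC hHS k f
  set D : ℝ := ‖S‖ * ‖f‖ with hD
  have hD0 : 0 ≤ D := by positivity
  set q : ℝ := √2⁻¹ with hq
  have hq0 : 0 ≤ q := Real.sqrt_nonneg _
  have hq1 : q < 1 := by
    rw [hq, Real.sqrt_lt' one_pos]; norm_num
  have hterm : ∀ (k : ℕ) (ζ : ℂ), ‖ζ ^ k • (S ^ (k + 1)) f‖ ≤ q ^ k * (Real.exp ((C * ‖ζ‖) ^ 2) * D) := by
    intro k ζ
    rw [norm_smul, norm_pow]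
    calc ‖ζ‖ ^ k * ‖(S ^ (k + 1)) f‖ ≤ ‖ζ‖ ^ k * (C ^ k / √(k.factorial) * D) := by
          gcongr; exact hSk k
      _ = (C * ‖ζ‖) ^ k / √(k.factorial) * D := by rw [mul_pow]; ring
      _ ≤ (q ^ k * Real.exp ((C * ‖ζ‖) ^ 2)) * D := by
          gcongr; exact pow_div_sqrt_factorial_le _ k
      _ = _ := by ring
  have hgeo : ∀ a : ℝ, Summable fun k : ℕ => q ^ k * a := fun a =>
    (summable_geometric_of_lt_one hq0 hq1).mul_right a
  have hsum : ∀ ζ : ℂ, Summable fun k : ℕ => ζ ^ k • (S ^ (k + 1)) f := fun ζ =>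
    Summable.of_norm_bounded (hgeo _) fun k => hterm k ζ
  -- The Neumann series of `S (1 - ζ S)⁻¹ f`. Factorial decay of the powers makes it entire, of
  -- order at most two in `ζ`.
  let h : ℂ → H := fun ζ => ∑' k : ℕ, ζ ^ k • (S ^ (k + 1)) f
  set D' : ℝ := (1 - q)⁻¹ * D with hD'
  have hD'0 : 0 ≤ D' := mul_nonneg (inv_nonneg.2 (by linarith)) hD0
  have hhn : ∀ ζ, ‖h ζ‖ ≤ D' * Real.exp ((C * ‖ζ‖) ^ 2) := fun ζ => by
    have h1 := tsum_of_norm_bounded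
      ((hasSum_geometric_of_lt_one hq0 hq1).mul_right (Real.exp ((C * ‖ζ‖) ^ 2) * D))
      fun k => hterm k ζ
    refine h1.trans (le_of_eq ?_)
    rw [hD']; ring
  have hhd : Differentiable ℂ h := by
    intro ζ
    have hon : DifferentiableOn ℂ h (Metric.ball 0 (‖ζ‖ + 1)) := by
      refine Complex.differentiableOn_tsum_of_summable_norm
        (u := fun k => q ^ k * (Real.exp ((C * (‖ζ‖ + 1)) ^ 2) * D)) (hgeo _) (fun k => ?_)
        Metric.isOpen_ball fun k w hw => ?_
      · exact ((differentiable_id.pow k).smul_const _).differentiableOn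
      · refine (hterm k w).trans ?_
        have : ‖w‖ ≤ ‖ζ‖ + 1 := by simpa using (Metric.mem_ball.1 hw).le
        gcongr
    exact hon.differentiableAt (Metric.isOpen_ball.mem_nhds (by simp))
  have hhS : ∀ ζ, h ζ = S f + ζ • S (h ζ) := fun ζ => by
    have h1 : h ζ = _ := (hsum ζ).tsum_eq_zero_add
    have h2 : S (h ζ) = ∑' k : ℕ, S (ζ ^ k • (S ^ (k + 1)) f) :=
      ContinuousLinearMap.map_tsum S (hsum ζ)
    rw [h2, h1, ← tsum_const_smul'']
    simp only [pow_zero, one_smul, zero_add, pow_one]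
    congr 1
    refine tsum_congr fun k => ?_
    rw [map_smul, smul_smul, ← pow_succ', pow_succ' S (k + 1)]
    rfl
  -- With `ζ = z²`, `w z` is `(1 - z² T²)⁻¹ f`. Since `1 - z² T² = (1 - zT) (1 + zT)`, `y z = (1 +
  -- zT) w z` is `(1 - zT)⁻¹ f`, an entire function of order at most four in `z`.
  let w : ℂ → H := fun z => f + z ^ 2 • h (z ^ 2)
  let y : ℂ → H := fun z => w z + z • T (w z)
  have hwS : ∀ z, w z - z ^ 2 • S (w z) = f := fun z => by
    have h1 := hhS (z ^ 2)
    simp only [w]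
    rw [map_add, map_smul]
    generalize h (z ^ 2) = v at *
    have h2 : S f = v - z ^ 2 • S v := by rw [eq_sub_iff_add_eq, ← h1]
    rw [h2]
    module
  have hy : ∀ z, y z - z • T (y z) = f := fun z => by
    rw [← hwS z]
    simp only [y, map_add, map_smul, hS, ContinuousLinearMap.comp_apply]
    module
  have hwd : Differentiable ℂ w :=
    (differentiable_const f).add ((differentiable_id.pow 2).smul (hhd.comp (differentiable_id.pow 2)))
  have hyd : Differentiable ℂ y := hwd.add (differentiable_id.smul (T.differentiable.comp hwd))
  let F : ℂ → H := fun z => T (y z)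
  have hFd : Differentiable ℂ F := T.differentiable.comp hyd
  have hexp1 : ∀ z : ℂ, ‖z‖ ≤ 1 + ‖z‖ ^ 4 := fun z => by
    nlinarith [sq_nonneg (‖z‖ ^ 2 - 1), sq_nonneg (‖z‖ - 1), norm_nonneg z, sq_nonneg ‖z‖]
  have hexp2 : ∀ z : ℂ, ‖z‖ ^ 2 ≤ 1 + ‖z‖ ^ 4 := fun z => by nlinarith [sq_nonneg (‖z‖ ^ 2 - 1)]
  have hwn : ∀ z, ‖w z‖ ≤ (‖f‖ + D') * Real.exp ((1 + ‖z‖ ^ 4) + C ^ 2 * ‖z‖ ^ 4) := fun z => by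
    have e1 : (C * ‖z ^ 2‖) ^ 2 = C ^ 2 * ‖z‖ ^ 4 := by rw [norm_pow]; ring
    have e2 : ‖z ^ 2 • h (z ^ 2)‖ ≤ Real.exp (1 + ‖z‖ ^ 4) * (D' * Real.exp (C ^ 2 * ‖z‖ ^ 4)) := by
      rw [norm_smul]
      have := hhn (z ^ 2)
      rw [e1] at this
      refine mul_le_mul ?_ this (norm_nonneg _) (Real.exp_pos _).le
      rw [norm_pow]
      exact (hexp2 z).trans ((by linarith : 1 + ‖z‖ ^ 4 ≤ (1 + ‖z‖ ^ 4) + 1).trans (Real.add_one_le_exp _))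
    have e3 : ‖f‖ ≤ ‖f‖ * Real.exp ((1 + ‖z‖ ^ 4) + C ^ 2 * ‖z‖ ^ 4) :=
      le_mul_of_one_le_right (norm_nonneg _) (Real.one_le_exp (by positivity))
    calc ‖w z‖ ≤ ‖f‖ + ‖z ^ 2 • h (z ^ 2)‖ := norm_add_le _ _
      _ ≤ _ := add_le_add e3 e2
      _ = _ := by rw [Real.exp_add]; ring
  have hFg : ∀ z, ‖F z‖ ≤ (‖T‖ * ((‖f‖ + D') * Real.exp (1 + ‖T‖))) *
      Real.exp ((1 + C ^ 2 + ‖T‖) * ‖z‖ ^ 4) := fun z => by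
    have e1 : ‖y z‖ ≤ ‖w z‖ * Real.exp (‖T‖ * (1 + ‖z‖ ^ 4)) := by
      calc ‖y z‖ ≤ ‖w z‖ + ‖z‖ * (‖T‖ * ‖w z‖) := by
            refine (norm_add_le _ _).trans ?_
            rw [norm_smul]
            gcongr
            exact T.le_opNorm _
        _ = ‖w z‖ * (‖T‖ * ‖z‖ + 1) := by ring
        _ ≤ ‖w z‖ * (‖T‖ * (1 + ‖z‖ ^ 4) + 1) := by
            gcongr; exact hexp1 z
        _ ≤ _ := by gcongr; exact Real.add_one_le_exp _
    calc ‖F z‖ ≤ ‖T‖ * ‖y z‖ := T.le_opNorm _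
      _ ≤ ‖T‖ * (((‖f‖ + D') * Real.exp ((1 + ‖z‖ ^ 4) + C ^ 2 * ‖z‖ ^ 4)) *
          Real.exp (‖T‖ * (1 + ‖z‖ ^ 4))) := by
            gcongr
            exact e1.trans (by gcongr; exact hwn z)
      _ = ‖T‖ * ((‖f‖ + D') * (Real.exp ((1 + ‖z‖ ^ 4) + C ^ 2 * ‖z‖ ^ 4) *
          Real.exp (‖T‖ * (1 + ‖z‖ ^ 4)))) := by ring
      _ = ‖T‖ * ((‖f‖ + D') * (Real.exp (1 + ‖T‖) *
          Real.exp ((1 + C ^ 2 + ‖T‖) * ‖z‖ ^ 4))) := by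
            rw [← Real.exp_add, ← Real.exp_add]; congr 3; ring
      _ = _ := by ring
  have hFres : ∀ z : ℂ, R ≤ ‖z‖ → z.re ≤ Real.cos (Real.pi / 16) * ‖z‖ →
      ‖z‖ * ‖F z‖ ≤ K * ‖f‖ := fun z hz hz' => by
    have := hres z hz hz' (y z)
    rwa [hy] at this
  obtain ⟨A, hA⟩ := (isCompact_closedBall (0 : ℂ) (max R 1)).exists_bound_of_continuousOn
    hFd.continuous.continuousOn
  have hFb : ∀ z : ℂ, z.re ≤ Real.cos (Real.pi / 16) * ‖z‖ → ‖F z‖ ≤ max A (K * ‖f‖) := by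
    intro z hz
    rcases le_or_gt ‖z‖ (max R 1) with h1 | h1
    · exact (hA z (by simpa using h1)).trans (le_max_left _ _)
    · refine le_trans ?_ ((hFres z ((le_max_left _ _).trans h1.le) hz).trans (le_max_right _ _))
      exact le_mul_of_one_le_left (norm_nonneg _) ((le_max_right _ _).trans h1.le)
  have hall := norm_le_of_bounded_outside_sector hFd hFg hFb
  have hbdd : Bornology.IsBounded (Set.range F) := by
    rw [isBounded_iff_forall_norm_le]
    exact ⟨_, by rintro _ ⟨z, rfl⟩; exact hall z⟩
  have hconst : ∀ z, F z = F 0 := fun z => hFd.apply_eq_apply_of_bounded hbdd z 0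
  have hF0 : F 0 = T f := by simp [F, y, w]
  rw [← hF0]
  -- `F` is constant, and the resolvent estimate along the negative half line, which avoids the
  -- sector, forces this constant to be zero.
  have hlim : ∀ x : ℝ, max R 1 ≤ x → x * ‖F 0‖ ≤ K * ‖f‖ := fun x hx => by
    have hx0 : 0 ≤ x := zero_le_one.trans ((le_max_right _ _).trans hx)
    have hn : ‖((-x : ℝ) : ℂ)‖ = x := by rw [Complex.norm_real, norm_neg, Real.norm_of_nonneg hx0]
    have h1 := hFres ((-x : ℝ) : ℂ) (by rw [hn]; exact (le_max_left _ _).trans hx) (by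
      rw [hn, Complex.ofReal_re]
      have : 0 ≤ Real.cos (Real.pi / 16) :=
        Real.cos_nonneg_of_mem_Icc ⟨by linarith [Real.pi_pos], by linarith [Real.pi_pos]⟩
      nlinarith)
    rwa [hn, hconst] at h1
  by_contra h0
  have hp : 0 < ‖F 0‖ := norm_pos_iff.2 h0
  have h1 := hlim (max (max R 1) ((K * ‖f‖ + 1) / ‖F 0‖)) (le_max_left _ _)
  have h2 : (K * ‖f‖ + 1) / ‖F 0‖ * ‖F 0‖ ≤ max (max R 1) ((K * ‖f‖ + 1) / ‖F 0‖) * ‖F 0‖ := by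
    gcongr; exact le_max_right _ _
  rw [div_mul_cancel₀ _ hp.ne'] at h2
  linarith

/-- A polynomial in a compact operator is compact up to its constant term. -/
theorem exists_compact_aeval {T : H →L[ℂ] H} (hT : IsCompactOperator T) (p : Polynomial ℂ) :
    ∃ K : H →L[ℂ] H, IsCompactOperator K ∧
      Polynomial.aeval T p = K - (-p.coeff 0) • (1 : H →L[ℂ] H) := by
  refine ⟨Polynomial.aeval T p.divX ∘L T, hT.clm_comp (Polynomial.aeval T p.divX), ?_⟩
  conv_lhs => rw [← Polynomial.divX_mul_X_add p]
  rw [map_add, map_mul, Polynomial.aeval_X, Polynomial.aeval_C, Algebra.algebraMap_eq_smul_one,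
    neg_smul, sub_neg_eq_add]
  rfl

/-- A compact operator with finitely many nonzero eigenvalues whose square is Hilbert-Schmidt and
whose resolvent decays outside a narrow sector has finite rank. -/
theorem finiteDimensional_range_of_finite_eigenvalues [CompleteSpace H] {T : H →L[ℂ] H}
    (hT : IsCompactOperator T) {C : ℝ} (hC : 0 ≤ C)
    (hHS : ∀ (d : ℕ) (e : Fin d → H), Orthonormal ℂ e → ∑ i, ‖T (T (e i))‖ ^ 2 ≤ C ^ 2)
    {R K : ℝ} (hres : ∀ z : ℂ, R ≤ ‖z‖ → z.re ≤ Real.cos (Real.pi / 16) * ‖z‖ →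
      ∀ y, ‖z‖ * ‖T y‖ ≤ K * ‖y - z • T y‖)
    (hfin : {κ : ℂ | κ ≠ 0 ∧ Module.End.HasEigenvalue (T : H →ₗ[ℂ] H) κ}.Finite) :
    FiniteDimensional ℂ (LinearMap.range (T : H →ₗ[ℂ] H)) := by
  -- `p` vanishes at every nonzero eigenvalue but not at zero, so `p(T)` is compact plus a nonzero
  -- scalar.
  set p : Polynomial ℂ := ∏ κ ∈ hfin.toFinset, (Polynomial.X - Polynomial.C κ) with hp
  have hp0 : p.coeff 0 ≠ 0 := by
    rw [Polynomial.coeff_zero_eq_eval_zero, hp, Polynomial.eval_prod, Finset.prod_ne_zero_iff]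
    intro κ hκ
    simpa using (hfin.mem_toFinset.1 hκ).1
  obtain ⟨K₁, hK₁, e₁⟩ := exists_compact_aeval hT p
  obtain ⟨m, hm⟩ := exists_ker_pow_stable hK₁ (neg_ne_zero.2 hp0)
  rw [← e₁] at hm
  set B := Polynomial.aeval T p with hB
  have hstab : ∀ (j : ℕ) x, (B ^ (m + j)) x = 0 → (B ^ m) x = 0 := by
    intro j
    induction j with
    | zero => exact fun x hx => hx
    | succ j ih =>
      intro x hx
      refine ih x ?_
      have h1 : (B ^ (m + 1)) ((B ^ j) x) = 0 := by
        rw [← mul_apply_eq_comp, ← pow_add]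
        convert hx using 2
        ring_nf
      have := hm _ h1
      rwa [← mul_apply_eq_comp, ← pow_add] at this
  -- A power beyond the ascent, so that `ker A² = ker A`, with positive exponent, so that it
  -- annihilates every eigenvector of `T` for a nonzero eigenvalue.
  set A : H →L[ℂ] H := B ^ (m + 1) with hA
  have hAp : A = Polynomial.aeval T (p ^ (m + 1)) := by rw [map_pow]
  have hA2 : ∀ x, A (A x) = 0 → A x = 0 := by
    intro x hx
    rw [hA, ← mul_apply_eq_comp, ← pow_add] at hx
    have := hstab (m + 2) x (by convert hx using 2; ring_nf)
    rw [hA, pow_succ', mul_apply_eq_comp, this, map_zero]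
  have hc : (p ^ (m + 1)).coeff 0 ≠ 0 := by
    rw [Polynomial.coeff_zero_eq_eval_zero, Polynomial.eval_pow, ← Polynomial.coeff_zero_eq_eval_zero]
    exact pow_ne_zero _ hp0
  obtain ⟨K₂, hK₂, e₂⟩ := exists_compact_aeval hT (p ^ (m + 1))
  rw [← hAp] at e₂
  have e₂x : ∀ x, A x = K₂ x - (-(p ^ (m + 1)).coeff 0) • x := fun x =>
    congrArg (fun G : H →L[ℂ] H => G x) e₂
  have hcn := neg_ne_zero.2 hc
  set N : Submodule ℂ H := LinearMap.ker (A : H →ₗ[ℂ] H) with hN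
  have hNm : ∀ x, x ∈ N ↔ A x = 0 := fun x => Iff.rfl
  have hNfin : FiniteDimensional ℂ N := by
    have h : ∀ G : H →L[ℂ] H, G = K₂ - (-(p ^ (m + 1)).coeff 0) • (1 : H →L[ℂ] H) →
        FiniteDimensional ℂ (LinearMap.ker (G : H →ₗ[ℂ] H)) := by
      rintro _ rfl
      exact finiteDimensional_ker hK₂ hcn
    exact h A e₂
  -- Adding the projection onto `N = ker A` makes `A` invertible, and hence `H` is the sum of the
  -- range `W` of `A` and of `N`.
  have hu : IsUnit (K₂ + N.starProjection - (-(p ^ (m + 1)).coeff 0) • (1 : H →L[ℂ] H)) := by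
    refine isUnit_of_injective (hK₂.add (isCompactOperator_starProjection N)) hcn fun x hx => ?_
    have hx' : A x + N.starProjection x = 0 := by
      rw [← hx, e₂x]; simp only [sub_apply, add_apply, smul_apply, one_apply_eq_self]; abel
    have h1 : A (A x) = 0 := by
      have h2 := congrArg A hx'
      rwa [map_add, map_zero, (hNm _).1 (Submodule.starProjection_apply_mem N x), add_zero] at h2
    have h2 := hA2 x h1
    rw [h2, zero_add, Submodule.starProjection_eq_self_iff.2 ((hNm x).2 h2)] at hx'
    exact hx'
  have hdecomp : ∀ y, ∃ x, A x + N.starProjection x = y := fun y => by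
    obtain ⟨x, hx⟩ := ((ContinuousLinearMap.isUnit_iff_bijective).1 hu).2 y
    refine ⟨x, ?_⟩
    rw [← hx, e₂x]; simp only [sub_apply, add_apply, smul_apply, one_apply_eq_self]; abel
  set W : Submodule ℂ H := LinearMap.range (A : H →ₗ[ℂ] H) with hW
  have hWm : ∀ x, A x ∈ W := fun x => ⟨x, rfl⟩
  have hWN : ∀ x ∈ W, x ∈ N → x = 0 := by
    rintro _ ⟨x, rfl⟩ hx
    exact hA2 x hx
  have hWclosed : IsClosed (W : Set H) := by
    obtain ⟨U, hU⟩ := hu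
    have hUx : ∀ x, (U : H →L[ℂ] H) x = A x + N.starProjection x := fun x => by
      rw [hU, e₂x]; simp only [sub_apply, add_apply, smul_apply, one_apply_eq_self]; abel
    have hUinv : ∀ y, (U : H →L[ℂ] H) (((U⁻¹ : (H →L[ℂ] H)ˣ) : H →L[ℂ] H) y) = y := fun y => by
      rw [← mul_apply_eq_comp, Units.mul_inv, one_apply_eq_self]
    -- The `N`-component of `y` in the decomposition depends continuously on `y`, and `W` is where
    -- it vanishes.
    have : (W : Set H) = {y | (N.starProjection ∘L ((U⁻¹ : (H →L[ℂ] H)ˣ) : H →L[ℂ] H)) y = 0} := by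
      ext y
      set x := ((U⁻¹ : (H →L[ℂ] H)ˣ) : H →L[ℂ] H) y with hx
      have hxy : A x + N.starProjection x = y := by rw [← hUx, hUinv]
      change y ∈ W ↔ N.starProjection x = 0
      constructor
      · intro hy
        refine hWN _ ?_ (Submodule.starProjection_apply_mem N x)
        rw [← sub_eq_of_eq_add' hxy.symm]
        exact sub_mem hy (hWm x)
      · intro h
        rw [← hxy, h, add_zero]
        exact hWm x
    rw [this]
    exact isClosed_eq (ContinuousLinearMap.continuous _) continuous_const
  have hcomm : ∀ x, T (A x) = A (T x) := fun x => by
    have h1 : T * A = A * T := by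
      rw [hAp]
      calc T * Polynomial.aeval T (p ^ (m + 1))
          = Polynomial.aeval T (Polynomial.X * p ^ (m + 1)) := by rw [map_mul, Polynomial.aeval_X]
        _ = _ := by rw [mul_comm, map_mul, Polynomial.aeval_X]
    exact congrArg (fun G : H →L[ℂ] H => G x) h1
  have hinv : ∀ x ∈ W, T x ∈ W := by
    rintro _ ⟨x, rfl⟩
    change T (A x) ∈ W
    rw [hcomm]
    exact hWm _
  have hBev : ∀ κ x, T x = κ • x → B x = p.eval κ • x := by
    intro κ x hx
    have hpow : ∀ q : Polynomial ℂ, Polynomial.aeval T q x = q.eval κ • x := by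
      intro q
      induction q using Polynomial.induction_on' with
      | add a b ha hb => rw [map_add, add_apply, ha, hb, Polynomial.eval_add, add_smul]
      | monomial n a =>
        induction n with
        | zero => simp [Algebra.algebraMap_eq_smul_one]
        | succ n ih =>
          rw [← Polynomial.monomial_mul_X, map_mul, Polynomial.aeval_X, mul_apply_eq_comp, hx,
            map_smul, ih, smul_smul, Polynomial.eval_mul, Polynomial.eval_X, mul_comm]
    exact hpow p
  -- `T` maps `W` to itself and inherits all the estimates there. An eigenvector in `W` with a
  -- nonzero eigenvalue would lie in `N` as well, and `W ∩ N = 0`.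
  have hTW : ∀ x ∈ W, T x = 0 := by
    have hWc : CompleteSpace W := hWclosed.completeSpace_coe
    let T' : W →L[ℂ] W := (T ∘L W.subtypeL).codRestrict W fun x => hinv x x.2
    have hT' : ∀ x : W, ((T' x : W) : H) = T x := fun x => rfl
    have hT'c : IsCompactOperator T' :=
      IsCompactOperator.restrict' (f := (T : H →ₗ[ℂ] H)) hT hinv
    have hz := eq_zero_of_quasinilpotent hT'c hC (R := R) (K := K) ?_ ?_ ?_
    · intro x hx
      exact congrArg Subtype.val (hz ⟨x, hx⟩)
    · intro d e he
      exact hHS d _ (he.comp_linearIsometry W.subtypeₗᵢ)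
    · intro z h1 h2 y
      exact hres z h1 h2 y
    · intro (κ : ℂ) hκ x hx
      have hx' : T x = κ • (x : H) := congrArg Subtype.val hx
      by_contra hx0
      have hx0' : (x : H) ≠ 0 := fun h => hx0 (Subtype.ext h)
      have hκe : Module.End.HasEigenvalue (T : H →ₗ[ℂ] H) κ :=
        Module.End.hasEigenvalue_of_hasEigenvector ⟨Module.End.mem_eigenspace_iff.2 hx', hx0'⟩
      refine hx0' (hWN x x.2 ?_)
      rw [hNm, hA, pow_succ, mul_apply_eq_comp, hBev κ x hx']
      have : p.eval κ = 0 := by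
        rw [hp, Polynomial.eval_prod]
        exact Finset.prod_eq_zero (hfin.mem_toFinset.2 ⟨hκ, hκe⟩) (by simp)
      rw [this, zero_smul, map_zero]
  have hle : LinearMap.range (T : H →ₗ[ℂ] H) ≤ N.map (T : H →ₗ[ℂ] H) := by
    rintro _ ⟨y, rfl⟩
    obtain ⟨x, hx⟩ := hdecomp y
    refine ⟨N.starProjection x, Submodule.starProjection_apply_mem N x, ?_⟩
    change T _ = T y
    rw [← hx, map_add, hTW _ (hWm x), zero_add]
  exact Submodule.finiteDimensional_of_le hle

end CompactOp

/-! ### Multiplicities of an operator and its adjoint; enumeration of the spectrum. -/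

namespace CompactOp

variable {H : Type*} [NormedAddCommGroup H] [InnerProductSpace ℂ H]

theorem coe_sub_smul_pow (T : H →L[ℂ] H) (κ : ℂ) (m : ℕ) :
    (((T - κ • (1 : H →L[ℂ] H)) ^ m : H →L[ℂ] H) : H →ₗ[ℂ] H) =
      ((T : H →ₗ[ℂ] H) - κ • (1 : Module.End ℂ H)) ^ m := by
  induction m with
  | zero => rfl
  | succ m ih => rw [pow_succ, pow_succ, ← ih]; rfl

/-- Root spaces of a compact operator for nonzero eigenvalues are kernels of large powers. -/
theorem exists_maxGenEigenspace_eq_ker [CompleteSpace H] {T : H →L[ℂ] H} (hT : IsCompactOperator T)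
    {κ : ℂ} (hκ : κ ≠ 0) : ∃ m, ∀ j, m ≤ j →
      Module.End.maxGenEigenspace (T : H →ₗ[ℂ] H) κ =
        LinearMap.ker (((T - κ • (1 : H →L[ℂ] H)) ^ j : H →L[ℂ] H) : H →ₗ[ℂ] H) := by
  obtain ⟨m, hm⟩ := exists_ker_pow_stable hT hκ
  set A := T - κ • (1 : H →L[ℂ] H) with hA
  have hstab : ∀ (j : ℕ) x, (A ^ (m + j)) x = 0 → (A ^ m) x = 0 := by
    intro j
    induction j with
    | zero => exact fun x hx => hx
    | succ j ih =>
      intro x hx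
      refine ih x ?_
      have h1 : (A ^ (m + 1)) ((A ^ j) x) = 0 := by
        rw [← mul_apply_eq_comp, ← pow_add]
        convert hx using 2
        ring_nf
      have := hm _ h1
      rwa [← mul_apply_eq_comp, ← pow_add] at this
  have hup : ∀ i j x, i ≤ j → (A ^ i) x = 0 → (A ^ j) x = 0 := by
    intro i j x hij hx
    obtain ⟨l, rfl⟩ := Nat.exists_eq_add_of_le' hij
    rw [pow_add, mul_apply_eq_comp, hx, map_zero]
  refine ⟨m, fun j hj => ?_⟩
  ext x
  rw [Module.End.mem_maxGenEigenspace]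
  constructor
  · rintro ⟨i, hi⟩
    rw [← coe_sub_smul_pow] at hi
    have h1 := hup i (m + i) x (by omega) hi
    exact hup m j x hj (hstab i x h1)
  · intro hx
    refine ⟨j, ?_⟩
    rw [← coe_sub_smul_pow]
    exact hx

theorem finiteDimensional_ker_pow [CompleteSpace H] {T : H →L[ℂ] H} (hT : IsCompactOperator T)
    {κ : ℂ} (hκ : κ ≠ 0) (m : ℕ) : FiniteDimensional ℂ
      (LinearMap.ker (((T - κ • (1 : H →L[ℂ] H)) ^ m : H →L[ℂ] H) : H →ₗ[ℂ] H)) := by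
  obtain ⟨K, hK, e⟩ := exists_compact_pow hT κ m
  have h : ∀ G : H →L[ℂ] H, G = K - (-(-κ) ^ m) • (1 : H →L[ℂ] H) →
      FiniteDimensional ℂ (LinearMap.ker (G : H →ₗ[ℂ] H)) := by
    rintro _ rfl
    exact finiteDimensional_ker hK (neg_ne_zero.2 (pow_ne_zero _ (neg_ne_zero.2 hκ)))
  exact h _ e

theorem finiteDimensional_maxGenEigenspace [CompleteSpace H] {T : H →L[ℂ] H}
    (hT : IsCompactOperator T) {κ : ℂ} (hκ : κ ≠ 0) :
    FiniteDimensional ℂ (Module.End.maxGenEigenspace (T : H →ₗ[ℂ] H) κ) := by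
  obtain ⟨m, hm⟩ := exists_maxGenEigenspace_eq_ker hT hκ
  rw [hm m le_rfl]
  exact finiteDimensional_ker_pow hT hκ m

theorem adjoint_sub_smul_pow [CompleteSpace H] (T : H →L[ℂ] H) (κ : ℂ) (m : ℕ) :
    ContinuousLinearMap.adjoint ((T - κ • (1 : H →L[ℂ] H)) ^ m) =
      (ContinuousLinearMap.adjoint T - conj κ • (1 : H →L[ℂ] H)) ^ m := by
  rw [← ContinuousLinearMap.star_eq_adjoint, star_pow, star_sub, star_smul, star_one]
  rfl

/-- Each power of `T - κ` is again compact minus a nonzero scalar, so it has index zero. The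
exponent one gives the geometric multiplicities, large exponents the algebraic ones. -/
theorem rank_ker_pow_adjoint [CompleteSpace H] {T : H →L[ℂ] H} (hT : IsCompactOperator T)
    {κ : ℂ} (hκ : κ ≠ 0) (m : ℕ) :
    Module.rank ℂ (LinearMap.ker (((T - κ • (1 : H →L[ℂ] H)) ^ m : H →L[ℂ] H) : H →ₗ[ℂ] H)) =
    Module.rank ℂ (LinearMap.ker (((ContinuousLinearMap.adjoint T - conj κ • (1 : H →L[ℂ] H)) ^ m :
      H →L[ℂ] H) : H →ₗ[ℂ] H)) := by
  obtain ⟨K, hK, e⟩ := exists_compact_pow hT κ m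
  have h1 := finiteDimensional_ker_pow hT hκ m
  have h2 := finiteDimensional_ker_pow (isCompactOperator_adjoint hT) (κ := conj κ)
    (by simpa using hκ) m
  rw [← Module.finrank_eq_rank, ← Module.finrank_eq_rank]
  have h3 := finrank_ker_adjoint hK (neg_ne_zero.2 (pow_ne_zero m (neg_ne_zero.2 hκ)))
  rw [← e, adjoint_sub_smul_pow] at h3
  exact_mod_cast h3.symm

/-- The algebraic multiplicities of a compact operator and of its adjoint agree. -/
theorem rank_maxGenEigenspace_adjoint [CompleteSpace H] {T : H →L[ℂ] H} (hT : IsCompactOperator T)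
    {κ : ℂ} (hκ : κ ≠ 0) :
    Module.rank ℂ (Module.End.maxGenEigenspace (T : H →ₗ[ℂ] H) κ) =
    Module.rank ℂ (Module.End.maxGenEigenspace
      ((ContinuousLinearMap.adjoint T : H →L[ℂ] H) : H →ₗ[ℂ] H) (conj κ)) := by
  obtain ⟨m, hm⟩ := exists_maxGenEigenspace_eq_ker hT hκ
  obtain ⟨m', hm'⟩ := exists_maxGenEigenspace_eq_ker (isCompactOperator_adjoint hT) (κ := conj κ)
    (by simpa using hκ)
  rw [hm _ (le_max_left m m'), hm' _ (le_max_right m m'), rank_ker_pow_adjoint hT hκ]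

theorem eigenspace_eq_ker (T : H →L[ℂ] H) (κ : ℂ) :
    Module.End.eigenspace (T : H →ₗ[ℂ] H) κ =
      LinearMap.ker (((T - κ • (1 : H →L[ℂ] H)) ^ 1 : H →L[ℂ] H) : H →ₗ[ℂ] H) := by
  ext x
  simp [sub_eq_zero]

/-- The geometric multiplicities of a compact operator and of its adjoint agree. -/
theorem rank_eigenspace_adjoint [CompleteSpace H] {T : H →L[ℂ] H} (hT : IsCompactOperator T)
    {κ : ℂ} (hκ : κ ≠ 0) :
    Module.rank ℂ (Module.End.eigenspace (T : H →ₗ[ℂ] H) κ) =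
    Module.rank ℂ (Module.End.eigenspace
      ((ContinuousLinearMap.adjoint T : H →L[ℂ] H) : H →ₗ[ℂ] H) (conj κ)) := by
  rw [eigenspace_eq_ker, eigenspace_eq_ker, rank_ker_pow_adjoint hT hκ]

theorem hasEigenvalue_iff_rank_ne_zero (f : Module.End ℂ H) (κ : ℂ) :
    Module.End.HasEigenvalue f κ ↔ Module.rank ℂ (Module.End.eigenspace f κ) ≠ 0 := by
  rw [Module.End.hasEigenvalue_iff, ne_eq, ne_eq, Submodule.rank_eq_zero]

theorem hasEigenvalue_adjoint_iff [CompleteSpace H] {T : H →L[ℂ] H} (hT : IsCompactOperator T)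
    {κ : ℂ} (hκ : κ ≠ 0) :
    Module.End.HasEigenvalue (T : H →ₗ[ℂ] H) κ ↔ Module.End.HasEigenvalue
      ((ContinuousLinearMap.adjoint T : H →L[ℂ] H) : H →ₗ[ℂ] H) (conj κ) := by
  rw [hasEigenvalue_iff_rank_ne_zero, hasEigenvalue_iff_rank_ne_zero, rank_eigenspace_adjoint hT hκ]

/-- The spectrum of a compact operator with infinitely many nonzero eigenvalues, enumerated with
multiplicities. -/
theorem exists_eigenvalue_sequence [CompleteSpace H] {S : H →L[ℂ] H} (hS : IsCompactOperator S)
    (hinf : {κ : ℂ | κ ≠ 0 ∧ Module.End.HasEigenvalue (S : H →ₗ[ℂ] H) κ}.Infinite) :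
    ∃ κ : ℕ → ℂ,
      (∀ k, κ k ≠ 0 ∧ Module.End.HasEigenvalue (S : H →ₗ[ℂ] H) (κ k)) ∧
      Tendsto κ atTop (𝓝 0) ∧ spectrum ℂ S = {0} ∪ Set.range κ ∧
      ∀ μ : ℂ, μ ≠ 0 →
        FiniteDimensional ℂ (Module.End.maxGenEigenspace (S : H →ₗ[ℂ] H) μ) ∧
        {k | κ k = μ}.encard =
          (Module.finrank ℂ (Module.End.maxGenEigenspace (S : H →ₗ[ℂ] H) μ) : ℕ∞) := by
  set Λ : Set ℂ := {κ : ℂ | κ ≠ 0 ∧ Module.End.HasEigenvalue (S : H →ₗ[ℂ] H) κ} with hΛ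
  let r : ℂ → ℕ := fun μ => Module.finrank ℂ (Module.End.maxGenEigenspace (S : H →ₗ[ℂ] H) μ)
  have hr : ∀ μ ∈ Λ, 0 < r μ := by
    intro μ hμ
    have := finiteDimensional_maxGenEigenspace hS hμ.1
    obtain ⟨x, hx⟩ := hμ.2.exists_hasEigenvector
    have hx' : x ∈ Module.End.maxGenEigenspace (S : H →ₗ[ℂ] H) μ :=
      Module.End.mem_maxGenEigenspace _ _ _ |>.2 ⟨1, by simp [hx.apply_eq_smul]⟩
    exact Module.finrank_pos_iff_exists_ne_zero.2
      ⟨⟨x, hx'⟩, fun h => hx.2 (congrArg Subtype.val h)⟩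
  have hr0 : ∀ μ, μ ≠ 0 → μ ∉ Λ → r μ = 0 := by
    intro μ hμ hμΛ
    have : Module.End.maxGenEigenspace (S : H →ₗ[ℂ] H) μ = ⊥ := by
      by_contra h
      refine hμΛ ⟨hμ, ?_⟩
      by_contra h2
      refine h ((Submodule.eq_bot_iff _).2 fun x hx => ?_)
      obtain ⟨k, hk⟩ := (Module.End.mem_maxGenEigenspace _ _ _).1 hx
      have hinj : ∀ y, ((S : H →ₗ[ℂ] H) - μ • (1 : Module.End ℂ H)) y = 0 → y = 0 := fun y hy => by
        by_contra hy0
        exact h2 (Module.End.hasEigenvalue_of_hasEigenvector (x := y)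
          ⟨Module.End.mem_eigenspace_iff.2 (by simpa [sub_eq_zero] using hy), hy0⟩)
      induction k generalizing x with
      | zero => simpa using hk
      | succ k ih =>
        rw [pow_succ, Module.End.mul_apply] at hk
        refine hinj x (ih _ ?_ hk)
        exact (Module.End.mem_maxGenEigenspace _ _ _).2 ⟨k, hk⟩
    simp only [r]
    rw [this, finrank_bot]
  have hΛc : Λ.Countable := by
    have : Λ ⊆ ⋃ j : ℕ, {κ : ℂ | 1 / ((j : ℝ) + 1) ≤ ‖κ‖ ∧
        Module.End.HasEigenvalue (S : H →ₗ[ℂ] H) κ} := by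
      intro κ hκ
      obtain ⟨j, hj⟩ := exists_nat_one_div_lt (norm_pos_iff.2 hκ.1)
      exact Set.mem_iUnion.2 ⟨j, hj.le, hκ.2⟩
    exact (Set.countable_iUnion fun j =>
      (finite_eigenvalues hS Nat.one_div_pos_of_nat).countable).mono this
  have : Countable Λ := hΛc.to_subtype
  have : Infinite Λ := hinf.to_subtype
  -- One index for each unit of algebraic multiplicity. `X` is countable because eigenvalues
  -- accumulate only at zero, and it is infinite because `Λ` is, so `ℕ` enumerates it.
  let X := Σ μ : Λ, Fin (r μ)
  have hXinf : Infinite X :=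
    Infinite.of_surjective (fun x : X => x.1) fun μ => ⟨⟨μ, ⟨0, hr μ μ.2⟩⟩, rfl⟩
  obtain ⟨e⟩ : Nonempty (ℕ ≃ X) := by
    obtain ⟨d⟩ := nonempty_denumerable X
    exact ⟨(Denumerable.eqv X).symm⟩
  let κ : ℕ → ℂ := fun k => (e k).1
  have hκΛ : ∀ k, κ k ∈ Λ := fun k => (e k).1.2
  have hκr : Set.range κ = Λ := by
    ext μ
    constructor
    · rintro ⟨k, rfl⟩; exact hκΛ k
    · intro hμ
      exact ⟨e.symm ⟨⟨μ, hμ⟩, ⟨0, hr μ hμ⟩⟩, by simp [κ]⟩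
  have hcard : ∀ μ, μ ≠ 0 → {k | κ k = μ}.encard = (r μ : ℕ∞) := by
    intro μ hμ
    by_cases hμΛ : μ ∈ Λ
    · have h1 : {k | κ k = μ} = Set.range fun i : Fin (r μ) => e.symm ⟨⟨μ, hμΛ⟩, i⟩ := by
        ext k
        constructor
        · intro hk
          obtain ⟨x, rfl⟩ := e.symm.surjective k
          obtain ⟨⟨μ', hμ'⟩, i⟩ := x
          have : μ' = μ := by simpa [κ] using hk
          subst this
          exact ⟨i, rfl⟩
        · rintro ⟨i, rfl⟩
          simp [κ]
      have h2 : Function.Injective fun i : Fin (r μ) => e.symm ⟨⟨μ, hμΛ⟩, i⟩ := by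
        intro i j hij
        exact eq_of_heq (Sigma.mk.inj (e.symm.injective hij)).2
      rw [h1, ← Set.image_univ, h2.encard_image]
      simp [Set.encard_univ]
    · rw [hr0 μ hμ hμΛ]
      have : {k | κ k = μ} = ∅ := by
        ext k
        simp only [Set.mem_ofPred_eq, Set.mem_empty_iff_false, iff_false]
        rintro rfl
        exact hμΛ (hκΛ k)
      rw [this]; simp
  have htend : Tendsto κ atTop (𝓝 0) := by
    rw [← Nat.cofinite_eq_atTop, Metric.tendsto_nhds]
    intro ε hε
    rw [Filter.eventually_cofinite]
    have hf := finite_eigenvalues hS hε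
    have : {k | ¬ dist (κ k) 0 < ε} ⊆ ⋃ μ ∈ {κ : ℂ | ε ≤ ‖κ‖ ∧
        Module.End.HasEigenvalue (S : H →ₗ[ℂ] H) κ}, {k | κ k = μ} := by
      intro k hk
      simp only [Set.mem_ofPred_eq, dist_zero_right, not_lt] at hk
      exact Set.mem_iUnion₂.2 ⟨κ k, ⟨hk, (hκΛ k).2⟩, rfl⟩
    -- Only finitely many eigenvalues have modulus at least `ε`, and each is repeated finitely
    -- often.
    refine (hf.biUnion fun μ hμ => ?_).subset this
    have hμ0 : μ ≠ 0 := norm_pos_iff.1 (hε.trans_le hμ.1)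
    rw [← Set.encard_lt_top_iff, hcard μ hμ0]
    exact ENat.natCast_lt_top _
  refine ⟨κ, hκΛ, htend, ?_, fun μ hμ => ⟨finiteDimensional_maxGenEigenspace hS hμ, hcard μ hμ⟩⟩
  ext μ
  rw [hκr, Set.mem_union, Set.mem_singleton_iff]
  constructor
  · intro hμ
    by_cases h0 : μ = 0
    · exact Or.inl h0
    · exact Or.inr ⟨h0, (hS.hasEigenvalue_iff_mem_spectrum h0).2 hμ⟩
  · rintro (rfl | hμ)
    -- Zero is in the spectrum as a limit of eigenvalues, whether or not it is an eigenvalue.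
    · refine (spectrum.isClosed S).mem_of_tendsto htend (Eventually.of_forall fun k => ?_)
      exact (hS.hasEigenvalue_iff_mem_spectrum (hκΛ k).1).1 (hκΛ k).2
    · exact (hS.hasEigenvalue_iff_mem_spectrum hμ.1).1 hμ.2

end CompactOp

/-! ### The abstract perturbed saddle point problem. -/

namespace SaddlePoint

/-- A bounded coercive operator on a complex Hilbert space is invertible. -/
theorem isUnit_of_coercive {V : Type*} [NormedAddCommGroup V] [InnerProductSpace ℂ V]
    [CompleteSpace V] (A : V →L[ℂ] V) {α : ℝ} (hα : 0 < α)
    (h : ∀ x, α * ‖x‖ ^ 2 ≤ (inner ℂ x (A x)).re) : IsUnit A := by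
  have hb : ∀ x, α * ‖x‖ ≤ ‖A x‖ := fun x => by
    rcases (norm_nonneg x).eq_or_lt with h0 | h0
    · rw [← h0]; simp
    · have h1 := (h x).trans ((Complex.re_le_norm _).trans (norm_inner_le_norm x (A x)))
      nlinarith
  have hanti : AntilipschitzWith (Real.toNNReal α⁻¹) A := by
    refine ContinuousLinearMap.antilipschitz_of_bound A fun x => ?_
    rw [Real.coe_toNNReal _ (inv_nonneg.2 hα.le)]
    have := hb x
    rw [inv_mul_eq_div, le_div_iff₀ hα, mul_comm]
    exact this
  rw [ContinuousLinearMap.isUnit_iff_bijective]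
  refine ⟨hanti.injective, ?_⟩
  have hcl : IsClosed ((LinearMap.range (A : V →ₗ[ℂ] V)) : Set V) :=
    hanti.isClosed_range A.uniformContinuous
  have hcomp := hcl.completeSpace_coe
  have htop : LinearMap.range (A : V →ₗ[ℂ] V) = ⊤ := by
    rw [← (LinearMap.range (A : V →ₗ[ℂ] V)).orthogonal_orthogonal, Submodule.eq_top_iff']
    intro v w hw
    have h1 : inner ℂ w (A w) = 0 := inner_eq_zero_symm.1 (hw _ ⟨w, rfl⟩)
    have h2 := h w
    rw [h1, Complex.zero_re] at h2
    have h3 : w = 0 := by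
      by_contra h0
      have := norm_pos_iff.2 h0
      have : 0 < α * ‖w‖ ^ 2 := by positivity
      linarith
    rw [h3, inner_zero_left]
  exact LinearMap.range_eq_top.1 htop

variable {E Q : Type*} [NormedAddCommGroup E] [InnerProductSpace ℂ E]
  [NormedAddCommGroup Q] [InnerProductSpace ℂ Q]

/-- `(p, u)` solves the perturbed saddle point problem with datum `f`, where `p` ranges over a
space `G` of pairs, `P` is the principal part and `B` the perturbation. -/
structure IsSol (G : Submodule ℂ (WithLp 2 (E × Q))) (P : E →L[ℂ] E) (ν : ℝ) (B : Q →L[ℂ] E)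
    (f : Q) (p : WithLp 2 (E × Q)) (u : Q) : Prop where
  mem : p ∈ G
  eq₁ : ∀ q ∈ G, inner ℂ (P q.fst) (P p.fst) + inner ℂ q.fst (B u) + ν * inner ℂ q.snd u = 0
  eq₂ : p.snd = -f

/-- The pairs `(g, u)` such that `g` is the negative adjoint image of `u`. -/
def gradSpace (G : Submodule ℂ (WithLp 2 (E × Q))) (P : E →L[ℂ] E) :
    Submodule ℂ (WithLp 2 (E × Q)) where
  carrier := {y | P y.fst = y.fst ∧ ∀ q ∈ G, inner ℂ (P q.fst) y.fst + inner ℂ q.snd y.snd = 0}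
  add_mem' := by
    rintro a b ⟨ha, ha'⟩ ⟨hb, hb'⟩
    refine ⟨by simp [ha, hb], fun q hq => ?_⟩
    have h1 := ha' q hq
    have h2 := hb' q hq
    simp only [WithLp.add_fst, WithLp.add_snd, inner_add_right]
    linear_combination h1 + h2
  zero_mem' := by simp
  smul_mem' := by
    rintro c a ⟨ha, ha'⟩
    refine ⟨by simp [ha], fun q hq => ?_⟩
    have h1 := ha' q hq
    simp only [WithLp.smul_fst, WithLp.smul_snd, inner_smul_right]
    linear_combination c * h1

variable {G : Submodule ℂ (WithLp 2 (E × Q))} {P : E →L[ℂ] E} {ν : ℝ} {B : Q →L[ℂ] E}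

theorem mem_gradSpace {y : WithLp 2 (E × Q)} : y ∈ gradSpace G P ↔ P y.fst = y.fst ∧
    ∀ q ∈ G, inner ℂ (P q.fst) y.fst + inner ℂ q.snd y.snd = 0 := Iff.rfl

theorem isClosed_gradSpace : IsClosed ((gradSpace G P : Submodule ℂ (WithLp 2 (E × Q))) :
    Set (WithLp 2 (E × Q))) := by
  have h1 : Continuous fun y : WithLp 2 (E × Q) => y.fst := (WithLp.fstL 2 ℂ E Q).continuous
  have h2 : Continuous fun y : WithLp 2 (E × Q) => y.snd := (WithLp.sndL 2 ℂ E Q).continuous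
  have e : ((gradSpace G P : Submodule ℂ (WithLp 2 (E × Q))) : Set (WithLp 2 (E × Q))) =
      {y | P y.fst = y.fst} ∩ ⋂ q ∈ G, {y | inner ℂ (P q.fst) y.fst + inner ℂ q.snd y.snd = 0} := by
    ext y
    simp [mem_gradSpace]
  rw [e]
  refine (isClosed_eq (P.continuous.comp h1) h1).inter (isClosed_biInter fun q _ => ?_)
  exact isClosed_eq (by fun_prop) continuous_const

theorem norm_fst_le {E Q : Type*} [SeminormedAddCommGroup E] [SeminormedAddCommGroup Q]
    (p : WithLp 2 (E × Q)) : ‖p.fst‖ ≤ ‖p‖ := by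
  refine le_of_sq_le_sq ?_ (norm_nonneg _)
  rw [WithLp.prod_norm_sq_eq_of_L2]
  linarith [sq_nonneg ‖p.snd‖]

/-- The standing hypotheses: `P` is an orthogonal projection onto a space containing the range
of `B`. -/
structure IsPerturbation (P : E →L[ℂ] E) (B : Q →L[ℂ] E) : Prop where
  symm : ∀ x y, inner ℂ (P x) y = inner ℂ x (P y)
  idem : ∀ x, P (P x) = P x
  range : ∀ u, P (B u) = B u

theorem IsPerturbation.norm_le (h : IsPerturbation P B) (x : E) : ‖P x‖ ≤ ‖x‖ := by
  rcases (norm_nonneg (P x)).eq_or_lt with h0 | h0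
  · rw [← h0]; exact norm_nonneg _
  · have h1 : inner ℂ (P x) (P x) = inner ℂ x (P x) := by rw [h.symm, h.idem]
    have h2 : ‖(inner ℂ (P x) (P x) : ℂ)‖ ≤ ‖x‖ * ‖P x‖ := h1 ▸ norm_inner_le_norm _ _
    rw [inner_self_eq_norm_sq_to_K] at h2
    have h3 : ‖P x‖ * ‖P x‖ ≤ ‖x‖ * ‖P x‖ := by simpa [sq] using h2
    exact le_of_mul_le_mul_right h3 h0

/-- The inf-sup condition, with the supremum eliminated. -/
def InfSup (G : Submodule ℂ (WithLp 2 (E × Q))) (γ : ℝ) : Prop :=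
  ∀ (q : Q) (M : ℝ), 0 ≤ M → (∀ p ∈ G, ‖(inner ℂ q p.snd : ℂ)‖ ≤ M * ‖p‖) → γ * ‖q‖ ≤ M

/-- The inf-sup condition bounds the second component of a pair in `gradSpace` by the first. -/
theorem norm_snd_le (hP : IsPerturbation P B) {γ : ℝ} (hγ : InfSup G γ)
    {y : WithLp 2 (E × Q)} (hy : y ∈ gradSpace G P) : γ * ‖y.snd‖ ≤ ‖y.fst‖ := by
  refine hγ _ _ (norm_nonneg _) fun p hp => ?_
  have h1 := hy.2 p hp
  have h2 : inner ℂ p.snd y.snd = - inner ℂ (P p.fst) y.fst := by linear_combination h1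
  rw [norm_inner_symm, h2, norm_neg]
  refine (norm_inner_le_norm _ _).trans ?_
  rw [mul_comm]
  gcongr
  exact (hP.norm_le _).trans (norm_fst_le p)

/-- Divided by `ν`, the first equation is the definition of a weak gradient of `u`. This identifies
the gradient with `(P σ + B u) / ν`, because `B u` lies in the range of `P`. -/
theorem IsSol.grad_mem (hP : IsPerturbation P B) (hν : 0 < ν) {f : Q} {p : WithLp 2 (E × Q)} {u : Q}
    (h : IsSol G P ν B f p u) :
    WithLp.toLp 2 ((ν : ℂ)⁻¹ • (P p.fst + B u), u) ∈ gradSpace G P := by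
  have hν' : (ν : ℂ) ≠ 0 := by exact_mod_cast hν.ne'
  refine ⟨by simp [hP.idem, hP.range], fun q hq => ?_⟩
  have h1 := h.eq₁ q hq
  have h2 : inner ℂ (P q.fst) (B u) = inner ℂ q.fst (B u) := by rw [hP.symm, hP.range]
  change inner ℂ (P q.fst) ((ν : ℂ)⁻¹ • (P p.fst + B u)) + inner ℂ q.snd u = 0
  rw [inner_smul_right, inner_add_right, h2]
  field_simp
  linear_combination h1

/-- The weak form of the problem on `gradSpace`. -/
theorem IsSol.weak {f : Q} {p : WithLp 2 (E × Q)} {u : Q}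
    (h : IsSol G P ν B f p u) {y : WithLp 2 (E × Q)} (hy : y ∈ gradSpace G P) :
    inner ℂ y.fst (P p.fst) = inner ℂ y.snd f := by
  have h1 := congrArg conj (hy.2 p h.mem)
  rw [map_add, inner_conj_symm, inner_conj_symm, h.eq₂, inner_neg_right, map_zero] at h1
  linear_combination h1

/-- The weak form is tested with the solution's own pair `(g, u)`, in which `P σ = ν g - B u`. -/
theorem IsSol.energy (hP : IsPerturbation P B) (hν : 0 < ν) {f : Q} {p : WithLp 2 (E × Q)} {u : Q}
    (h : IsSol G P ν B f p u) {g : E} (hg : g = (ν : ℂ)⁻¹ • (P p.fst + B u)) :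
    ν * (‖g‖ : ℂ) ^ 2 - inner ℂ g (B u) = inner ℂ u f := by
  have hν' : (ν : ℂ) ≠ 0 := by exact_mod_cast hν.ne'
  have h1 := h.weak (h.grad_mem hP hν)
  change inner ℂ ((ν : ℂ)⁻¹ • (P p.fst + B u)) (P p.fst) = inner ℂ u f at h1
  rw [← hg] at h1
  have h2 : P p.fst = (ν : ℂ) • g - B u := by
    rw [hg, smul_smul, mul_inv_cancel₀ hν', one_smul]; abel
  rw [h2, inner_sub_right, inner_smul_right, inner_self_eq_norm_sq_to_K] at h1
  exact h1

/-- A priori estimates for the solution. -/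
theorem IsSol.norm_grad_le (hP : IsPerturbation P B) (hν : 0 < ν) {γ b : ℝ} (hγ0 : 0 < γ)
    (hγ : InfSup G γ) (hb : ∀ u, ‖B u‖ ≤ b * ‖u‖) (hb0 : 0 ≤ b)
    {f : Q} {p : WithLp 2 (E × Q)} {u : Q} (h : IsSol G P ν B f p u) {g : E}
    (hg : g = (ν : ℂ)⁻¹ • (P p.fst + B u)) : γ * ‖u‖ ≤ ‖g‖ ∧ (γ * ν - b) * ‖g‖ ≤ ‖f‖ := by
  have h1 := norm_snd_le hP hγ (h.grad_mem hP hν)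
  rw [← hg] at h1
  have h1' : γ * ‖u‖ ≤ ‖g‖ := h1
  refine ⟨h1', ?_⟩
  have h2 := h.energy hP hν hg
  have h3 : ν * ‖g‖ ^ 2 ≤ ‖u‖ * ‖f‖ + ‖g‖ * (b * ‖u‖) := by
    have e : (ν * ‖g‖ ^ 2 : ℝ) = ‖(inner ℂ u f + inner ℂ g (B u) : ℂ)‖ := by
      rw [← h2, sub_add_cancel, norm_mul, norm_pow, Complex.norm_real, Complex.norm_real, norm_norm,
        Real.norm_of_nonneg hν.le]
    rw [e]
    refine (norm_add_le _ _).trans (add_le_add (norm_inner_le_norm _ _) ?_)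
    exact (norm_inner_le_norm _ _).trans (by gcongr; exact hb u)
  rcases (norm_nonneg g).eq_or_lt with h0 | h0
  · rw [← h0]; simp
  -- Both occurrences of `‖u‖` in the energy bound are traded for `‖g‖ / γ`; the convective term is
  -- then absorbed on the left.
  · have h4 : γ * (ν * ‖g‖ ^ 2) ≤ ‖g‖ * ‖f‖ + ‖g‖ * b * ‖g‖ := by
      calc γ * (ν * ‖g‖ ^ 2) ≤ γ * (‖u‖ * ‖f‖ + ‖g‖ * (b * ‖u‖)) := by gcongr
        _ = (γ * ‖u‖) * ‖f‖ + ‖g‖ * b * (γ * ‖u‖) := by ring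
        _ ≤ _ := by gcongr
    have h5 : ((γ * ν - b) * ‖g‖) * ‖g‖ ≤ ‖f‖ * ‖g‖ := by linarith
    exact le_of_mul_le_mul_right h5 h0

theorem IsSol.sub {f f' : Q} {p p' : WithLp 2 (E × Q)} {u u' : Q}
    (h : IsSol G P ν B f p u) (h' : IsSol G P ν B f' p' u') :
    IsSol G P ν B (f - f') (p - p') (u - u') where
  mem := sub_mem h.mem h'.mem
  eq₁ q hq := by
    have h1 := h.eq₁ q hq
    have h2 := h'.eq₁ q hq
    simp only [WithLp.sub_fst, map_sub, inner_sub_right]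
    linear_combination h1 - h2
  eq₂ := by rw [WithLp.sub_snd, h.eq₂, h'.eq₂]; abel

/-- The difference of two solutions has zero datum. The a priori estimates make its gradient and its
field vanish, and then both `P σ` and the divergence vanish, so that coercivity on `G` forces `σ =
0`. -/
theorem IsSol.unique (hP : IsPerturbation P B) (hν : 0 < ν) {γ b c : ℝ} (hγ0 : 0 < γ)
    (hγ : InfSup G γ) (hb : ∀ u, ‖B u‖ ≤ b * ‖u‖) (hb0 : 0 ≤ b) (hbν : b < γ * ν) (hc : 0 < c)
    (hcG : ∀ p ∈ G, c * ‖p‖ ^ 2 ≤ ‖P p.fst‖ ^ 2 + ‖p.snd‖ ^ 2)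
    {f : Q} {p p' : WithLp 2 (E × Q)} {u u' : Q}
    (h : IsSol G P ν B f p u) (h' : IsSol G P ν B f p' u') : p = p' ∧ u = u' := by
  have hν' : (ν : ℂ) ≠ 0 := by exact_mod_cast hν.ne'
  have hd := h.sub h'
  rw [sub_self] at hd
  obtain ⟨h1, h2⟩ := hd.norm_grad_le hP hν hγ0 hγ hb hb0 rfl
  rw [norm_zero] at h2
  have h3 : ‖(ν : ℂ)⁻¹ • (P (p - p').fst + B (u - u'))‖ = 0 :=
    le_antisymm (by nlinarith) (norm_nonneg _)
  rw [h3] at h1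
  have h4 : u - u' = 0 := norm_eq_zero.1 (le_antisymm (by nlinarith) (norm_nonneg _))
  have h5 : P (p - p').fst = 0 := by
    rw [norm_eq_zero, smul_eq_zero, h4, map_zero, add_zero] at h3
    exact h3.resolve_left (inv_ne_zero hν')
  have h6 := hcG _ hd.mem
  rw [h5, hd.eq₂] at h6
  have h7 : ‖p - p'‖ = 0 := by
    have : ‖p - p'‖ ^ 2 ≤ 0 := by simp at h6; nlinarith
    nlinarith [norm_nonneg (p - p')]
  exact ⟨sub_eq_zero.1 (norm_eq_zero.1 h7), sub_eq_zero.1 h4⟩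

/-- The perturbed saddle point problem has a bounded solution operator. -/
theorem exists_solution_operator [CompleteSpace E] [CompleteSpace Q] (hP : IsPerturbation P B)
    (hν : 0 < ν) {γ b c : ℝ} (hγ0 : 0 < γ)
    (hγ : InfSup G γ) (hb : ∀ u, ‖B u‖ ≤ b * ‖u‖) (hb0 : 0 ≤ b) (hbν : b < γ * ν) (hc : 0 < c)
    (hcG : ∀ p ∈ G, c * ‖p‖ ^ 2 ≤ ‖P p.fst‖ ^ 2 + ‖p.snd‖ ^ 2)
    (hG : IsClosed (G : Set (WithLp 2 (E × Q)))) :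
    ∃ T : Q →L[ℂ] Q, ∀ f, ∃ p, IsSol G P ν B f p (T f) := by
  have hν' : (ν : ℂ) ≠ 0 := by exact_mod_cast hν.ne'
  set V := gradSpace G P with hV
  have hVc : CompleteSpace V := isClosed_gradSpace.completeSpace_coe
  let p₁ : V →L[ℂ] E := WithLp.fstL 2 ℂ E Q ∘L V.subtypeL
  let p₂ : V →L[ℂ] Q := WithLp.sndL 2 ℂ E Q ∘L V.subtypeL
  have hp₁ : ∀ x : V, p₁ x = (x : WithLp 2 (E × Q)).fst := fun x => rfl
  have hp₂ : ∀ x : V, p₂ x = (x : WithLp 2 (E × Q)).snd := fun x => rfl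
  let A : V →L[ℂ] V := (ν : ℂ) • (ContinuousLinearMap.adjoint p₁ ∘L p₁) -
    ContinuousLinearMap.adjoint p₁ ∘L B ∘L p₂
  have hA : ∀ x y : V, inner ℂ y (A x) = ν * inner ℂ (p₁ y) (p₁ x) - inner ℂ (p₁ y) (B (p₂ x)) := by
    intro x y
    have e : A x = (ν : ℂ) • ContinuousLinearMap.adjoint p₁ (p₁ x) -
      ContinuousLinearMap.adjoint p₁ (B (p₂ x)) := rfl
    rw [e, inner_sub_right, ContinuousLinearMap.adjoint_inner_right,
      ← ContinuousLinearMap.adjoint_inner_right p₁ y (p₁ x)]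
    congr 1
    exact inner_smul_right y (ContinuousLinearMap.adjoint p₁ (p₁ x)) (ν : ℂ)
  have hγp : ∀ x : V, γ * ‖p₂ x‖ ≤ ‖p₁ x‖ := fun x => norm_snd_le hP hγ x.2
  have hδ : 0 < ν - b / γ := by
    rw [sub_pos, div_lt_iff₀ hγ0, mul_comm]; exact hbν
  -- The term with `B` costs at most `(b / γ) ‖g‖²`, and `‖u‖ ≤ ‖g‖ / γ` bounds the full norm of the
  -- pair by `(1 + γ⁻²) ‖g‖²`.
  have hcoer : ∀ x : V, ((ν - b / γ) * (1 + (γ ^ 2)⁻¹)⁻¹) * ‖x‖ ^ 2 ≤ (inner ℂ x (A x)).re := by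
    intro x
    have h1 : ‖p₂ x‖ ≤ ‖p₁ x‖ / γ := by
      rw [le_div_iff₀ hγ0, mul_comm]; exact hγp x
    have h2 : ‖x‖ ^ 2 ≤ (1 + (γ ^ 2)⁻¹) * ‖p₁ x‖ ^ 2 := by
      have e : ‖x‖ ^ 2 = ‖p₁ x‖ ^ 2 + ‖p₂ x‖ ^ 2 :=
        WithLp.prod_norm_sq_eq_of_L2 (x : WithLp 2 (E × Q))
      have h3 : ‖p₂ x‖ ^ 2 ≤ (‖p₁ x‖ / γ) ^ 2 := by gcongr
      rw [div_pow] at h3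
      rw [e, add_mul, one_mul, inv_mul_eq_div]
      linarith
    have h3 : (inner ℂ (p₁ x) (B (p₂ x))).re ≤ b / γ * ‖p₁ x‖ ^ 2 := by
      refine ((Complex.re_le_norm _).trans (norm_inner_le_norm _ _)).trans ?_
      calc ‖p₁ x‖ * ‖B (p₂ x)‖ ≤ ‖p₁ x‖ * (b * (‖p₁ x‖ / γ)) := by
            gcongr; exact (hb _).trans (by gcongr)
        _ = _ := by ring
    have h4 : (inner ℂ x (A x)).re = ν * ‖p₁ x‖ ^ 2 - (inner ℂ (p₁ x) (B (p₂ x))).re := by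
      have e : (inner ℂ (p₁ x) (p₁ x) : ℂ) = ((‖p₁ x‖ ^ 2 : ℝ) : ℂ) := by
        rw [inner_self_eq_norm_sq_to_K]; simp
      rw [hA, e, Complex.sub_re, Complex.re_ofReal_mul, Complex.ofReal_re]
    rw [h4, mul_assoc]
    have h5 : (1 + (γ ^ 2)⁻¹)⁻¹ * ‖x‖ ^ 2 ≤ ‖p₁ x‖ ^ 2 := by
      rw [inv_mul_le_iff₀ (by positivity)]; exact h2
    have h6 := mul_le_mul_of_nonneg_left h5 hδ.le
    linarith
  obtain ⟨U, hU⟩ := isUnit_of_coercive A (mul_pos hδ (by positivity)) hcoer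
  let R : V →L[ℂ] V := ((U⁻¹ : (V →L[ℂ] V)ˣ) : V →L[ℂ] V)
  have hAR : ∀ y, A (R y) = y := fun y => by
    rw [← hU, ← mul_apply_eq_comp, Units.mul_inv, one_apply_eq_self]
  let Φ : WithLp 2 (E × Q) →L[ℂ] WithLp 2 (E × Q) :=
    (WithLp.prodContinuousLinearEquiv 2 ℂ E Q).symm.toContinuousLinearMap ∘L
      ((P ∘L WithLp.fstL 2 ℂ E Q).prod (WithLp.sndL 2 ℂ E Q))
  have hΦ : ∀ q, Φ q = WithLp.toLp 2 (P q.fst, q.snd) := fun q => rfl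
  -- The pairs `(P σ, div σ)` that occur. Coercivity on `G` bounds this map below, so its image is
  -- closed and equals its double orthogonal complement.
  let W : Submodule ℂ (WithLp 2 (E × Q)) := G.map (Φ : WithLp 2 (E × Q) →ₗ[ℂ] WithLp 2 (E × Q))
  have hWc : IsClosed (W : Set (WithLp 2 (E × Q))) := by
    have hGc : CompleteSpace G := hG.completeSpace_coe
    have hanti : AntilipschitzWith (Real.toNNReal (√c)⁻¹) (Φ ∘L G.subtypeL) := by
      refine ContinuousLinearMap.antilipschitz_of_bound _ fun x => ?_
      rw [Real.coe_toNNReal _ (by positivity), inv_mul_eq_div, le_div_iff₀ (by positivity)]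
      refine le_of_sq_le_sq ?_ (norm_nonneg _)
      have h1 : ‖(Φ ∘L G.subtypeL) x‖ ^ 2 = ‖P (x : WithLp 2 (E × Q)).fst‖ ^ 2 +
          ‖(x : WithLp 2 (E × Q)).snd‖ ^ 2 := WithLp.prod_norm_sq_eq_of_L2 _
      rw [h1, mul_pow, Real.sq_sqrt hc.le, mul_comm]
      exact hcG x x.2
    have e : (W : Set (WithLp 2 (E × Q))) = Set.range (Φ ∘L G.subtypeL) := by
      ext y
      constructor
      · rintro ⟨x, hx, rfl⟩
        exact ⟨⟨x, hx⟩, rfl⟩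
      · rintro ⟨x, rfl⟩
        exact ⟨x, x.2, rfl⟩
    rw [e]
    exact hanti.isClosed_range (Φ ∘L G.subtypeL).uniformContinuous
  have hWcomp := hWc.completeSpace_coe
  refine ⟨p₂ ∘L R ∘L ContinuousLinearMap.adjoint p₂, fun f => ?_⟩
  set x : V := R (ContinuousLinearMap.adjoint p₂ f) with hx
  have hweak : ∀ y : V, ν * inner ℂ (p₁ y) (p₁ x) - inner ℂ (p₁ y) (B (p₂ x)) =
      inner ℂ (p₂ y) f := fun y => by
    rw [← hA, hx, hAR, ContinuousLinearMap.adjoint_inner_right]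
  have hxP : P (p₁ x) = p₁ x := x.2.1
  set Z : E := (ν : ℂ) • p₁ x - B (p₂ x) with hZ
  have hPZ : P Z = Z := by rw [hZ, map_sub, map_smul, hxP, hP.range]
  -- Recovery of `σ`: a pair orthogonal to `W` becomes an element of `gradSpace` after applying `P`
  -- to its first component, and the weak equation says exactly that `(Z, -f)` is orthogonal to it.
  have hmem : WithLp.toLp 2 (Z, -f) ∈ W := by
    rw [← W.orthogonal_orthogonal]
    rw [Submodule.mem_orthogonal]
    intro y hy
    have hyV : WithLp.toLp 2 (P y.fst, y.snd) ∈ V := by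
      refine ⟨hP.idem _, fun q hq => ?_⟩
      have h1 := (Submodule.mem_orthogonal _ _).1 hy (Φ q) ⟨q, hq, rfl⟩
      rw [hΦ, WithLp.prod_inner_apply] at h1
      have h2 : inner ℂ (P q.fst) (P y.fst) = inner ℂ (P q.fst) y.fst := by
        rw [← hP.symm, hP.idem]
      change inner ℂ (P q.fst) (P y.fst) + inner ℂ q.snd y.snd = 0
      rw [h2]
      exact h1
    have h1 := hweak ⟨_, hyV⟩
    change ν * inner ℂ (P y.fst) (p₁ x) - inner ℂ (P y.fst) (B (p₂ x)) = inner ℂ y.snd f at h1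
    rw [WithLp.prod_inner_apply]
    change inner ℂ y.fst Z + inner ℂ y.snd (-f) = 0
    have h2 : inner ℂ y.fst Z = inner ℂ (P y.fst) Z := by rw [hP.symm, hPZ]
    rw [h2, hZ, inner_sub_right, inner_smul_right, inner_neg_right, h1, add_neg_cancel]
  obtain ⟨p, hp, hpe⟩ := hmem
  have hp1 : P p.fst = Z := congrArg WithLp.fst hpe
  have hp2 : p.snd = -f := congrArg WithLp.snd hpe
  refine ⟨p, hp, fun q hq => ?_, hp2⟩
  change inner ℂ (P q.fst) (P p.fst) + inner ℂ q.fst (B (p₂ x)) + ν * inner ℂ q.snd (p₂ x) = 0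
  have h1 := x.2.2 q hq
  have h2 : inner ℂ (P q.fst) (B (p₂ x)) = inner ℂ q.fst (B (p₂ x)) := by rw [hP.symm, hP.range]
  rw [hp1, hZ, inner_sub_right, inner_smul_right, h2]
  rw [← hp₁, ← hp₂] at h1
  linear_combination ν * h1

end SaddlePoint

/-! ### The pseudostress Oseen problems as instances of the abstract problem. -/

namespace Oseen

variable {n : ℕ} {Ω : Set (Pt n)}

/-! ### Tensor algebra -/

theorem dot_eq_inner (s r : Vec n) : dot s r = inner ℂ r s := by
  simp [dot, PiLp.inner_apply, RCLike.inner_apply]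

theorem ddot_eq_inner (A B : Ten n) : ddot A B = inner ℂ B A := by
  simp [ddot, PiLp.inner_apply, RCLike.inner_apply]

/-- The identity tensor. -/
noncomputable def idTen (n : ℕ) : Ten n := WithLp.toLp 2 fun p => if p.1 = p.2 then 1 else 0

theorem tr_eq_inner (A : Ten n) : tr A = inner ℂ (idTen n) A := by
  simp [tr, idTen, PiLp.inner_apply, RCLike.inner_apply, Fintype.sum_prod_type]

theorem dev_eq (A : Ten n) : dev A = A - (tr A / n) • idTen n := by
  ext p
  simp [dev, idTen]

/-- The deviatoric part as a continuous linear map. -/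
noncomputable def devCLM (n : ℕ) : Ten n →L[ℂ] Ten n :=
  ContinuousLinearMap.id ℂ _ - (n : ℂ)⁻¹ • (innerSL ℂ (idTen n)).smulRight (idTen n)

theorem devCLM_apply (A : Ten n) : devCLM n A = dev A := by
  rw [dev_eq, tr_eq_inner]
  simp [devCLM, smul_smul, div_eq_inv_mul]

theorem tr_idTen : tr (idTen n) = n := by
  simp [tr, idTen]

theorem tr_dev (hn : n ≠ 0) (A : Ten n) : tr (dev A) = 0 := by
  have : (n : ℂ) ≠ 0 := by exact_mod_cast hn
  rw [dev_eq, tr_eq_inner, inner_sub_right, inner_smul_right, ← tr_eq_inner, ← tr_eq_inner,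
    tr_idTen]
  field_simp
  ring

theorem dev_dev (hn : n ≠ 0) (A : Ten n) : dev (dev A) = dev A := by
  rw [dev_eq (dev A), tr_dev hn]
  simp

theorem inner_dev (A B : Ten n) : (inner ℂ (dev A) B : ℂ) = inner ℂ A (dev B) := by
  rw [dev_eq, dev_eq, inner_sub_left, inner_sub_right, inner_smul_left, inner_smul_right,
    tr_eq_inner, tr_eq_inner]
  simp only [map_div₀, inner_conj_symm, map_natCast]
  ring

theorem norm_dyad (v : Vec n) (b : Pt n) : ‖dyad v b‖ = ‖v‖ * ‖b‖ := by
  refine (sq_eq_sq₀ (norm_nonneg _) (by positivity)).1 ?_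
  rw [mul_pow, EuclideanSpace.norm_sq_eq, EuclideanSpace.norm_sq_eq, EuclideanSpace.norm_sq_eq,
    Finset.sum_mul_sum, Fintype.sum_prod_type]
  simp [dyad, mul_pow]

theorem continuous_dyad : Continuous fun p : Vec n × Pt n => dyad p.1 p.2 := by
  unfold dyad
  fun_prop

/-! ### Operators on square integrable fields -/

/-- The deviatoric part of a tensor field. -/
noncomputable def devL (Ω : Set (Pt n)) : TenL2 Ω →L[ℂ] TenL2 Ω :=
  (devCLM n).compLpL 2 (volume.restrict Ω)

theorem coeFn_devL (τ : TenL2 Ω) : devL Ω τ =ᵐ[volume.restrict Ω] fun x => dev (τ x) := by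
  filter_upwards [(devCLM n).coeFn_compLpL (p := 2) τ] with x hx
  rw [← devCLM_apply]
  exact hx

theorem inner_devL (σ τ : TenL2 Ω) : (inner ℂ (devL Ω σ) τ : ℂ) = inner ℂ σ (devL Ω τ) := by
  rw [L2.inner_def, L2.inner_def]
  refine integral_congr_ae ?_
  filter_upwards [coeFn_devL σ, coeFn_devL τ] with x h1 h2
  rw [h1, h2, inner_dev]

theorem devL_devL (hn : n ≠ 0) (τ : TenL2 Ω) : devL Ω (devL Ω τ) = devL Ω τ := by
  refine Lp.ext ?_
  filter_upwards [coeFn_devL (devL Ω τ), coeFn_devL τ] with x h1 h2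
  rw [h1, h2, dev_dev hn]

theorem ae_norm_le_supNorm {β : Pt n → Pt n} (hβ : MemLp β ⊤ (volume.restrict Ω)) :
    ∀ᵐ x ∂(volume.restrict Ω), ‖β x‖ ≤ supNorm Ω β := by
  filter_upwards [enorm_ae_le_eLpNormEssSup β (volume.restrict Ω)] with x hx
  rw [supNorm, eLpNorm_exponent_top]
  have h := hβ.2
  rw [eLpNorm_exponent_top] at h
  rw [← toReal_enorm]
  exact ENNReal.toReal_mono h.ne hx

theorem ae_norm_dyad_le {β : Pt n → Pt n} (hβ : MemLp β ⊤ (volume.restrict Ω)) (u : VecL2 Ω) :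
    ∀ᵐ x ∂(volume.restrict Ω), ‖dyad (u x) (β x)‖ ≤ supNorm Ω β * ‖u x‖ := by
  filter_upwards [ae_norm_le_supNorm hβ] with x hx
  rw [norm_dyad, mul_comm]
  gcongr

theorem memLp_dyad {β : Pt n → Pt n} (hβ : MemLp β ⊤ (volume.restrict Ω)) (u : VecL2 Ω) :
    MemLp (fun x => dyad (u x) (β x)) 2 (volume.restrict Ω) :=
  MemLp.of_le_mul (Lp.memLp u)
    (continuous_dyad.comp_aestronglyMeasurable₂ (Lp.aestronglyMeasurable u) hβ.1)
    (ae_norm_dyad_le hβ u)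

/-- The operator `u ↦ u ⊗ β`. -/
noncomputable def dyadL {β : Pt n → Pt n} (hβ : MemLp β ⊤ (volume.restrict Ω)) : VecL2 Ω →L[ℂ] TenL2 Ω :=
  LinearMap.mkContinuous
    { toFun := fun u => (memLp_dyad hβ u).toLp _
      map_add' := fun u v => by
        refine Lp.ext ?_
        filter_upwards [(memLp_dyad hβ u).coeFn_toLp, (memLp_dyad hβ v).coeFn_toLp,
          (memLp_dyad hβ (u + v)).coeFn_toLp, Lp.coeFn_add u v,
          Lp.coeFn_add ((memLp_dyad hβ u).toLp _) ((memLp_dyad hβ v).toLp _)] with x h1 h2 h3 h4 h5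
        rw [h3, h5, Pi.add_apply, h1, h2, h4]
        ext p
        simp [dyad, add_mul]
      map_smul' := fun c u => by
        refine Lp.ext ?_
        filter_upwards [(memLp_dyad hβ u).coeFn_toLp,
          (memLp_dyad hβ (c • u)).coeFn_toLp, Lp.coeFn_smul c u,
          Lp.coeFn_smul c ((memLp_dyad hβ u).toLp _)] with x h1 h3 h4 h5
        rw [h3, RingHom.id_apply, h5, Pi.smul_apply, h1, h4]
        ext p
        simp [dyad, mul_assoc] }
    (supNorm Ω β) fun u => by
      refine Lp.norm_le_mul_norm_of_ae_le_mul ?_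
      filter_upwards [(memLp_dyad hβ u).coeFn_toLp, ae_norm_dyad_le hβ u] with x h1 h2
      change ‖((memLp_dyad hβ u).toLp _ : TenL2 Ω) x‖ ≤ _
      rw [h1]
      exact h2

theorem coeFn_dyadL {β : Pt n → Pt n} (hβ : MemLp β ⊤ (volume.restrict Ω)) (u : VecL2 Ω) :
    dyadL hβ u =ᵐ[volume.restrict Ω] fun x => dyad (u x) (β x) :=
  (memLp_dyad hβ u).coeFn_toLp

/-- The convective operator `u ↦ dev (u ⊗ β)`. -/
noncomputable def convL {β : Pt n → Pt n} (hβ : MemLp β ⊤ (volume.restrict Ω)) : VecL2 Ω →L[ℂ] TenL2 Ω :=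
  devL Ω ∘L dyadL hβ

theorem coeFn_convL {β : Pt n → Pt n} (hβ : MemLp β ⊤ (volume.restrict Ω)) (u : VecL2 Ω) :
    convL hβ u =ᵐ[volume.restrict Ω] fun x => dev (dyad (u x) (β x)) := by
  filter_upwards [coeFn_devL (dyadL hβ u), coeFn_dyadL hβ u] with x h1 h2
  rw [← h2, ← h1]
  rfl

theorem isPerturbation {β : Pt n → Pt n} (hn : n ≠ 0) (hβ : MemLp β ⊤ (volume.restrict Ω)) :
    SaddlePoint.IsPerturbation (devL Ω) (convL hβ) :=
  ⟨inner_devL, devL_devL hn, fun _ => devL_devL hn _⟩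

theorem norm_convL_le {β : Pt n → Pt n} (hn : n ≠ 0) (hβ : MemLp β ⊤ (volume.restrict Ω))
    (u : VecL2 Ω) : ‖convL hβ u‖ ≤ supNorm Ω β * ‖u‖ :=
  ((isPerturbation hn hβ).norm_le _).trans <|
    LinearMap.mkContinuous_norm_le' _ _ |> fun h => (dyadL hβ).le_of_opNorm_le (by
      refine h.trans ?_
      rw [max_eq_left]
      exact ENNReal.toReal_nonneg) u

/-! ### The forms as inner products -/

theorem l2_eq_inner (f v : VecL2 Ω) : l2 f v = inner ℂ v f := by
  rw [L2.inner_def, l2]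
  simp_rw [dot_eq_inner]

theorem formA_eq_inner (ν : ℝ) (ρ τ : TenL2 Ω) :
    formA ν ρ τ = (1 / ν : ℝ) * inner ℂ (devL Ω τ) (devL Ω ρ) := by
  rw [L2.inner_def, formA]
  congr 1
  refine integral_congr_ae ?_
  filter_upwards [coeFn_devL ρ, coeFn_devL τ] with x h1 h2
  rw [h1, h2, ddot_eq_inner]

theorem formB_eq_inner (τ : TenL2 Ω) (v : VecL2 Ω) : formB τ v = inner ℂ v (weakDiv τ) := by
  rw [L2.inner_def, formB]
  simp_rw [dot_eq_inner]

theorem formC_eq_inner {β : Pt n → Pt n} (hβ : MemLp β ⊤ (volume.restrict Ω)) (ν : ℝ)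
    (v : VecL2 Ω) (τ : TenL2 Ω) :
    formC ν β v τ = (1 / ν : ℝ) * inner ℂ τ (convL hβ v) := by
  rw [L2.inner_def, formC]
  congr 1
  refine integral_congr_ae ?_
  filter_upwards [coeFn_convL hβ v] with x h1
  rw [h1, ddot_eq_inner]

theorem integral_norm_dev_sq (τ : TenL2 Ω) : ∫ x in Ω, ‖dev (τ x)‖ ^ 2 = ‖devL Ω τ‖ ^ 2 := by
  have h : (inner ℂ (devL Ω τ) (devL Ω τ) : ℂ) = ((‖devL Ω τ‖ ^ 2 : ℝ) : ℂ) := by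
    rw [inner_self_eq_norm_sq_to_K]; simp
  rw [L2.inner_def] at h
  have h2 : ∫ x in Ω, (inner ℂ (devL Ω τ x) (devL Ω τ x) : ℂ) =
      ((∫ x in Ω, ‖dev (τ x)‖ ^ 2 : ℝ) : ℂ) := by
    rw [← integral_complex_ofReal]
    refine integral_congr_ae ?_
    filter_upwards [coeFn_devL τ] with x h1
    rw [h1, inner_self_eq_norm_sq_to_K]
    simp
  rw [h2] at h
  exact_mod_cast h

/-! ### The weak divergence -/

theorem IsTest.memLp {φ : Pt n → ℝ} (h : IsTest Ω φ) (μ : Measure (Pt n))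
    [IsFiniteMeasureOnCompacts μ] (p : ENNReal) : MemLp φ p μ :=
  h.smooth.continuous.memLp_of_hasCompactSupport h.compact

theorem contDiff_pderiv {φ : Pt n → ℝ} (h : ContDiff ℝ ∞ φ) (j : Fin n) :
    ContDiff ℝ ∞ (pderiv j φ) :=
  (h.fderiv_right (m := ∞) (by simp)).clm_apply contDiff_const

theorem IsTest.pderiv {φ : Pt n → ℝ} (h : IsTest Ω φ) (j : Fin n) : IsTest Ω (pderiv j φ) where
  smooth := contDiff_pderiv h.smooth j
  compact := h.compact.fderiv_apply (𝕜 := ℝ) _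
  support := (tsupport_fderiv_apply_subset ℝ _).trans h.support

/-- The field `φ eᵢ`. -/
noncomputable def vecField (φ : Pt n → ℝ) (i : Fin n) (x : Pt n) : Vec n := EuclideanSpace.single i (φ x : ℂ)

/-- The Jacobian of the field `φ eᵢ`. -/
noncomputable def gradField (φ : Pt n → ℝ) (i : Fin n) (x : Pt n) : Ten n :=
  ∑ j, EuclideanSpace.single (i, j) (pderiv j φ x : ℂ)

theorem memLp_single {ι : Type*} [Fintype ι] [DecidableEq ι] {f : Pt n → ℂ} {μ : Measure (Pt n)}
    {p : ENNReal} (hf : MemLp f p μ) (i : ι) :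
    MemLp (fun x => (EuclideanSpace.single i (f x) : EuclideanSpace ℂ ι)) p μ := by
  refine hf.of_le (?_) (Eventually.of_forall fun x => by simp)
  have : Continuous fun z : ℂ => (EuclideanSpace.single i z : EuclideanSpace ℂ ι) :=
    (PiLp.continuous_toLp 2 _).comp (continuous_single (A := fun _ : ι => ℂ) i)
  exact this.comp_aestronglyMeasurable hf.1

theorem IsTest.memLp_vecField {φ : Pt n → ℝ} (h : IsTest Ω φ) (i : Fin n) :
    MemLp (vecField φ i) 2 (volume.restrict Ω) :=
  memLp_single (h.memLp _ _).ofReal i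

theorem IsTest.memLp_gradField {φ : Pt n → ℝ} (h : IsTest Ω φ) (i : Fin n) :
    MemLp (gradField φ i) 2 (volume.restrict Ω) := by
  unfold gradField
  exact memLp_finsetSum _ fun j _ => memLp_single ((h.pderiv j).memLp _ _).ofReal _

theorem inner_toLp {E : Type*} [NormedAddCommGroup E] [InnerProductSpace ℂ E] {μ : Measure (Pt n)}
    {F : Pt n → E} (hF : MemLp F 2 μ) (g : Lp E 2 μ) :
    inner ℂ (hF.toLp F) g = ∫ x, (inner ℂ (F x) (g x) : ℂ) ∂μ := by
  rw [L2.inner_def]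
  refine integral_congr_ae ?_
  filter_upwards [hF.coeFn_toLp] with x hx
  rw [hx]

theorem inner_vecField {φ : Pt n → ℝ} (h : IsTest Ω φ) (i : Fin n) (g : VecL2 Ω) :
    inner ℂ ((h.memLp_vecField i).toLp) g = ∫ x in Ω, g x i * (φ x : ℂ) := by
  rw [inner_toLp]
  simp [vecField, EuclideanSpace.inner_single_left, mul_comm]

theorem inner_gradField {φ : Pt n → ℝ} (h : IsTest Ω φ) (i : Fin n) (τ : TenL2 Ω) :
    inner ℂ ((h.memLp_gradField i).toLp) τ = ∫ x in Ω, ∑ j, τ x (i, j) * (pderiv j φ x : ℂ) := by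
  rw [inner_toLp]
  refine integral_congr_ae (Eventually.of_forall fun x => ?_)
  simp only [gradField, sum_inner]
  simp [ EuclideanSpace.inner_single_left, mul_comm]

theorem isWeakDiv_iff {τ : TenL2 Ω} {g : VecL2 Ω} : IsWeakDiv Ω τ g ↔
    ∀ (φ : Pt n → ℝ) (h : IsTest Ω φ) (i : Fin n),
      inner ℂ ((h.memLp_gradField i).toLp) τ = -inner ℂ ((h.memLp_vecField i).toLp) g := by
  refine forall_congr' fun φ => forall_congr' fun h => forall_congr' fun i => ?_
  rw [inner_gradField h, inner_vecField h]

/-- The graph of the divergence. -/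
noncomputable def divGraph (Ω : Set (Pt n)) : Submodule ℂ (WithLp 2 (TenL2 Ω × VecL2 Ω)) where
  carrier := {p | IsWeakDiv Ω p.fst p.snd}
  add_mem' := fun {p q} hp hq => by
    have hp := isWeakDiv_iff.1 hp
    have hq := isWeakDiv_iff.1 hq
    refine isWeakDiv_iff.2 fun φ h i => ?_
    rw [WithLp.add_fst, WithLp.add_snd, inner_add_right, inner_add_right, hp φ h i, hq φ h i,
      neg_add]
  zero_mem' := isWeakDiv_iff.2 fun φ h i => by simp
  smul_mem' := fun c p hp => by
    have hp := isWeakDiv_iff.1 hp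
    refine isWeakDiv_iff.2 fun φ h i => ?_
    rw [WithLp.smul_fst, WithLp.smul_snd, inner_smul_right, inner_smul_right, hp φ h i, mul_neg]

theorem mem_divGraph {p : WithLp 2 (TenL2 Ω × VecL2 Ω)} :
    p ∈ divGraph Ω ↔ IsWeakDiv Ω p.fst p.snd := Iff.rfl

theorem isClosed_divGraph : IsClosed (divGraph Ω : Set (WithLp 2 (TenL2 Ω × VecL2 Ω))) := by
  have h1 : Continuous fun y : WithLp 2 (TenL2 Ω × VecL2 Ω) => y.fst :=
    (WithLp.fstL 2 ℂ _ _).continuous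
  have h2 : Continuous fun y : WithLp 2 (TenL2 Ω × VecL2 Ω) => y.snd :=
    (WithLp.sndL 2 ℂ _ _).continuous
  have e : (divGraph Ω : Set (WithLp 2 (TenL2 Ω × VecL2 Ω))) =
      ⋂ (φ : Pt n → ℝ) (h : IsTest Ω φ) (i : Fin n), {p | (inner ℂ ((h.memLp_gradField i).toLp)
        p.fst : ℂ) = -inner ℂ ((h.memLp_vecField i).toLp) p.snd} := by
    ext p
    simp only [SetLike.mem_coe, mem_divGraph, isWeakDiv_iff, Set.mem_iInter]
    rfl
  rw [e]
  refine isClosed_iInter fun φ => isClosed_iInter fun h => isClosed_iInter fun i => ?_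
  exact isClosed_eq (by fun_prop) (by fun_prop)

/-- The point of the graph of the divergence over `τ`. -/
noncomputable def graphPt (τ : TenL2 Ω) : WithLp 2 (TenL2 Ω × VecL2 Ω) :=
  WithLp.toLp 2 (τ, weakDiv τ)

theorem graphPt_fst (τ : TenL2 Ω) : (graphPt τ).fst = τ := rfl

theorem graphPt_snd (τ : TenL2 Ω) : (graphPt τ).snd = weakDiv τ := rfl

theorem divNorm_eq (τ : TenL2 Ω) : divNorm τ = ‖graphPt τ‖ := by
  rw [divNorm, ← Real.sqrt_sq (norm_nonneg (graphPt τ)),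
    WithLp.prod_norm_sq_eq_of_L2, graphPt_fst, graphPt_snd]

section Bounded

variable [IsFiniteMeasure (volume.restrict Ω)]

/-- The identity as a constant field. -/
noncomputable def idL (Ω : Set (Pt n)) [IsFiniteMeasure (volume.restrict Ω)] : TenL2 Ω :=
  (memLp_const (idTen n)).toLp

theorem integral_tr (τ : TenL2 Ω) : ∫ x in Ω, tr (τ x) = inner ℂ (idL Ω) τ := by
  rw [idL, inner_toLp]
  simp_rw [tr_eq_inner]

/-- The graph of the divergence on fields of vanishing mean trace. -/
noncomputable def divGraph0 (Ω : Set (Pt n)) [IsFiniteMeasure (volume.restrict Ω)] :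
    Submodule ℂ (WithLp 2 (TenL2 Ω × VecL2 Ω)) :=
  divGraph Ω ⊓ LinearMap.ker ((innerSL ℂ (idL Ω) ∘L WithLp.fstL 2 ℂ (TenL2 Ω) (VecL2 Ω) :
    WithLp 2 (TenL2 Ω × VecL2 Ω) →L[ℂ] ℂ) : WithLp 2 (TenL2 Ω × VecL2 Ω) →ₗ[ℂ] ℂ)

theorem mem_divGraph0 {p : WithLp 2 (TenL2 Ω × VecL2 Ω)} :
    p ∈ divGraph0 Ω ↔ IsWeakDiv Ω p.fst p.snd ∧ inner ℂ (idL Ω) p.fst = 0 := Iff.rfl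

theorem isClosed_divGraph0 : IsClosed (divGraph0 Ω : Set (WithLp 2 (TenL2 Ω × VecL2 Ω))) :=
  isClosed_divGraph.inter (ContinuousLinearMap.isClosed_ker _)

theorem exists_of_mem_divGraph0 (hΩ : IsOpen Ω) {p : WithLp 2 (TenL2 Ω × VecL2 Ω)}
    (hp : p ∈ divGraph0 Ω) : p.fst ∈ HDiv0 Ω ∧ weakDiv p.fst = p.snd :=
  have h := mem_divGraph0.1 hp
  ⟨⟨⟨_, h.1⟩, (integral_tr _).trans h.2⟩, weakDiv_eq hΩ h.1⟩

theorem mem_divGraph0_of_mem {τ : TenL2 Ω} (hτ : τ ∈ HDiv0 Ω) :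
    graphPt τ ∈ divGraph0 Ω :=
  mem_divGraph0.2
    ⟨Classical.epsilon_spec (p := IsWeakDiv Ω τ) hτ.1, (integral_tr _).symm.trans hτ.2⟩

theorem infSup_of_le {γ : ℝ}
    (h : ∀ q : VecL2 Ω, γ * ‖q‖ ≤ ⨆ τ : HDiv0 Ω, ‖formB τ.1 q‖ / divNorm τ.1) :
    SaddlePoint.InfSup (divGraph0 Ω) γ := by
  intro q M hM hle
  refine (h q).trans (Real.iSup_le (fun τ => ?_) hM)
  -- A zero denominator is admitted, so `τ = 0`, where the quotient is `0 / 0 = 0`, needs no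
  -- separate case.
  refine div_le_of_le_mul₀ (Real.sqrt_nonneg _) hM ?_
  rw [formB_eq_inner, divNorm_eq, ← graphPt_snd]
  exact hle _ (mem_divGraph0_of_mem τ.2)

/-- The smallness of the data provides the constants for the abstract theory. -/
theorem exists_constants (hΩ : IsOpen Ω) {ν : ℝ} (hν : 0 < ν) {β : Pt n → Pt n}
    (hsmall : supNorm Ω β < infSupConst Ω * min ν (coercivityConst Ω)) :
    ∃ γ c : ℝ, 0 < γ ∧ 0 < c ∧ supNorm Ω β < γ * ν ∧ SaddlePoint.InfSup (divGraph0 Ω) γ ∧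
      ∀ p ∈ divGraph0 Ω, c * ‖p‖ ^ 2 ≤ ‖devL Ω p.fst‖ ^ 2 + ‖p.snd‖ ^ 2 := by
  have hb : 0 ≤ supNorm Ω β := ENNReal.toReal_nonneg
  have hpos := hb.trans_lt hsmall
  have hzero : ∀ q : VecL2 Ω, (0 : ℝ) * ‖q‖ ≤ ⨆ τ : HDiv0 Ω, ‖formB τ.1 q‖ / divNorm τ.1 :=
    fun q => by
      rw [zero_mul]
      exact Real.iSup_nonneg fun τ => div_nonneg (norm_nonneg _) (Real.sqrt_nonneg _)
  have hγ0 : 0 ≤ infSupConst Ω := Real.sSup_nonneg' ⟨0, hzero, le_rfl⟩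
  have hmin : 0 < min ν (coercivityConst Ω) := pos_of_mul_pos_right hpos hγ0
  have hγν : supNorm Ω β / ν < infSupConst Ω := by
    rw [div_lt_iff₀ hν]
    exact hsmall.trans_le (mul_le_mul_of_nonneg_left (min_le_left _ _) hγ0)
  -- The best constants need not be known to be attained: an admissible `γ` with `γ ν` still above
  -- the norm of `β`, and any admissible `c > 0`, suffice.
  obtain ⟨γ, hγ, hγlt⟩ := exists_lt_of_lt_csSup (s := {γ : ℝ | ∀ q : VecL2 Ω,
    γ * ‖q‖ ≤ ⨆ τ : HDiv0 Ω, ‖formB τ.1 q‖ / divNorm τ.1}) ⟨0, hzero⟩ hγν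
  have hc1 : 0 < coercivityConst Ω := hmin.trans_le (min_le_right _ _)
  obtain ⟨c, hc, hc0⟩ := exists_lt_of_lt_csSup ⟨0, fun τ _ => by
    rw [zero_mul, integral_norm_dev_sq]; positivity⟩ hc1
  refine ⟨γ, c, (div_nonneg hb hν.le).trans_lt hγlt, hc0, (div_lt_iff₀ hν).1 hγlt,
    infSup_of_le hγ, fun p hp => ?_⟩
  obtain ⟨h1, h2⟩ := exists_of_mem_divGraph0 hΩ hp
  have := hc p.fst h1
  rw [integral_norm_dev_sq, divNorm_eq, h2] at this
  have e : graphPt p.fst = p := congrArg (fun v => WithLp.toLp 2 (p.fst, v)) h2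
  rwa [e] at this

/-- The first equation is multiplied by `ν`, and test tensors `τ` are encoded as points `(τ, div τ)`
of the graph of the divergence. -/
theorem isSource_iff (hΩ : IsOpen Ω) {ν : ℝ} (hν : 0 < ν) {β : Pt n → Pt n}
    (hβ : MemLp β ⊤ (volume.restrict Ω)) {f : VecL2 Ω} {σ : TenL2 Ω} {u : VecL2 Ω} :
    IsSource Ω ν β f σ u ↔ SaddlePoint.IsSol (divGraph0 Ω) (devL Ω) ν (convL hβ) f
      (graphPt σ) u := by
  have hν' : (ν : ℂ) ≠ 0 := by exact_mod_cast hν.ne'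
  have key : ∀ τ : TenL2 Ω, formA ν σ τ + conj (formB τ u) + formC ν β u τ = 0 ↔
      inner ℂ (devL Ω τ) (devL Ω σ) + inner ℂ τ (convL hβ u) + ν * inner ℂ (weakDiv τ) u = 0 := by
    intro τ
    rw [formA_eq_inner, formB_eq_inner, formC_eq_inner hβ, inner_conj_symm, Complex.ofReal_div,
      Complex.ofReal_one]
    constructor
    · intro h
      field_simp at h
      linear_combination h
    · intro h
      field_simp
      linear_combination h
  constructor
  · intro h
    refine ⟨mem_divGraph0_of_mem h.mem, fun q hq => ?_, ?_⟩
    · obtain ⟨h1, h2⟩ := exists_of_mem_divGraph0 hΩ hq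
      have h3 := (key q.fst).1 (h.eq₁ q.fst h1)
      rwa [h2] at h3
    · refine ext_inner_left ℂ fun v => ?_
      rw [inner_neg_right, ← l2_eq_inner f, ← h.eq₂, formB_eq_inner, graphPt_snd]
  · intro h
    refine ⟨(exists_of_mem_divGraph0 hΩ h.mem).1, fun τ hτ => ?_, fun v => ?_⟩
    · have h1 := h.eq₁ _ (mem_divGraph0_of_mem hτ)
      simp only [graphPt_fst, graphPt_snd] at h1
      exact (key τ).2 h1
    · have h2 : weakDiv σ = -f :=
        (graphPt_snd σ).symm.trans h.eq₂
      rw [formB_eq_inner, l2_eq_inner, h2, inner_neg_right]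

/-- Conjugating the first equation restores the order of the arguments in the primal problem; the
only trace left of the adjoint is the sign of the convection. -/
theorem isAdjointSource_iff (hΩ : IsOpen Ω) {ν : ℝ} (hν : 0 < ν) {β : Pt n → Pt n}
    (hβ : MemLp β ⊤ (volume.restrict Ω)) {f : VecL2 Ω} {σ : TenL2 Ω} {u : VecL2 Ω} :
    IsAdjointSource Ω ν β f σ u ↔ SaddlePoint.IsSol (divGraph0 Ω) (devL Ω) ν (-convL hβ) f
      (graphPt σ) u := by
  have hν' : (ν : ℂ) ≠ 0 := by exact_mod_cast hν.ne'
  have key : ∀ τ : TenL2 Ω, formA ν τ σ + formB τ u - conj (formC ν β u τ) = 0 ↔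
      inner ℂ (devL Ω τ) (devL Ω σ) + inner ℂ τ ((-convL hβ) u) + ν * inner ℂ (weakDiv τ) u = 0 := by
    intro τ
    rw [← map_eq_zero (starRingEnd ℂ), formA_eq_inner, formB_eq_inner, formC_eq_inner hβ, map_sub,
      map_add, map_mul, inner_conj_symm, inner_conj_symm, Complex.conj_conj, Complex.conj_ofReal,
      Complex.ofReal_div, Complex.ofReal_one, neg_apply, inner_neg_right]
    constructor
    · intro h
      field_simp at h
      linear_combination h
    · intro h
      field_simp
      linear_combination h
  constructor
  · intro h
    refine ⟨mem_divGraph0_of_mem h.mem, fun q hq => ?_, ?_⟩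
    · obtain ⟨h1, h2⟩ := exists_of_mem_divGraph0 hΩ hq
      have h3 := (key q.fst).1 (h.eq₁ q.fst h1)
      rwa [h2] at h3
    · refine ext_inner_left ℂ fun v => ?_
      have := congrArg conj (h.eq₂ v)
      rw [Complex.conj_conj, l2_eq_inner, map_neg, inner_conj_symm, formB_eq_inner] at this
      rw [inner_neg_right, ← this, graphPt_snd]
  · intro h
    refine ⟨(exists_of_mem_divGraph0 hΩ h.mem).1, fun τ hτ => ?_, fun v => ?_⟩
    · have h1 := h.eq₁ _ (mem_divGraph0_of_mem hτ)
      simp only [graphPt_fst, graphPt_snd] at h1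
      exact (key τ).2 h1
    · have h2 : weakDiv σ = -f :=
        (graphPt_snd σ).symm.trans h.eq₂
      rw [formB_eq_inner, l2_eq_inner, h2, inner_conj_symm, inner_neg_left]

end Bounded

end Oseen

/-! ### Skew-symmetry of the convection and adjointness of the solution operators. -/

namespace Oseen

variable {n : ℕ} {Ω : Set (Pt n)}

/-! ### Integration by parts against test functions -/

theorem IsTest.eq_zero {φ : Pt n → ℝ} (h : IsTest Ω φ) {x : Pt n} (hx : x ∉ Ω) : φ x = 0 :=
  image_eq_zero_of_notMem_tsupport fun hx' => hx (h.support hx')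

/-- The test function and its derivatives vanish off `Ω`, so both integrals extend to the whole
space and no boundary term appears. -/
theorem setIntegral_mul_pderiv {φ : Pt n → ℝ} (h : IsTest Ω φ) {f : Pt n → ℂ}
    (hf : ContDiff ℝ 1 f) (j : Fin n) :
    ∫ x in Ω, f x * (pderiv j φ x : ℂ) =
      -∫ x in Ω, fderiv ℝ f x (EuclideanSpace.single j 1) * (φ x : ℂ) := by
  have hj := h.pderiv j
  rw [setIntegral_eq_integral_of_forall_compl_eq_zero fun x hx => by simp [hj.eq_zero hx],
    setIntegral_eq_integral_of_forall_compl_eq_zero fun x hx => by simp [h.eq_zero hx]]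
  have hfc := hf.continuous
  have hfc' : Continuous fun x => fderiv ℝ f x (EuclideanSpace.single j 1) :=
    (hf.continuous_fderiv one_ne_zero).clm_apply continuous_const
  have key := integral_smul_fderiv_eq_neg_fderiv_smul_of_integrable (μ := (volume : Measure (Pt n)))
    (f := φ) (g := f) (v := EuclideanSpace.single j 1)
    ((hj.smooth.continuous.smul hfc).integrable_of_hasCompactSupport hj.compact.smul_right)
    ((h.smooth.continuous.smul hfc').integrable_of_hasCompactSupport h.compact.smul_right)
    ((h.smooth.continuous.smul hfc).integrable_of_hasCompactSupport h.compact.smul_right)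
    (fun x _ => (h.smooth.differentiable (by simp)).differentiableAt)
    (fun x _ => (hf.differentiable one_ne_zero).differentiableAt)
  simp only [Complex.real_smul] at key
  rw [← neg_eq_iff_eq_neg] at key
  simp only [mul_comm (f _), mul_comm (fderiv ℝ f _ _)]
  exact key.symm

/-- The classical divergence of a smooth tensor field is its weak divergence. -/
theorem isWeakDiv_of_contDiff {F : Pt n → Ten n} {g : Pt n → Vec n}
    (hF : ∀ p, ContDiff ℝ 1 fun x => F x p)
    (hg : ∀ x i, g x i = ∑ j, fderiv ℝ (fun y => F y (i, j)) x (EuclideanSpace.single j 1))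
    (hF2 : MemLp F 2 (volume.restrict Ω)) (hg2 : MemLp g 2 (volume.restrict Ω)) :
    IsWeakDiv Ω (hF2.toLp F) (hg2.toLp g) := by
  intro φ h i
  have e1 : ∫ x in Ω, ∑ j, (hF2.toLp F : TenL2 Ω) x (i, j) * (pderiv j φ x : ℂ) =
      ∫ x in Ω, ∑ j, F x (i, j) * (pderiv j φ x : ℂ) := by
    refine integral_congr_ae ?_
    filter_upwards [hF2.coeFn_toLp] with x hx
    rw [hx]
  have e2 : ∫ x in Ω, (hg2.toLp g : VecL2 Ω) x i * (φ x : ℂ) =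
      ∫ x in Ω, ∑ j, fderiv ℝ (fun y => F y (i, j)) x (EuclideanSpace.single j 1) * (φ x : ℂ) := by
    refine integral_congr_ae ?_
    filter_upwards [hg2.coeFn_toLp] with x hx
    rw [hx, hg, Finset.sum_mul]
  rw [e1, e2, integral_finsetSum, integral_finsetSum, ← Finset.sum_neg_distrib]
  · exact Finset.sum_congr rfl fun j _ => setIntegral_mul_pderiv h (hF (i, j)) j
  · intro j _
    exact ((((hF (i, j)).continuous_fderiv one_ne_zero).clm_apply continuous_const).mul
      (Complex.continuous_ofReal.comp h.smooth.continuous)).integrable_of_hasCompactSupport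
        (h.compact.comp_left Complex.ofReal_zero).mul_left |>.integrableOn
  · intro j _
    exact ((hF (i, j)).continuous.mul
      (Complex.continuous_ofReal.comp (h.pderiv j).smooth.continuous)).integrable_of_hasCompactSupport
        ((h.pderiv j).compact.comp_left Complex.ofReal_zero).mul_left |>.integrableOn

theorem pderiv_mul {φ ψ : Pt n → ℝ} (hφ : ContDiff ℝ ∞ φ) (hψ : ContDiff ℝ ∞ ψ) (j : Fin n)
    (x : Pt n) : pderiv j (fun x => φ x * ψ x) x = φ x * pderiv j ψ x + ψ x * pderiv j φ x := by
  unfold pderiv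
  rw [fderiv_fun_mul (hφ.differentiable (by simp)).differentiableAt
    (hψ.differentiable (by simp)).differentiableAt]
  simp

theorem IsTest.mul {φ ψ : Pt n → ℝ} (hφ : IsTest Ω φ) (hψ : ContDiff ℝ ∞ ψ) :
    IsTest Ω fun x => φ x * ψ x where
  smooth := hφ.smooth.mul hψ
  compact := hφ.compact.mul_right
  support := (tsupport_mul_subset_left).trans hφ.support

/-- Skew-symmetry of the convective derivative by a solenoidal field. -/
theorem IsSolenoidalLipschitz.skew {β : Pt n → Pt n} (hβ : IsSolenoidalLipschitz Ω β)
    {φ ψ : Pt n → ℝ} (hφ : IsTest Ω φ) (hψ : IsTest Ω ψ) :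
    ∫ x in Ω, φ x * ∑ j, β x j * pderiv j ψ x = -∫ x in Ω, ψ x * ∑ j, β x j * pderiv j φ x := by
  obtain ⟨hb, D, hD, hDβ, hdiv⟩ := hβ
  have hbj : ∀ j, MemLp (fun x => β x j) ⊤ (volume.restrict Ω) := fun j =>
    hb.continuousLinearMap_comp (EuclideanSpace.proj j : Pt n →L[ℝ] ℝ)
  have hint : ∀ {a b : Pt n → ℝ}, MemLp a ⊤ (volume.restrict Ω) → IsTest Ω b →
      Integrable (fun x => a x * b x) (volume.restrict Ω) := fun ha hb =>
    memLp_one_iff_integrable.1 ((hb.memLp _ 1).mul ha)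
  -- The weak divergence of `β`, tested with the product `φ ψ`; the product rule then splits the
  -- result into the two sides.
  have h0 : ∫ x in Ω, ∑ j, β x j * pderiv j (fun x => φ x * ψ x) x = 0 := by
    have hφψ := hφ.mul hψ.smooth
    rw [integral_finsetSum _ fun j _ => hint (hbj j) (hφψ.pderiv j)]
    simp_rw [fun j => hDβ j j _ hφψ]
    rw [Finset.sum_neg_distrib, ← integral_finsetSum _ fun j _ => hint (hD j j) hφψ, neg_eq_zero]
    refine integral_eq_zero_of_ae ?_
    filter_upwards [hdiv] with x hx
    rw [← Finset.sum_mul, hx, zero_mul]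
    rfl
  have hI : ∀ {φ ψ : Pt n → ℝ}, IsTest Ω φ → IsTest Ω ψ →
      Integrable (fun x => φ x * ∑ j, β x j * pderiv j ψ x) (volume.restrict Ω) := by
    intro φ ψ hφ hψ
    simp_rw [Finset.mul_sum]
    refine integrable_finsetSum _ fun j _ => ?_
    have := hint (hbj j) (hφ.mul (hψ.pderiv j).smooth)
    refine this.congr (Eventually.of_forall fun x => ?_)
    ring
  rw [eq_neg_iff_add_eq_zero, ← integral_add (hI hφ hψ) (hI hψ hφ), ← h0]
  refine integral_congr_ae (Eventually.of_forall fun x => ?_)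
  simp only [pderiv_mul hφ.smooth hψ.smooth, Finset.mul_sum, ← Finset.sum_add_distrib]
  exact Finset.sum_congr rfl fun j _ => by ring

/-- The rank-one field `φ eᵢ ⊗ β` has the divergence `(β · ∇φ) eᵢ`. -/
theorem isWeakDiv_dyad_vecField {β : Pt n → Pt n} (hβ : IsSolenoidalLipschitz Ω β)
    {φ : Pt n → ℝ} (hφ : IsTest Ω φ) (i : Fin n) :
    IsWeakDiv Ω (dyadL hβ.1 ((hφ.memLp_vecField i).toLp))
      (ContinuousLinearMap.adjoint (dyadL hβ.1) ((hφ.memLp_gradField i).toLp)) := by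
  -- Tested with the gradient of `ψ eₖ`, the dyad gives `∫ φ β · ∇ψ` if `k = i` and zero otherwise.
  -- The weak divergence identity is therefore the skew-symmetry in `φ` and `ψ`.
  have key : ∀ {φ ψ : Pt n → ℝ} (hφ : IsTest Ω φ) (hψ : IsTest Ω ψ) (i k : Fin n),
      inner ℂ ((hψ.memLp_gradField k).toLp) (dyadL hβ.1 ((hφ.memLp_vecField i).toLp)) =
        if k = i then ((∫ x in Ω, φ x * ∑ j, β x j * pderiv j ψ x : ℝ) : ℂ) else 0 := by
    intro φ ψ hφ hψ i k
    rw [inner_gradField hψ]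
    have e : ∫ x in Ω, ∑ j, dyadL hβ.1 ((hφ.memLp_vecField i).toLp) x (k, j) *
        (pderiv j ψ x : ℂ) = ∫ x in Ω, if k = i then
          ((φ x * ∑ j, β x j * pderiv j ψ x : ℝ) : ℂ) else 0 := by
      refine integral_congr_ae ?_
      filter_upwards [coeFn_dyadL hβ.1 ((hφ.memLp_vecField i).toLp),
        (hφ.memLp_vecField i).coeFn_toLp] with x h1 h2
      rw [h1, h2]
      by_cases hk : k = i
      · simp [dyad, vecField, hk, Finset.mul_sum, mul_assoc]
      · simp [dyad, vecField, hk]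
    rw [e]
    by_cases hk : k = i
    · simp only [hk, if_true]
      rw [integral_complex_ofReal]
    · simp [hk]
  refine isWeakDiv_iff.2 fun ψ hψ k => ?_
  rw [ContinuousLinearMap.adjoint_inner_right, key hφ hψ, ← inner_conj_symm, key hψ hφ]
  by_cases hk : k = i
  · rw [if_pos hk, if_pos hk.symm, Complex.conj_ofReal, hβ.skew hφ hψ, Complex.ofReal_neg]
  · rw [if_neg hk, if_neg fun h => hk h.symm]
    simp

section Bounded

variable [IsFiniteMeasure (volume.restrict Ω)]

theorem isWeakDiv_idL : IsWeakDiv Ω (idL Ω) 0 := by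
  have hg : MemLp (fun _ => 0 : Pt n → Vec n) 2 (volume.restrict Ω) := memLp_const 0
  have h := isWeakDiv_of_contDiff (Ω := Ω) (F := fun _ => idTen n) (g := fun _ => 0)
    (fun p => contDiff_const) (fun x i => by simp) (memLp_const _) hg
  have e : (hg.toLp (fun _ => 0 : Pt n → Vec n) : VecL2 Ω) = 0 := by
    refine Lp.ext ?_
    filter_upwards [hg.coeFn_toLp, Lp.coeFn_zero (Vec n) 2 (volume.restrict Ω)] with x h1 h2
    rw [h1, h2]
    rfl
  rwa [e] at h

theorem devL_idL (hn : n ≠ 0) : devL Ω (idL Ω) = 0 := by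
  refine Lp.ext ?_
  filter_upwards [coeFn_devL (idL Ω), (memLp_const (idTen n) (μ := volume.restrict Ω)
    (p := 2)).coeFn_toLp, Lp.coeFn_zero (Ten n) 2 (volume.restrict Ω)] with x h1 h2 h3
  have hn' : (n : ℂ) ≠ 0 := by exact_mod_cast hn
  have h4 : idL Ω x = idTen n := h2
  rw [h1, h3, h4, dev_eq, tr_idTen, div_self hn', one_smul, sub_self]
  rfl

theorem inner_idL_ne_zero (hn : n ≠ 0) (hne : volume Ω ≠ 0) :
    (inner ℂ (idL Ω) (idL Ω) : ℂ) ≠ 0 := by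
  rw [inner_self_ne_zero]
  intro h0
  have h1 : ∀ᵐ x ∂(volume.restrict Ω), False := by
    filter_upwards [(memLp_const (idTen n) (μ := volume.restrict Ω) (p := 2)).coeFn_toLp,
      Lp.coeFn_zero (Ten n) 2 (volume.restrict Ω)] with x hx h2
    have h3 : idL Ω x = idTen n := hx
    rw [h0, h2] at h3
    have h4 := congrArg (fun A => tr A) h3
    simp only [tr_idTen] at h4
    refine hn ?_
    have : (n : ℂ) = 0 := by rw [← h4]; simp [tr]
    exact_mod_cast this
  rw [eventually_false_iff_eq_bot, ae_eq_bot, Measure.restrict_eq_zero] at h1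
  exact hne h1

/-- Elements of the gradient space are gradients in the sense of duality with all of `H(div)`. -/
theorem gradSpace_inner_eq_zero (hn : n ≠ 0) (hne : volume Ω ≠ 0)
    {y : WithLp 2 (TenL2 Ω × VecL2 Ω)}
    (hy : y ∈ SaddlePoint.gradSpace (divGraph0 Ω) (devL Ω)) {τ : TenL2 Ω} {g : VecL2 Ω}
    (h : IsWeakDiv Ω τ g) : inner ℂ τ y.fst + inner ℂ g y.snd = 0 := by
  have hid := inner_idL_ne_zero hn hne
  have hy1 : devL Ω y.fst = y.fst := hy.1
  -- Subtracting the multiple `c` of the identity makes the mean trace vanish. The identity has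
  -- neither divergence nor deviatoric part, so the pairing is unaffected.
  set c : ℂ := inner ℂ (idL Ω) τ / inner ℂ (idL Ω) (idL Ω) with hc
  have hdiv : IsWeakDiv Ω (τ - c • idL Ω) g := isWeakDiv_iff.2 fun φ hφ i => by
    rw [inner_sub_right, inner_smul_right, isWeakDiv_iff.1 h φ hφ i,
      isWeakDiv_iff.1 isWeakDiv_idL φ hφ i, inner_zero_right, neg_zero, mul_zero, sub_zero]
  have htr : (inner ℂ (idL Ω) (τ - c • idL Ω) : ℂ) = 0 := by
    rw [inner_sub_right, inner_smul_right, hc, div_mul_cancel₀ _ hid, sub_self]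
  have h1 : inner ℂ (devL Ω (τ - c • idL Ω)) y.fst + inner ℂ g y.snd = 0 :=
    hy.2 (WithLp.toLp 2 (τ - c • idL Ω, g)) (mem_divGraph0.2 ⟨hdiv, htr⟩)
  rw [map_sub, map_smul, devL_idL hn, smul_zero, sub_zero, inner_devL, hy1] at h1
  exact h1

/-- The dyadic product of a weakly differentiable field with `β` is in `H(div)`. -/
theorem isWeakDiv_dyadL (hn : n ≠ 0) (hne : volume Ω ≠ 0) {β : Pt n → Pt n}
    (hβ : IsSolenoidalLipschitz Ω β) {y : WithLp 2 (TenL2 Ω × VecL2 Ω)}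
    (hy : y ∈ SaddlePoint.gradSpace (divGraph0 Ω) (devL Ω)) :
    IsWeakDiv Ω (dyadL hβ.1 y.snd) (ContinuousLinearMap.adjoint (dyadL hβ.1) y.fst) := by
  refine isWeakDiv_iff.2 fun φ hφ i => ?_
  have h := gradSpace_inner_eq_zero hn hne hy (isWeakDiv_dyad_vecField hβ hφ i)
  rw [ContinuousLinearMap.adjoint_inner_left] at h
  rw [ContinuousLinearMap.adjoint_inner_right]
  linear_combination h

/-- Skew-symmetry of the convective term. -/
theorem convL_skew (hn : n ≠ 0) (hne : volume Ω ≠ 0) {β : Pt n → Pt n}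
    (hβ : IsSolenoidalLipschitz Ω β) {y z : WithLp 2 (TenL2 Ω × VecL2 Ω)}
    (hy : y ∈ SaddlePoint.gradSpace (divGraph0 Ω) (devL Ω))
    (hz : z ∈ SaddlePoint.gradSpace (divGraph0 Ω) (devL Ω)) :
    inner ℂ (convL hβ.1 z.snd) y.fst + inner ℂ z.fst (convL hβ.1 y.snd) = 0 := by
  -- The dyad of one field with `β` lies in `H(div)`, so it can be tested against the gradient pair
  -- of the other.
  have h := gradSpace_inner_eq_zero hn hne hy (isWeakDiv_dyadL hn hne hβ hz)
  rw [ContinuousLinearMap.adjoint_inner_left] at h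
  have e1 : inner ℂ (convL hβ.1 z.snd) y.fst = inner ℂ (dyadL hβ.1 z.snd) y.fst := by
    rw [convL, ContinuousLinearMap.comp_apply, inner_devL, hy.1]
  have e2 : inner ℂ z.fst (convL hβ.1 y.snd) = inner ℂ z.fst (dyadL hβ.1 y.snd) := by
    rw [convL, ContinuousLinearMap.comp_apply, ← inner_devL, hz.1]
  rw [e1, e2]
  exact h

/-- The two solution operators are adjoint to each other. -/
theorem inner_solution (hn : n ≠ 0) (hne : volume Ω ≠ 0) {ν : ℝ} (hν : 0 < ν) {β : Pt n → Pt n}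
    (hβ : IsSolenoidalLipschitz Ω β) {f g u v : VecL2 Ω} {p q : WithLp 2 (TenL2 Ω × VecL2 Ω)}
    (hu : SaddlePoint.IsSol (divGraph0 Ω) (devL Ω) ν (convL hβ.1) f p u)
    (hv : SaddlePoint.IsSol (divGraph0 Ω) (devL Ω) ν (-convL hβ.1) g q v) :
    inner ℂ v f = inner ℂ g u := by
  have hν' : (ν : ℂ) ≠ 0 := by exact_mod_cast hν.ne'
  have hP := isPerturbation hn hβ.1
  have hP' : SaddlePoint.IsPerturbation (devL Ω) (-convL hβ.1) :=
    ⟨hP.symm, hP.idem, fun u => by rw [neg_apply, map_neg, hP.range]⟩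
  obtain ⟨y, hy, hy1, hy2⟩ : ∃ y ∈ SaddlePoint.gradSpace (divGraph0 Ω) (devL Ω),
      y.fst = (ν : ℂ)⁻¹ • (devL Ω p.fst + convL hβ.1 u) ∧ y.snd = u :=
    ⟨_, hu.grad_mem hP hν, rfl, rfl⟩
  obtain ⟨z, hz, hz1, hz2⟩ : ∃ z ∈ SaddlePoint.gradSpace (divGraph0 Ω) (devL Ω),
      z.fst = (ν : ℂ)⁻¹ • (devL Ω q.fst + (-convL hβ.1) v) ∧ z.snd = v :=
    ⟨_, hv.grad_mem hP' hν, rfl, rfl⟩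
  have hpa : devL Ω p.fst = (ν : ℂ) • y.fst - convL hβ.1 u := by
    rw [hy1, smul_smul, mul_inv_cancel₀ hν', one_smul, add_sub_cancel_right]
  have hqb : devL Ω q.fst = (ν : ℂ) • z.fst + convL hβ.1 v := by
    rw [hz1, smul_smul, mul_inv_cancel₀ hν', one_smul, neg_apply, neg_add_cancel_right]
  -- Each problem is tested with the gradient pair of the other. The diffusive terms coincide up to
  -- conjugation, and the convective ones cancel by `h3`.
  have h1 := hu.weak hz
  have h2 := hv.weak hy
  have h3 := convL_skew hn hne hβ hy hz
  rw [hy2, hz2] at h3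
  rw [hpa, inner_sub_right, inner_smul_right, hz2] at h1
  rw [hqb, inner_add_right, inner_smul_right, hy2] at h2
  have h4 := congrArg conj h2
  rw [map_add, map_mul, inner_conj_symm, inner_conj_symm, inner_conj_symm,
    Complex.conj_ofReal] at h4
  linear_combination h4 - h1 - h3

end Bounded

end Oseen

namespace CompactOp

/-! ### Operators smoothing with respect to a Parseval frame -/

variable {H : Type*} [NormedAddCommGroup H] [InnerProductSpace ℂ H] {ι : Type*} {b : ι → H}

theorem norm_inner_self_complex (x : H) : ‖(inner ℂ x x : ℂ)‖ = ‖x‖ ^ 2 := by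
  rw [inner_self_eq_norm_sq_to_K]
  simp

/-- Parseval for `b i` itself contains the term `‖b i‖ ^ 4`, which is thus at most `‖b i‖ ^ 2`. -/
theorem frame_norm_le_one (hb : ∀ f, HasSum (fun i => ‖(inner ℂ (b i) f : ℂ)‖ ^ 2) (‖f‖ ^ 2))
    (i : ι) : ‖b i‖ ≤ 1 := by
  have h := sum_le_hasSum {i} (fun j _ => sq_nonneg _) (hb (b i))
  rw [Finset.sum_singleton, norm_inner_self_complex] at h
  by_contra hlt
  push Not at hlt
  have h1 : 1 < ‖b i‖ ^ 2 := by nlinarith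
  have : ‖b i‖ ^ 2 < (‖b i‖ ^ 2) ^ 2 := by nlinarith
  linarith

/-- The polarized Parseval identity. -/
theorem frame_hasSum_inner (hb : ∀ f, HasSum (fun i => ‖(inner ℂ (b i) f : ℂ)‖ ^ 2) (‖f‖ ^ 2))
    (x y : H) :
    HasSum (fun i => (inner ℂ (inner ℂ (b i) x : ℂ) (inner ℂ (b i) y : ℂ) : ℂ)) (inner ℂ x y) := by
  have hc : ∀ f, HasSum (fun i => ((‖(inner ℂ (b i) f : ℂ)‖ : ℂ)) ^ 2) ((‖f‖ : ℂ) ^ 2) := fun f => by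
    have := Complex.hasSum_ofReal.2 (hb f)
    simpa using this
  rw [inner_eq_sum_norm_sq_div_four]
  have h := ((((hc (x + y)).sub (hc (x - y))).add
    (((hc (x - Complex.I • y)).sub (hc (x + Complex.I • y))).mul_right Complex.I)).div_const 4)
  have e : (fun i => (inner ℂ (inner ℂ (b i) x : ℂ) (inner ℂ (b i) y : ℂ) : ℂ)) = _ :=
    funext fun i => by
      rw [inner_eq_sum_norm_sq_div_four, ← inner_add_right, ← inner_sub_right, smul_eq_mul,
        ← inner_smul_right, ← inner_sub_right, ← inner_add_right]
  rw [e]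
  exact h

variable [CompleteSpace H] {T : H →L[ℂ] H} {w : ι → ℝ} {C : ℝ}

/-- An operator smoothing with respect to a frame is compact. -/
theorem isCompactOperator_of_frame
    (hb : ∀ f, HasSum (fun i => ‖(inner ℂ (b i) f : ℂ)‖ ^ 2) (‖f‖ ^ 2)) (hC : 0 ≤ C)
    (hT : ∀ (f : H) (S : Finset ι), ∑ i ∈ S, w i ^ 2 * ‖(inner ℂ (b i) (T f) : ℂ)‖ ^ 2 ≤
      C ^ 2 * ‖f‖ ^ 2)
    (hfin : ∀ R : ℝ, {i | w i ≤ R}.Finite) : IsCompactOperator T := by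
  have happ : ∀ ε > 0, ∃ A : H →L[ℂ] H, IsCompactOperator A ∧ ‖T - A‖ ≤ ε := by
    intro ε hε
    -- Coefficients of weight above `R` contribute at most `(C / R) ‖g‖ ≤ ε ‖g‖`; the `+ 1` keeps
    -- `R` positive when `C = 0`. The finitely many others vanish on the complement of `V`.
    let R := (C + 1) / ε
    have hR : 0 < R := by positivity
    let S := (hfin R).toFinset
    let V : Submodule ℂ H := Submodule.span ℂ
      ((fun i => ContinuousLinearMap.adjoint T (b i)) '' S)
    have : FiniteDimensional ℂ V := FiniteDimensional.span_of_finite ℂ (S.finite_toSet.image _)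
    refine ⟨T ∘L V.starProjection, (isCompactOperator_starProjection V).clm_comp T,
      ContinuousLinearMap.opNorm_le_bound _ hε.le fun f => ?_⟩
    set g := f - V.starProjection f with hg
    have hgV : g ∈ Vᗮ := V.sub_starProjection_mem_orthogonal f
    have hgn : ‖g‖ ≤ ‖f‖ := by
      have h1 := V.norm_sq_eq_add_norm_sq_starProjection f
      have h2 : ‖g‖ = ‖Vᗮ.starProjection f‖ := by
        rw [hg, Submodule.starProjection_orthogonal_val]
      have h3 : ‖g‖ ^ 2 ≤ ‖f‖ ^ 2 := by rw [h1, h2]; linarith [sq_nonneg ‖V.starProjection f‖]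
      exact le_of_sq_le_sq h3 (norm_nonneg _)
    have hTg : (T - T ∘L V.starProjection) f = T g := by simp [hg]
    rw [hTg]
    have hzero : ∀ i, w i ≤ R → (inner ℂ (b i) (T g) : ℂ) = 0 := fun i hi => by
      rw [← ContinuousLinearMap.adjoint_inner_left]
      refine hgV _ (Submodule.subset_span ?_)
      exact ⟨i, by simpa [S] using hi, rfl⟩
    have hle : ‖T g‖ ^ 2 ≤ (R ^ 2)⁻¹ * (C ^ 2 * ‖g‖ ^ 2) := by
      refine hasSum_le_of_sum_le (hb (T g)) fun s => ?_
      refine le_trans ?_ (mul_le_mul_of_nonneg_left (hT g s) (by positivity))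
      rw [Finset.mul_sum]
      refine Finset.sum_le_sum fun i _ => ?_
      by_cases hi : w i ≤ R
      · simp [hzero i hi]
      · push Not at hi
        rw [← mul_assoc]
        refine le_mul_of_one_le_left (sq_nonneg _) ?_
        rw [inv_mul_eq_div, one_le_div (by positivity)]
        gcongr
    refine le_of_sq_le_sq (hle.trans ?_) (by positivity)
    have h1 : (R ^ 2)⁻¹ * C ^ 2 ≤ ε ^ 2 := by
      rw [inv_mul_le_iff₀ (by positivity), ← mul_pow]
      have : R * ε = C + 1 := div_mul_cancel₀ _ hε.ne'
      rw [this]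
      gcongr
      linarith
    calc (R ^ 2)⁻¹ * (C ^ 2 * ‖g‖ ^ 2) = ((R ^ 2)⁻¹ * C ^ 2) * ‖g‖ ^ 2 := by ring
      _ ≤ ε ^ 2 * ‖f‖ ^ 2 := by gcongr
      _ = (ε * ‖f‖) ^ 2 := by ring
  have hcl : IsClosed {A : H →L[ℂ] H | IsCompactOperator A} := isClosed_setOfPred_isCompactOperator
  refine hcl.closure_subset (Metric.mem_closure_iff.2 fun ε hε => ?_)
  obtain ⟨A, hA, hle⟩ := happ (ε / 2) (by positivity)
  exact ⟨A, hA, by rw [dist_eq_norm]; linarith⟩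

/-- If the weights of a smoothing operator are summable to the power `-4`, then the square of the
operator is Hilbert-Schmidt. -/
theorem hilbertSchmidt_sq_of_frame
    (hb : ∀ f, HasSum (fun i => ‖(inner ℂ (b i) f : ℂ)‖ ^ 2) (‖f‖ ^ 2)) (hw : ∀ i, 1 ≤ w i)
    (hT : ∀ (f : H) (S : Finset ι), ∑ i ∈ S, w i ^ 2 * ‖(inner ℂ (b i) (T f) : ℂ)‖ ^ 2 ≤
      C ^ 2 * ‖f‖ ^ 2)
    (hsum : Summable fun i => (w i ^ 4)⁻¹) (d : ℕ) (e : Fin d → H) (he : Orthonormal ℂ e) :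
    ∑ a, ‖T (T (e a))‖ ^ 2 ≤ (C ^ 2 * √(∑' i, (w i ^ 4)⁻¹)) ^ 2 := by
  have hw0 : ∀ i, 0 < w i := fun i => one_pos.trans_le (hw i)
  set Z := ∑' i, (w i ^ 4)⁻¹ with hZ
  have hZ0 : 0 ≤ Z := tsum_nonneg fun i => by have := hw0 i; positivity
  set h : ι → H := fun i => ContinuousLinearMap.adjoint T (b i) with hh
  have hin : ∀ i f, (inner ℂ (b i) (T f) : ℂ) = inner ℂ (h i) f := fun i f =>
    (ContinuousLinearMap.adjoint_inner_left _ _ _).symm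
  -- Duality: as `T` gains one power of the weight, `T*` is bounded from the norm with weights `w⁻²`
  -- to `H`.
  have hadj : ∀ (x : H) (M : ℝ), 0 ≤ M →
      (∀ K : Finset ι, ∑ k ∈ K, (w k ^ 2)⁻¹ * ‖(inner ℂ (b k) x : ℂ)‖ ^ 2 ≤ M) →
      ‖ContinuousLinearMap.adjoint T x‖ ^ 2 ≤ C ^ 2 * M := by
    intro x M hM hK
    set y := ContinuousLinearMap.adjoint T x with hy
    have h1 : (inner ℂ x (T y) : ℂ) = ((‖y‖ ^ 2 : ℝ) : ℂ) := by
      rw [← ContinuousLinearMap.adjoint_inner_left, ← hy, inner_self_eq_norm_sq_to_K]; simp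
    have h2 := frame_hasSum_inner hb x (T y)
    rw [h1] at h2
    have h3 : ‖((‖y‖ ^ 2 : ℝ) : ℂ)‖ ≤ √M * √(C ^ 2 * ‖y‖ ^ 2) := by
      refine le_of_tendsto h2.norm (Eventually.of_forall fun K => ?_)
      refine (norm_sum_le _ _).trans ?_
      calc ∑ k ∈ K, ‖(inner ℂ (inner ℂ (b k) x : ℂ) (inner ℂ (b k) (T y) : ℂ) : ℂ)‖
          ≤ ∑ k ∈ K, ((w k)⁻¹ * ‖(inner ℂ (b k) x : ℂ)‖) *
            (w k * ‖(inner ℂ (b k) (T y) : ℂ)‖) := by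
            refine Finset.sum_le_sum fun k _ => (norm_inner_le_norm _ _).trans (le_of_eq ?_)
            have := (hw0 k).ne'
            field_simp
        _ ≤ √(∑ k ∈ K, ((w k)⁻¹ * ‖(inner ℂ (b k) x : ℂ)‖) ^ 2) *
            √(∑ k ∈ K, (w k * ‖(inner ℂ (b k) (T y) : ℂ)‖) ^ 2) :=
            Real.sum_mul_le_sqrt_mul_sqrt _ _ _
        _ ≤ _ := by
            gcongr
            · simpa [mul_pow] using hK K
            · simpa [mul_pow] using hT y K
    rw [Complex.norm_real, Real.norm_of_nonneg (by positivity), ← Real.sqrt_mul hM,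
      Real.le_sqrt (by positivity) (by positivity)] at h3
    rcases (norm_nonneg y).eq_or_lt with h0 | h0
    · rw [← h0]; simp; positivity
    · have : ‖y‖ ^ 2 * ‖y‖ ^ 2 ≤ (C ^ 2 * M) * ‖y‖ ^ 2 := by linarith
      exact le_of_mul_le_mul_right this (by positivity)
  have hhn : ∀ i, w i ^ 2 * ‖h i‖ ^ 2 ≤ C ^ 2 := by
    intro i
    have h1 := hT (h i) {i}
    rw [Finset.sum_singleton, hin, norm_inner_self_complex] at h1
    rcases (norm_nonneg (h i)).eq_or_lt with h0 | h0
    · rw [← h0]; simp; positivity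
    · have : (w i ^ 2 * ‖h i‖ ^ 2) * ‖h i‖ ^ 2 ≤ C ^ 2 * ‖h i‖ ^ 2 := by linarith
      exact le_of_mul_le_mul_right this (by positivity)
  have hfinZ : ∀ S : Finset ι, ∑ i ∈ S, (w i ^ 4)⁻¹ ≤ Z := fun S =>
    hsum.sum_le_tsum S fun i _ => by have := hw0 i; positivity
  -- The entries `w i ² |⟨b k, h i⟩|²` have row and column sums at most `C²`. Splitting `(w k)⁻² (w
  -- i)⁻² ≤ ((w k)⁻⁴ + (w i)⁻⁴) / 2` reduces the double sum to these, which is why the power `-4`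
  -- suffices for `T²`.
  have hdouble : ∀ K S : Finset ι,
      ∑ k ∈ K, ∑ i ∈ S, (w k ^ 2)⁻¹ * ‖(inner ℂ (b k) (h i) : ℂ)‖ ^ 2 ≤ C ^ 2 * Z := by
    intro K S
    have hterm : ∀ k i, (w k ^ 2)⁻¹ * ‖(inner ℂ (b k) (h i) : ℂ)‖ ^ 2 ≤
        (w k ^ 4)⁻¹ / 2 * (w i ^ 2 * ‖(inner ℂ (b k) (h i) : ℂ)‖ ^ 2) +
        (w i ^ 4)⁻¹ / 2 * (w i ^ 2 * ‖(inner ℂ (b k) (h i) : ℂ)‖ ^ 2) := by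
      intro k i
      have hk := (hw0 k).ne'
      have hi := (hw0 i).ne'
      have e1 : (w k ^ 2)⁻¹ * ‖(inner ℂ (b k) (h i) : ℂ)‖ ^ 2 = ((w k ^ 2)⁻¹ * (w i ^ 2)⁻¹) *
          (w i ^ 2 * ‖(inner ℂ (b k) (h i) : ℂ)‖ ^ 2) := by
        field_simp
      rw [e1, ← add_mul]
      refine mul_le_mul_of_nonneg_right ?_ (by positivity)
      have e2 : ∀ j, (w j ^ 4)⁻¹ = ((w j ^ 2)⁻¹) ^ 2 := fun j => by rw [inv_pow, ← pow_mul]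
      rw [e2, e2]
      nlinarith [sq_nonneg ((w k ^ 2)⁻¹ - (w i ^ 2)⁻¹)]
    have hS : ∀ k, ∑ i ∈ S, w i ^ 2 * ‖(inner ℂ (b k) (h i) : ℂ)‖ ^ 2 ≤ C ^ 2 := by
      intro k
      calc _ = ∑ i ∈ S, w i ^ 2 * ‖(inner ℂ (b i) (T (b k)) : ℂ)‖ ^ 2 :=
            Finset.sum_congr rfl fun i _ => by rw [hin, norm_inner_symm]
        _ ≤ C ^ 2 * ‖b k‖ ^ 2 := hT _ _
        _ ≤ C ^ 2 * 1 ^ 2 := by gcongr; exact frame_norm_le_one hb k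
        _ = C ^ 2 := by ring
    have hKi : ∀ i, ∑ k ∈ K, w i ^ 2 * ‖(inner ℂ (b k) (h i) : ℂ)‖ ^ 2 ≤ C ^ 2 := by
      intro i
      rw [← Finset.mul_sum]
      refine le_trans ?_ (hhn i)
      gcongr
      exact sum_le_hasSum K (fun j _ => sq_nonneg _) (hb (h i))
    calc _ ≤ ∑ k ∈ K, ∑ i ∈ S, ((w k ^ 4)⁻¹ / 2 * (w i ^ 2 * ‖(inner ℂ (b k) (h i) : ℂ)‖ ^ 2) +
        (w i ^ 4)⁻¹ / 2 * (w i ^ 2 * ‖(inner ℂ (b k) (h i) : ℂ)‖ ^ 2)) :=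
          Finset.sum_le_sum fun k _ => Finset.sum_le_sum fun i _ => hterm k i
      _ = ∑ k ∈ K, (w k ^ 4)⁻¹ / 2 * ∑ i ∈ S, (w i ^ 2 * ‖(inner ℂ (b k) (h i) : ℂ)‖ ^ 2) +
          ∑ i ∈ S, (w i ^ 4)⁻¹ / 2 * ∑ k ∈ K, (w i ^ 2 * ‖(inner ℂ (b k) (h i) : ℂ)‖ ^ 2) := by
          simp_rw [Finset.sum_add_distrib, Finset.mul_sum]
          congr 1
          exact Finset.sum_comm
      _ ≤ ∑ k ∈ K, (w k ^ 4)⁻¹ / 2 * C ^ 2 + ∑ i ∈ S, (w i ^ 4)⁻¹ / 2 * C ^ 2 := by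
          refine add_le_add (Finset.sum_le_sum fun k _ => ?_) (Finset.sum_le_sum fun i _ => ?_)
          · exact mul_le_mul_of_nonneg_left (hS k) (by have := hw0 k; positivity)
          · exact mul_le_mul_of_nonneg_left (hKi i) (by have := hw0 i; positivity)
      _ ≤ C ^ 2 * Z := by
          rw [← Finset.sum_mul, ← Finset.sum_mul, ← Finset.sum_div, ← Finset.sum_div]
          have h1 := mul_le_mul_of_nonneg_left (hfinZ K) (sq_nonneg C)
          have h2 := mul_le_mul_of_nonneg_left (hfinZ S) (sq_nonneg C)
          linarith
  have hsm : ∀ i, Summable fun k => (w k ^ 2)⁻¹ * ‖(inner ℂ (b k) (h i) : ℂ)‖ ^ 2 := fun i =>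
    (hb (h i)).summable.of_nonneg_of_le (fun k => by have := hw0 k; positivity) fun k =>
      mul_le_of_le_one_left (sq_nonneg _) (inv_le_one_of_one_le₀ (one_le_pow₀ (hw k)))
  have hsq : ∀ S : Finset ι, ∑ i ∈ S, ‖ContinuousLinearMap.adjoint T (h i)‖ ^ 2 ≤
      C ^ 2 * (C ^ 2 * Z) := by
    intro S
    calc _ ≤ ∑ i ∈ S, C ^ 2 * ∑' k, (w k ^ 2)⁻¹ * ‖(inner ℂ (b k) (h i) : ℂ)‖ ^ 2 := by
          refine Finset.sum_le_sum fun i _ => hadj _ _ ?_ fun K => ?_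
          · exact tsum_nonneg fun k => by have := hw0 k; positivity
          · exact (hsm i).sum_le_tsum K fun k _ => by have := hw0 k; positivity
      _ = C ^ 2 * ∑' k, ∑ i ∈ S, (w k ^ 2)⁻¹ * ‖(inner ℂ (b k) (h i) : ℂ)‖ ^ 2 := by
          rw [← Finset.mul_sum, Summable.tsum_finsetSum fun i _ => hsm i]
      _ ≤ _ := by
          gcongr
          exact Real.tsum_le_of_sum_le (fun k => Finset.sum_nonneg fun i _ => by
            have := hw0 k; positivity) fun K => hdouble K S
  rw [mul_pow, Real.sq_sqrt hZ0]
  -- The coefficient of `T (T (e a))` along `b i` is, up to conjugation, that of `T* h i` along `e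
  -- a`, so Bessel's inequality sums over `a`.
  have h4 : HasSum (fun i => ∑ a, ‖(inner ℂ (b i) (T (T (e a))) : ℂ)‖ ^ 2)
      (∑ a, ‖T (T (e a))‖ ^ 2) := hasSum_sum fun a _ => hb _
  refine hasSum_le_of_sum_le h4 fun S => ?_
  refine le_trans (Finset.sum_le_sum fun i _ => ?_) ((hsq S).trans (le_of_eq (by ring)))
  have h5 : ∀ a, ‖(inner ℂ (b i) (T (T (e a))) : ℂ)‖ =
      ‖(inner ℂ (e a) (ContinuousLinearMap.adjoint T (h i)) : ℂ)‖ := fun a => by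
    rw [hin, ← ContinuousLinearMap.adjoint_inner_left, norm_inner_symm]
  simp_rw [h5]
  exact he.sum_inner_products_le _

end CompactOp

namespace Oseen

variable {n : ℕ} {Ω : Set (Pt n)}

/-! ### Plane waves -/

/-- The phase of a plane wave of period `L` and frequency `k`. -/
noncomputable def phase (L : ℝ) (k : Fin n → ℤ) : Pt n →L[ℝ] ℝ :=
  (2 * Real.pi / L) • ∑ j, (k j : ℝ) • (EuclideanSpace.proj j : Pt n →L[ℝ] ℝ)

/-- The plane wave of period `L` and frequency `k`. -/
noncomputable def wave (L : ℝ) (k : Fin n → ℤ) (x : Pt n) : ℂ :=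
  Complex.exp ((phase L k x : ℂ) * Complex.I)

theorem phase_single (L : ℝ) (k : Fin n → ℤ) (j : Fin n) :
    phase L k (EuclideanSpace.single j 1) = 2 * Real.pi / L * k j := by
  simp [phase]

theorem norm_wave (L : ℝ) (k : Fin n → ℤ) (x : Pt n) : ‖wave L k x‖ = 1 :=
  Complex.norm_exp_ofReal_mul_I _

theorem contDiff_wave (L : ℝ) (k : Fin n → ℤ) {m : WithTop ℕ∞} : ContDiff ℝ m (wave L k) :=
  ((Complex.ofRealCLM.contDiff.comp (phase L k).contDiff).mul contDiff_const).cexp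

theorem fderiv_wave (L : ℝ) (k : Fin n → ℤ) (x : Pt n) (j : Fin n) :
    fderiv ℝ (wave L k) x (EuclideanSpace.single j 1) =
      ((2 * Real.pi / L * k j : ℝ) : ℂ) * Complex.I * wave L k x := by
  have h : HasFDerivAt (wave L k) _ x :=
    ((Complex.ofRealCLM.hasFDerivAt.comp x (phase L k).hasFDerivAt).mul_const Complex.I).cexp
  rw [h.fderiv, ← phase_single]
  simp only [smul_apply, ContinuousLinearMap.comp_apply, Function.comp_apply, wave,
    Complex.ofRealCLM_apply, smul_eq_mul]
  ring

/-- The number `1 + |k|²`. -/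
noncomputable def freqSq (k : Fin n → ℤ) : ℝ := 1 + ∑ j, (k j : ℝ) ^ 2

theorem one_le_freqSq (k : Fin n → ℤ) : 1 ≤ freqSq k :=
  le_add_of_nonneg_right (Finset.sum_nonneg fun _ _ => sq_nonneg _)

/-- Comparison with the lattice sum of `‖k‖⁻⁴`, which converges in dimension below four. This is
where the restriction on the dimension from above enters. -/
theorem summable_freqSq (hn : n < 4) : Summable fun k : Fin n → ℤ => (freqSq k ^ 2)⁻¹ := by
  let L := Submodule.span ℤ (Set.range (Pi.basisFun ℝ (Fin n)))
  have hr : Module.finrank ℤ L < 4 := by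
    rw [ZLattice.rank ℝ L]
    simpa using hn
  let ψ : (Fin n → ℤ) → L := fun k => ⟨fun j => (k j : ℝ), by
    have : (fun j => (k j : ℝ)) = ∑ j, k j • Pi.basisFun ℝ (Fin n) j := by
      ext i
      simp [Pi.single_apply]
    rw [this]
    exact Submodule.sum_mem _ fun j _ =>
      Submodule.smul_mem _ _ (Submodule.subset_span ⟨j, rfl⟩)⟩
  have hψ : Function.Injective ψ := fun k l h => by
    ext j
    have : (k j : ℝ) = l j := congrFun (congrArg Subtype.val h) j
    exact_mod_cast this
  have hs := (ZLattice.summable_norm_pow_inv L 4 hr).comp_injective hψ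
  refine Summable.of_norm_bounded_eventually hs ?_
  have hfin : ({0} : Set (Fin n → ℤ)).Finite := Set.finite_singleton 0
  filter_upwards [hfin.compl_mem_cofinite] with k hk
  have hk0 : ψ k ≠ 0 := fun h => hk (hψ (h.trans (by ext; simp [ψ])))
  have hpos : 0 < ‖ψ k‖ := norm_pos_iff.2 hk0
  have hle : ‖ψ k‖ ^ 2 ≤ freqSq k := by
    have h1 : ‖ψ k‖ ≤ √(freqSq k) := by
      refine (pi_norm_le_iff_of_nonneg (Real.sqrt_nonneg _)).2 fun j => ?_
      refine Real.le_sqrt_of_sq_le ?_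
      rw [Real.norm_eq_abs, sq_abs]
      refine (Finset.single_le_sum (f := fun j => (k j : ℝ) ^ 2) (fun _ _ => sq_nonneg _)
        (Finset.mem_univ j)).trans ?_
      rw [freqSq]
      linarith
    calc ‖ψ k‖ ^ 2 ≤ √(freqSq k) ^ 2 := by gcongr
      _ = _ := Real.sq_sqrt (zero_le_one.trans (one_le_freqSq k))
  have hf := one_le_freqSq k
  rw [Real.norm_of_nonneg (by positivity), Function.comp_apply, inv_pow]
  refine inv_anti₀ (by positivity) ?_
  calc ‖ψ k‖ ^ 4 = (‖ψ k‖ ^ 2) ^ 2 := by ring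
    _ ≤ _ := by gcongr

/-! ### Parseval's identity on a bounded set -/

section Torus

noncomputable local instance : MeasureSpace UnitAddCircle := ⟨AddCircle.haarAddCircle⟩

/-- A bounded set is covered by a cube that is the image of the torus, up to scaling. -/
theorem exists_torus_map (hΩ : Bornology.IsBounded Ω) :
    ∃ (L : ℝ) (Ψ : UnitAddTorus (Fin n) → Pt n) (c : ENNReal) (A : Set (Pt n)), 0 < L ∧ c ≠ 0 ∧
      c ≠ ⊤ ∧ Ω ⊆ A ∧ MeasurePreserving Ψ volume (c • volume.restrict A) ∧
      ∀ k t, UnitAddTorus.mFourier k t = wave L k (Ψ t) := by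
  obtain ⟨R, hR, hΩR⟩ := hΩ.subset_ball_lt 0 0
  let a : Fin n → ℝ := fun _ => -1 / 2
  let B : Set (Fin n → ℝ) := {x | ∀ i, x i ∈ Set.Ioc (a i) (a i + 1)}
  have hB : MeasurableSet B := MeasurableSet.univ_pi' fun i => measurableSet_Ioc
  have h1 : MeasurePreserving (fun t => ((UnitAddTorus.measurableEquivPiIoc a t : B) : Fin n → ℝ))
      volume (volume.restrict B) := by
    refine MeasurePreserving.comp ?_ (UnitAddTorus.measurePreserving_equivPiIoc a)
    exact ⟨measurable_subtype_coe, map_comap_subtype_coe hB volume⟩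
  let A' : Set (Pt n) := {x | WithLp.ofLp x ∈ B}
  have hA' : MeasurableSet A' := by
    have : Measurable (fun x : Pt n => WithLp.ofLp x) := (PiLp.continuous_ofLp 2 _).measurable
    exact this hB
  have h2 : MeasurePreserving (WithLp.toLp 2) (volume.restrict B) (volume.restrict A') :=
    (PiLp.volume_preserving_toLp (Fin n)).restrict_preimage hA'
  -- The cell `(-1/2, 1/2]ⁿ` scaled by `L > 2R` contains the ball of radius `R`.
  let L := 2 * R + 1
  have hL : 0 < L := by positivity
  let A : Set (Pt n) := (fun x => L⁻¹ • x) ⁻¹' A'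
  have hA : MeasurableSet A := (measurable_const_smul L⁻¹) hA'
  have h3 : MeasurePreserving (fun x : Pt n => L • x) volume
      (ENNReal.ofReal |(L ^ Module.finrank ℝ (Pt n))⁻¹| • volume) :=
    ⟨measurable_const_smul L, Measure.map_addHaar_smul _ hL.ne'⟩
  have h4 := h3.restrict_preimage hA
  have e : (fun x : Pt n => L • x) ⁻¹' A = A' := by
    ext x
    simp [A, smul_smul, inv_mul_cancel₀ hL.ne']
  rw [e, Measure.restrict_smul] at h4
  refine ⟨L, _, _, A, hL, ?_, ENNReal.ofReal_ne_top, fun x hx => ?_, (h4.comp h2).comp h1,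
    fun k t => ?_⟩
  · rw [ENNReal.ofReal_ne_zero_iff]
    positivity
  · have hxR : ‖x‖ < R := by simpa using hΩR hx
    intro i
    have hi : |x i| < R := lt_of_le_of_lt (by simpa using PiLp.norm_apply_le x i) hxR
    have hi' := abs_lt.1 hi
    have e1 : (WithLp.ofLp (L⁻¹ • x)) i = x i / L := by simp [inv_mul_eq_div]
    rw [e1]
    constructor
    · rw [lt_div_iff₀ hL]
      simp only [a, L]
      linarith
    · rw [div_le_iff₀ hL]
      simp only [a, L]
      linarith
  · have e2 : ∀ i, t i = (((UnitAddTorus.measurableEquivPiIoc a t : B) : Fin n → ℝ) i :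
        UnitAddCircle) := fun i => by
      rw [UnitAddTorus.coe_measurableEquivPiIoc_apply]
      exact (AddCircle.coe_equivIoc (p := (1 : ℝ))).symm
    change ∏ i, fourier (k i) (t i) = _
    simp_rw [fun i => congrArg (fourier (k i)) (e2 i), fourier_coe_apply]
    rw [← Complex.exp_sum, wave]
    congr 1
    simp only [phase, Function.comp_apply]
    simp only [smul_apply, sum_apply, Finset.mul_sum, Finset.sum_mul, smul_eq_mul,
      Complex.ofReal_sum, map_smul, PiLp.proj_apply]
    refine Finset.sum_congr rfl fun i _ => ?_
    have hL' : (L : ℂ) ≠ 0 := by exact_mod_cast hL.ne'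
    push_cast
    field_simp

/-- Parseval's identity for scalar functions on a bounded set. -/
theorem exists_parseval (hΩ : Bornology.IsBounded Ω) (hm : MeasurableSet Ω) :
    ∃ L C : ℝ, 0 < L ∧ 0 < C ∧ ∀ f : Pt n → ℂ, MemLp f 2 (volume.restrict Ω) →
      HasSum (fun k => ‖∫ x in Ω, conj (wave L k x) * f x‖ ^ 2) (C * ∫ x in Ω, ‖f x‖ ^ 2) := by
  obtain ⟨L, Ψ, c, A, hL, hc0, hc, hA, hΨ, hw⟩ := exists_torus_map hΩ
  have hr : 0 < c.toReal := ENNReal.toReal_pos hc0 hc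
  refine ⟨L, c.toReal⁻¹, hL, inv_pos.2 hr, fun f hf => ?_⟩
  have hres : (c • volume.restrict A).restrict Ω = c • volume.restrict Ω := by
    rw [Measure.restrict_smul, Measure.restrict_restrict hm, Set.inter_eq_left.2 hA]
  -- The function is extended by zero to the period cell; the density `c` of the image measure
  -- becomes the constant in Parseval's identity.
  have hg : MemLp (Ω.indicator f) 2 (c • volume.restrict A) := by
    rw [memLp_indicator_iff_restrict hm, hres]
    exact hf.smul_measure hc
  have hF : MemLp (Ω.indicator f ∘ Ψ) 2 volume := hg.comp_measurePreserving hΨ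
  have hint : ∀ {E : Type} [NormedAddCommGroup E] [NormedSpace ℝ E] (g : Pt n → E),
      AEStronglyMeasurable (Ω.indicator g) (c • volume.restrict A) →
      ∫ t, Ω.indicator g (Ψ t) = c.toReal • ∫ x in Ω, g x := by
    intro E _ _ g hg
    rw [← integral_map hΨ.aemeasurable (hΨ.map_eq ▸ hg), hΨ.map_eq, integral_indicator hm, hres,
      integral_smul_measure]
  have hcoef : ∀ k, UnitAddTorus.mFourierCoeff (hF.toLp _) k =
      c.toReal * ∫ x in Ω, conj (wave L k x) * f x := by
    intro k
    rw [UnitAddTorus.mFourierCoeff]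
    have e : ∫ t, UnitAddTorus.mFourier (-k) t • (hF.toLp _ : Lp ℂ 2 volume) t =
        ∫ t, Ω.indicator (fun x => conj (wave L k x) * f x) (Ψ t) := by
      refine integral_congr_ae ?_
      filter_upwards [hF.coeFn_toLp] with t ht
      rw [ht, UnitAddTorus.mFourier_neg, hw]
      by_cases hx : Ψ t ∈ Ω <;> simp [hx]
    rw [e, hint, Complex.real_smul]
    have hm1 := hg.1
    have : Ω.indicator (fun x => conj (wave L k x) * f x) =
        fun x => conj (wave L k x) * Ω.indicator f x := by
      ext x
      by_cases hx : x ∈ Ω <;> simp [hx]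
    rw [this]
    exact ((Complex.continuous_conj.comp
      (contDiff_wave L k (m := 0)).continuous).aestronglyMeasurable).mul hm1
  have hnorm : ∫ t, ‖(hF.toLp _ : Lp ℂ 2 volume) t‖ ^ 2 = c.toReal * ∫ x in Ω, ‖f x‖ ^ 2 := by
    have e : ∫ t, ‖(hF.toLp _ : Lp ℂ 2 volume) t‖ ^ 2 =
        ∫ t, Ω.indicator (fun x => ‖f x‖ ^ 2) (Ψ t) := by
      refine integral_congr_ae ?_
      filter_upwards [hF.coeFn_toLp] with t ht
      rw [ht]
      by_cases hx : Ψ t ∈ Ω <;> simp [hx]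
    rw [e, hint, smul_eq_mul]
    have : Ω.indicator (fun x => ‖f x‖ ^ 2) = fun x => ‖Ω.indicator f x‖ ^ 2 := by
      ext x
      by_cases hx : x ∈ Ω <;> simp [hx]
    rw [this]
    exact hg.1.norm.pow 2
  have h := UnitAddTorus.hasSum_sq_mFourierCoeff (hF.toLp _)
  rw [hnorm] at h
  simp_rw [hcoef, norm_mul, mul_pow] at h
  have h2 := h.mul_left (c.toReal ^ 2)⁻¹
  have hr' := hr.ne'
  have e1 : (c.toReal ^ 2)⁻¹ * (c.toReal * ∫ x in Ω, ‖f x‖ ^ 2) =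
      c.toReal⁻¹ * ∫ x in Ω, ‖f x‖ ^ 2 := by field_simp
  rw [e1] at h2
  refine h2.congr_fun fun k => ?_
  rw [Complex.norm_real, Real.norm_of_nonneg hr.le]
  field_simp

end Torus

section Bounded

variable [IsFiniteMeasure (volume.restrict Ω)]

theorem memLp_wave (L : ℝ) (k : Fin n → ℤ) : MemLp (wave L k) 2 (volume.restrict Ω) :=
  (memLp_const (1 : ℂ)).of_le (contDiff_wave L k (m := 0)).continuous.aestronglyMeasurable
    (Eventually.of_forall fun x => by simp [norm_wave])

/-- The plane wave polarized in the `p`-th coordinate. -/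
noncomputable def waveL (Ω : Set (Pt n)) [IsFiniteMeasure (volume.restrict Ω)] {κ : Type}
    [Fintype κ] [DecidableEq κ] (L : ℝ) (k : Fin n → ℤ) (p : κ) :
    Lp (EuclideanSpace ℂ κ) 2 (volume.restrict Ω) :=
  (memLp_single (memLp_wave L k) p).toLp

theorem inner_waveL {κ : Type} [Fintype κ] [DecidableEq κ] (L : ℝ) (k : Fin n → ℤ) (p : κ)
    (f : Lp (EuclideanSpace ℂ κ) 2 (volume.restrict Ω)) :
    inner ℂ (waveL Ω L k p) f = ∫ x in Ω, conj (wave L k x) * f x p := by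
  rw [waveL, inner_toLp]
  simp [EuclideanSpace.inner_single_left]

/-- The polarized plane waves form a tight frame. -/
theorem exists_wave_frame (hΩ : Bornology.IsBounded Ω) (hm : MeasurableSet Ω) :
    ∃ L C : ℝ, 0 < L ∧ 0 < C ∧ ∀ (κ : Type) [Fintype κ] [DecidableEq κ]
      (f : Lp (EuclideanSpace ℂ κ) 2 (volume.restrict Ω)),
      HasSum (fun q : κ × (Fin n → ℤ) => ‖(inner ℂ (waveL Ω L q.2 q.1) f : ℂ)‖ ^ 2)
        (C * ‖f‖ ^ 2) := by
  obtain ⟨L, C, hL, hC, h⟩ := exists_parseval hΩ hm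
  refine ⟨L, C, hL, hC, fun κ _ _ f => ?_⟩
  have hmem : ∀ p, MemLp (fun x => f x p) 2 (volume.restrict Ω) := fun p =>
    (Lp.memLp f).continuousLinearMap_comp (EuclideanSpace.proj p : EuclideanSpace ℂ κ →L[ℂ] ℂ)
  have hp : ∀ p, HasSum (fun k => ‖(inner ℂ (waveL Ω L k p) f : ℂ)‖ ^ 2)
      (C * ∫ x in Ω, ‖f x p‖ ^ 2) := fun p => by
    simp_rw [inner_waveL]
    exact h _ (hmem p)
  have hs : Summable fun q : κ × (Fin n → ℤ) => ‖(inner ℂ (waveL Ω L q.2 q.1) f : ℂ)‖ ^ 2 := by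
    rw [summable_prod_of_nonneg fun q => sq_nonneg _]
    exact ⟨fun p => (hp p).summable, (hasSum_fintype _).summable⟩
  have h1 := (hs.hasSum.prod_fiberwise hp).unique (hasSum_fintype _)
  have h2 : ∑ p, C * ∫ x in Ω, ‖f x p‖ ^ 2 = C * ‖f‖ ^ 2 := by
    have hn : ((‖f‖ ^ 2 : ℝ) : ℂ) = ((∫ x in Ω, ‖f x‖ ^ 2 : ℝ) : ℂ) := by
      have e : (inner ℂ f f : ℂ) = ((‖f‖ ^ 2 : ℝ) : ℂ) := by
        rw [inner_self_eq_norm_sq_to_K]; simp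
      rw [← e, L2.inner_def, ← integral_complex_ofReal]
      refine integral_congr_ae (Eventually.of_forall fun x => ?_)
      simp only [inner_self_eq_norm_sq_to_K]
      simp
    rw [Complex.ofReal_injective hn, ← Finset.mul_sum, ← integral_finsetSum]
    · simp_rw [EuclideanSpace.norm_sq_eq]
    · exact fun p _ => (hmem p).integrable_norm_pow (by norm_num)
  have h3 := hs.hasSum
  rwa [h1, h2] at h3

/-- Elements of the gradient space are smoother than square integrable, in terms of plane waves. -/
theorem exists_smoothing (hn : n ≠ 0) (hne : volume Ω ≠ 0) (hΩ : Bornology.IsBounded Ω)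
    (hm : MeasurableSet Ω) :
    ∃ (b : Fin n × (Fin n → ℤ) → VecL2 Ω) (C : ℝ), 0 ≤ C ∧
      (∀ f, HasSum (fun q => ‖(inner ℂ (b q) f : ℂ)‖ ^ 2) (‖f‖ ^ 2)) ∧
      ∀ y ∈ SaddlePoint.gradSpace (divGraph0 Ω) (devL Ω), ∀ S : Finset (Fin n × (Fin n → ℤ)),
        ∑ q ∈ S, freqSq q.2 * ‖(inner ℂ (b q) y.snd : ℂ)‖ ^ 2 ≤
          ‖y.snd‖ ^ 2 + C * ‖y.fst‖ ^ 2 := by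
  obtain ⟨L, C, hL, hC, hf⟩ := exists_wave_frame hΩ hm
  -- Normalization that turns the tight frame into a Parseval frame.
  set a : ℝ := (√C)⁻¹ with ha
  have ha2 : a ^ 2 * C = 1 := by
    rw [ha, inv_pow, Real.sq_sqrt hC.le, inv_mul_cancel₀ hC.ne']
  set c : ℝ := 2 * Real.pi / L with hc
  have hc0 : 0 < c := by positivity
  have hb : ∀ (q : Fin n × (Fin n → ℤ)) (f : VecL2 Ω),
      ‖(inner ℂ ((a : ℂ) • waveL Ω L q.2 q.1) f : ℂ)‖ ^ 2 =
        a ^ 2 * ‖(inner ℂ (waveL Ω L q.2 q.1) f : ℂ)‖ ^ 2 := fun q f => by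
    rw [inner_smul_left, norm_mul, mul_pow, Complex.conj_ofReal, Complex.norm_real, Real.norm_eq_abs,
      sq_abs]
  have hframe : ∀ f : VecL2 Ω, HasSum (fun q : Fin n × (Fin n → ℤ) =>
      ‖(inner ℂ ((a : ℂ) • waveL Ω L q.2 q.1) f : ℂ)‖ ^ 2) (‖f‖ ^ 2) := fun f => by
    simp_rw [hb]
    have := (hf (Fin n) f).mul_left (a ^ 2)
    rwa [← mul_assoc, ha2, one_mul] at this
  refine ⟨fun q => (a : ℂ) • waveL Ω L q.2 q.1, (c ^ 2)⁻¹, by positivity, hframe,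
    fun y hy S => ?_⟩
  -- The test tensor is the plane wave in the entry `(i, j)`, whose divergence is `i c kⱼ` times the
  -- wave in direction `i`. Elements of `H(div)` carry no boundary condition, so waves are
  -- admissible on any bounded domain and no regularity of the boundary is used.
  have hdiv : ∀ (i j : Fin n) (k : Fin n → ℤ),
      (k j : ℝ) ^ 2 * ‖(inner ℂ (waveL Ω L k i) y.snd : ℂ)‖ ^ 2 =
        (c ^ 2)⁻¹ * ‖(inner ℂ (waveL Ω L k (i, j)) y.fst : ℂ)‖ ^ 2 := by
    intro i j k
    have hg2 : MemLp (fun x => (EuclideanSpace.single i (((c * k j : ℝ) : ℂ) * Complex.I *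
        wave L k x) : Vec n)) 2 (volume.restrict Ω) :=
      memLp_single ((memLp_wave L k).const_mul _) i
    have hw : IsWeakDiv Ω (waveL Ω L k (i, j)) (hg2.toLp) := by
      refine isWeakDiv_of_contDiff (fun p => ?_) (fun x l => ?_) _ _
      · by_cases hp : p = (i, j)
        · simpa [hp] using contDiff_wave L k
        · simpa [hp] using contDiff_const
      · by_cases hl : l = i
        · subst hl
          rw [Finset.sum_eq_single j]
          · simp [fderiv_wave, hc]
          · intro m _ hmj
            simp [hmj]
          · simp
        · simp [hl]
    have h1 := gradSpace_inner_eq_zero hn hne hy hw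
    have h2 : (hg2.toLp : VecL2 Ω) = (((c * k j : ℝ) : ℂ) * Complex.I) • waveL Ω L k i := by
      refine Lp.ext ?_
      filter_upwards [hg2.coeFn_toLp, (memLp_single (memLp_wave (Ω := Ω) L k) i).coeFn_toLp,
        Lp.coeFn_smul (((c * k j : ℝ) : ℂ) * Complex.I) (waveL Ω L k i)] with x h1 h2 h3
      have h4 : waveL Ω L k i x = EuclideanSpace.single i (wave L k x) := h2
      rw [h1, h3, Pi.smul_apply, h4]
      ext l
      by_cases hl : l = i <;> simp [hl]
    rw [h2, inner_smul_left] at h1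
    have h3 : ‖(inner ℂ (waveL Ω L k (i, j)) y.fst : ℂ)‖ =
        |c * k j| * ‖(inner ℂ (waveL Ω L k i) y.snd : ℂ)‖ := by
      rw [eq_neg_of_add_eq_zero_left h1, norm_neg, norm_mul, RCLike.norm_conj, norm_mul,
        Complex.norm_I, mul_one, Complex.norm_real, Real.norm_eq_abs]
    rw [h3, mul_pow, sq_abs, mul_pow, ← mul_assoc, ← mul_assoc,
      inv_mul_cancel₀ (by positivity), one_mul]
  have hT : ∑ q ∈ S, ∑ j, ‖(inner ℂ (waveL Ω L q.2 (q.1, j)) y.fst : ℂ)‖ ^ 2 ≤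
      C * ‖y.fst‖ ^ 2 := by
    rw [← Finset.sum_product']
    let ε : (Fin n × (Fin n → ℤ)) × Fin n ↪ (Fin n × Fin n) × (Fin n → ℤ) :=
      ⟨fun r => ((r.1.1, r.2), r.1.2), by
        rintro ⟨⟨i, k⟩, j⟩ ⟨⟨i', k'⟩, j'⟩ h
        simp only [Prod.mk.injEq] at h ⊢
        exact ⟨⟨h.1.1, h.2⟩, h.1.2⟩⟩
    have := sum_le_hasSum ((S ×ˢ Finset.univ).map ε) (fun q _ => sq_nonneg _)
      (hf (Fin n × Fin n) y.fst)
    rwa [Finset.sum_map] at this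
  calc ∑ q ∈ S, freqSq q.2 * ‖(inner ℂ ((a : ℂ) • waveL Ω L q.2 q.1) y.snd : ℂ)‖ ^ 2
      = ∑ q ∈ S, ‖(inner ℂ ((a : ℂ) • waveL Ω L q.2 q.1) y.snd : ℂ)‖ ^ 2 +
        a ^ 2 * ((c ^ 2)⁻¹ *
          ∑ q ∈ S, ∑ j, ‖(inner ℂ (waveL Ω L q.2 (q.1, j)) y.fst : ℂ)‖ ^ 2) := by
        rw [Finset.mul_sum, Finset.mul_sum, ← Finset.sum_add_distrib]
        refine Finset.sum_congr rfl fun q _ => ?_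
        rw [freqSq, add_mul, one_mul, hb, Finset.mul_sum, Finset.mul_sum, Finset.sum_mul]
        congr 1
        refine Finset.sum_congr rfl fun j _ => ?_
        rw [← hdiv]
        ring
    _ ≤ ‖y.snd‖ ^ 2 + a ^ 2 * ((c ^ 2)⁻¹ * (C * ‖y.fst‖ ^ 2)) := by
        gcongr
        exact sum_le_hasSum S (fun q _ => sq_nonneg _) (hframe y.snd)
    _ = ‖y.snd‖ ^ 2 + (a ^ 2 * C) * ((c ^ 2)⁻¹ * ‖y.fst‖ ^ 2) := by ring
    _ = _ := by rw [ha2, one_mul]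

end Bounded

end Oseen

/-! ### Semisimplicity of the eigenvalue zero. -/

namespace CompactOp

variable {H : Type*} [NormedAddCommGroup H] [InnerProductSpace ℂ H]

/-- If an operator and its adjoint have the same kernel, then zero is a semisimple eigenvalue. -/
theorem maxGenEigenspace_zero_of_ker_eq [CompleteSpace H] {T : H →L[ℂ] H}
    (h : ∀ f, T f = 0 → ContinuousLinearMap.adjoint T f = 0) :
    Module.End.maxGenEigenspace (T : H →ₗ[ℂ] H) 0 = Module.End.eigenspace (T : H →ₗ[ℂ] H) 0 := by
  -- `T f` lies in the kernel of `T`, hence in that of `T*`, which is orthogonal to the range of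
  -- `T`; so `T f` is orthogonal to itself.
  have hker : ∀ f, T (T f) = 0 → T f = 0 := fun f hf => by
    have h1 := h _ hf
    rw [← inner_self_eq_zero (𝕜 := ℂ), ← ContinuousLinearMap.adjoint_inner_right, h1,
      inner_zero_right]
  refine le_antisymm (fun x hx => ?_) fun x hx => ?_
  · obtain ⟨k, hk⟩ := Module.End.mem_maxGenEigenspace _ _ _ |>.1 hx
    rw [zero_smul, sub_zero] at hk
    rw [Module.End.mem_eigenspace_iff, zero_smul]
    change T x = 0
    induction k with
    | zero =>
      rw [pow_zero, Module.End.one_apply] at hk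
      rw [hk, map_zero]
    | succ k ih =>
      rcases k with _ | k
      · simpa using hk
      · refine ih ?_
        rw [pow_succ', Module.End.mul_apply, pow_succ', Module.End.mul_apply] at hk
        rw [pow_succ', Module.End.mul_apply]
        exact hker _ hk
  · exact (Module.End.mem_maxGenEigenspace _ _ _).2 ⟨1, by
      rw [zero_smul, sub_zero, pow_one]
      rw [Module.End.mem_eigenspace_iff, zero_smul] at hx
      exact hx⟩

end CompactOp

/-! ### Resolvent decay, and data with vanishing solution. -/

namespace SaddlePoint

variable {E Q : Type*} [NormedAddCommGroup E] [InnerProductSpace ℂ E]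
  [NormedAddCommGroup Q] [InnerProductSpace ℂ Q]
variable {G : Submodule ℂ (WithLp 2 (E × Q))} {P : E →L[ℂ] E} {ν : ℝ} {B : Q →L[ℂ] E}

/-- Resolvent estimate for the solution operator outside a sector about the positive half line. -/
theorem exists_resolvent_bound (hP : IsPerturbation P B) (hν : 0 < ν) {b : ℝ}
    (hb : ∀ u, ‖B u‖ ≤ b * ‖u‖) {T : Q →L[ℂ] Q} (hT : ∀ f, ∃ p, IsSol G P ν B f p (T f))
    {c : ℝ} (hc0 : 0 ≤ c) (hc1 : c < 1) :
    ∃ R K : ℝ, ∀ z : ℂ, R ≤ ‖z‖ → z.re ≤ c * ‖z‖ → ∀ y, ‖z‖ * ‖T y‖ ≤ K * ‖y - z • T y‖ := by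
  set δ : ℝ := √((1 - c) / 2) with hδ
  have hδ2 : δ ^ 2 = (1 - c) / 2 := Real.sq_sqrt (by linarith)
  have hδ0 : 0 < δ := Real.sqrt_pos.2 (by linarith)
  -- The radius is such that the convective term, after Young's inequality, uses at most half of `δ
  -- ‖z‖ ‖u‖²`; the other half gives the bound `2 / δ`.
  refine ⟨b ^ 2 / (2 * δ ^ 2 * ν), 2 / δ, fun z hz hre y => ?_⟩
  obtain ⟨p, hp⟩ := hT y
  have h1 := hp.energy hP hν rfl
  set g : E := (ν : ℂ)⁻¹ • (P p.fst + B (T y)) with hg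
  set u := T y with hu
  set r := y - z • u with hr
  have hy : y = r + z • u := by rw [hr, sub_add_cancel]
  have hus : (inner ℂ u u : ℂ) = (‖u‖ : ℂ) ^ 2 := by
    rw [inner_self_eq_norm_sq_to_K]; simp
  rw [hy, inner_add_right, inner_smul_right, hus] at h1
  have h2 : (ν : ℂ) * (‖g‖ : ℂ) ^ 2 - z * (‖u‖ : ℂ) ^ 2 = inner ℂ u r + inner ℂ g (B u) := by
    linear_combination h1
  have h3 : ‖(ν : ℂ) * (‖g‖ : ℂ) ^ 2 - z * (‖u‖ : ℂ) ^ 2‖ ≤ ‖u‖ * ‖r‖ + ‖g‖ * (b * ‖u‖) := by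
    rw [h2]
    refine (norm_add_le _ _).trans (add_le_add (norm_inner_le_norm _ _) ?_)
    exact (norm_inner_le_norm _ _).trans (by gcongr; exact hb u)
  set s := ‖u‖ with hs
  set t := ‖g‖ with ht
  have hs0 : 0 ≤ s := norm_nonneg _
  have ht0 : 0 ≤ t := norm_nonneg _
  have hz0 : 0 ≤ ‖z‖ := norm_nonneg _
  -- Outside the sector `ν t²` and `z s²` cannot cancel: with `a = ν t²` and `d = ‖z‖ s²`, `a² - 2c
  -- a d + d² - δ² (a + d)²` equals `(1 + c) / 2` times `(a - d)²`.
  have h4 : δ * (ν * t ^ 2 + ‖z‖ * s ^ 2) ≤ ‖(ν : ℂ) * (t : ℂ) ^ 2 - z * (s : ℂ) ^ 2‖ := by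
    refine le_of_sq_le_sq ?_ (norm_nonneg _)
    have e : ‖(ν : ℂ) * (t : ℂ) ^ 2 - z * (s : ℂ) ^ 2‖ ^ 2 =
        (ν * t ^ 2) ^ 2 - 2 * (ν * t ^ 2) * s ^ 2 * z.re + (‖z‖ * s ^ 2) ^ 2 := by
      have e1 : (ν : ℂ) * (t : ℂ) ^ 2 - z * (s : ℂ) ^ 2 =
          ((ν * t ^ 2 : ℝ) : ℂ) - ((s ^ 2 : ℝ) : ℂ) * z := by push_cast; ring
      rw [e1, mul_pow ‖z‖, Complex.sq_norm, Complex.sq_norm, Complex.normSq_apply,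
        Complex.normSq_apply]
      simp only [Complex.sub_re, Complex.sub_im, Complex.ofReal_re, Complex.ofReal_im,
        Complex.re_ofReal_mul, Complex.im_ofReal_mul]
      ring
    rw [e, mul_pow, hδ2]
    have h5 : 2 * (ν * t ^ 2) * s ^ 2 * z.re ≤ 2 * (ν * t ^ 2) * s ^ 2 * (c * ‖z‖) :=
      mul_le_mul_of_nonneg_left hre (by positivity)
    nlinarith [mul_nonneg (by linarith : 0 ≤ 1 + c) (sq_nonneg (ν * t ^ 2 - ‖z‖ * s ^ 2))]
  have h5 : b * t * s ≤ δ * ν * t ^ 2 + b ^ 2 / (4 * δ * ν) * s ^ 2 := by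
    have e : δ * ν * t ^ 2 + b ^ 2 / (4 * δ * ν) * s ^ 2 - b * t * s =
        (2 * δ * ν * t - b * s) ^ 2 / (4 * δ * ν) := by
      field_simp
      ring
    have : 0 ≤ (2 * δ * ν * t - b * s) ^ 2 / (4 * δ * ν) := by positivity
    linarith
  have h6 : b ^ 2 / (4 * δ * ν) ≤ δ / 2 * ‖z‖ := by
    have := mul_le_mul_of_nonneg_left hz (by positivity : 0 ≤ δ / 2)
    refine le_trans (le_of_eq ?_) this
    field_simp
    ring
  have h7 := mul_le_mul_of_nonneg_right h6 (sq_nonneg s)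
  have h8 : (δ / 2 * (‖z‖ * s)) * s ≤ ‖r‖ * s := by nlinarith
  rw [div_mul_eq_mul_div, le_div_iff₀ hδ0]
  rcases hs0.eq_or_lt with h0 | h0
  · rw [← h0, mul_zero, zero_mul]; positivity
  · have := le_of_mul_le_mul_right h8 h0
    linarith

/-- The problem with vanishing second component does not depend on the perturbation. -/
theorem IsSol.of_zero {f : Q} {p : WithLp 2 (E × Q)} (h : IsSol G P ν B f p 0) (B' : Q →L[ℂ] E) :
    IsSol G P ν B' f p 0 where
  mem := h.mem
  eq₁ q hq := by simpa using h.eq₁ q hq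
  eq₂ := h.eq₂

/-- With `u = 0` the first equation can be tested with the stress itself. -/
theorem IsSol.map_fst_eq_zero {f : Q} {p : WithLp 2 (E × Q)} (h : IsSol G P ν B f p 0) :
    P p.fst = 0 := by
  simpa using h.eq₁ p h.mem

end SaddlePoint

/-! ### Rotated gradients and the infinite rank of the solution operator. -/

namespace Oseen

variable {n : ℕ} {Ω : Set (Pt n)}

theorem pderiv_comm {φ : Pt n → ℝ} (h : ContDiff ℝ ∞ φ) (i j : Fin n) (x : Pt n) :
    pderiv i (pderiv j φ) x = pderiv j (pderiv i φ) x := by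
  have hd : DifferentiableAt ℝ (fderiv ℝ φ) x :=
    ((h.fderiv_right (m := ∞) (by simp)).differentiable (by simp)).differentiableAt
  have e : ∀ i j, pderiv i (pderiv j φ) x =
      fderiv ℝ (fderiv ℝ φ) x (EuclideanSpace.single i 1) (EuclideanSpace.single j 1) := by
    intro i j
    unfold pderiv
    rw [fderiv_clm_apply hd (differentiableAt_const _)]
    simp
  rw [e, e]
  exact (h.contDiffAt.isSymmSndFDerivAt (by
    rw [minSmoothness_of_isRCLikeNormedField]
    exact WithTop.coe_le_coe.2 (le_top : (2 : ℕ∞) ≤ ⊤))) _ _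

/-- The rotated gradient of `φ` in the coordinate plane `i, j`. -/
noncomputable def curlL {φ : Pt n → ℝ} (h : IsTest Ω φ) (i j : Fin n) : VecL2 Ω :=
  ((h.pderiv j).memLp_vecField i).toLp - ((h.pderiv i).memLp_vecField j).toLp

/-- Rotated gradients are orthogonal to gradients. -/
theorem curlL_eq_zero {φ : Pt n → ℝ} (h : IsTest Ω φ) (i j : Fin n) {σ : TenL2 Ω}
    (hσ : devL Ω σ = 0) (hdiv : IsWeakDiv Ω σ (-curlL h i j)) : curlL h i j = 0 := by
  -- `D` is the Jacobian of the rotated gradient, and is trace free because mixed derivatives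
  -- commute. Its product with `σ` is therefore zero, while integration by parts evaluates it as the
  -- squared norm of the rotated gradient.
  set D : TenL2 Ω := ((h.pderiv j).memLp_gradField i).toLp - ((h.pderiv i).memLp_gradField j).toLp
    with hD
  have h1 : devL Ω D = D := by
    refine Lp.ext ?_
    filter_upwards [coeFn_devL D, Lp.coeFn_sub ((h.pderiv j).memLp_gradField i).toLp
      ((h.pderiv i).memLp_gradField j).toLp, ((h.pderiv j).memLp_gradField i).coeFn_toLp,
      ((h.pderiv i).memLp_gradField j).coeFn_toLp] with x h1 h2 h3 h4
    rw [h1, dev_eq]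
    have htr : tr (D x) = 0 := by
      rw [hD, h2, Pi.sub_apply, h3, h4]
      have e : ∀ (ψ : Pt n → ℝ) (k : Fin n), tr (gradField ψ k x) = pderiv k ψ x := by
        intro ψ k
        simp only [tr, gradField, WithLp.ofLp_sum, Finset.sum_apply, PiLp.single_apply,
          Prod.mk.injEq]
        rw [Finset.sum_eq_single k, Finset.sum_eq_single k]
        · simp
        · intro l _ hl; simp [hl.symm]
        · simp
        · intro l _ hl; simp [hl]
        · simp
      have e2 : ∀ A B : Ten n, tr (A - B) = tr A - tr B := fun A B => by
        simp [tr, Finset.sum_sub_distrib]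
      rw [e2, e, e, pderiv_comm h.smooth, sub_self]
    rw [htr, zero_div, zero_smul, sub_zero]
  have h2 : (inner ℂ D σ : ℂ) = 0 := by rw [← h1, inner_devL, hσ, inner_zero_right]
  have h3 := isWeakDiv_iff.1 hdiv _ (h.pderiv j) i
  have h4 := isWeakDiv_iff.1 hdiv _ (h.pderiv i) j
  rw [hD, inner_sub_left, h3, h4] at h2
  rw [← inner_self_eq_zero (𝕜 := ℂ)]
  nth_rewrite 1 [curlL]
  rw [inner_sub_left]
  simp only [inner_neg_right] at h2
  linear_combination h2

/-- As `i ≠ j`, the `j`-th component is `-∂ᵢ φ` alone. Its vanishing makes `φ` constant on lines in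
direction `i`, and these leave the support. -/
theorem eq_zero_of_curlL_eq_zero (hΩ : IsOpen Ω) {φ : Pt n → ℝ} (h : IsTest Ω φ) {i j : Fin n}
    (hij : i ≠ j) (h0 : curlL h i j = 0) : φ = 0 := by
  have hi : ∀ x ∈ Ω, pderiv i φ x = 0 := by
    have hae : pderiv i φ =ᵐ[volume.restrict Ω] 0 := by
      have h1 := Lp.coeFn_zero (Vec n) 2 (volume.restrict Ω)
      rw [← h0] at h1
      filter_upwards [h1, Lp.coeFn_sub ((h.pderiv j).memLp_vecField i).toLp
        ((h.pderiv i).memLp_vecField j).toLp, ((h.pderiv j).memLp_vecField i).coeFn_toLp,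
        ((h.pderiv i).memLp_vecField j).coeFn_toLp] with x h1 h2 h3 h4
      rw [curlL, h2, Pi.sub_apply, h3, h4] at h1
      have h5 := congrArg (fun v : Vec n => v j) h1
      simpa [vecField, hij.symm] using h5
    exact Measure.eqOn_open_of_ae_eq hae hΩ (h.pderiv i).smooth.continuous.continuousOn
      continuousOn_const
  have hi' : ∀ x, fderiv ℝ φ x (EuclideanSpace.single i 1) = 0 := fun x => by
    by_cases hx : x ∈ Ω
    · exact hi x hx
    · exact (h.pderiv i).eq_zero hx
  obtain ⟨r, hr, hball⟩ := h.compact.isCompact.isBounded.subset_ball_lt 0 0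
  funext x
  let e : Pt n := EuclideanSpace.single i 1
  have hd : ∀ t : ℝ, HasDerivAt (fun t : ℝ => φ (x + t • e)) 0 t := by
    intro t
    have h1 : HasDerivAt (fun t : ℝ => x + t • e) e t := by
      simpa using ((hasDerivAt_id t).smul_const e).const_add x
    have h2 := ((h.smooth.differentiable (by simp)).differentiableAt
      (x := x + t • e)).hasFDerivAt.comp_hasDerivAt t h1
    rwa [hi'] at h2
  have hconst := is_const_of_deriv_eq_zero (fun t => (hd t).differentiableAt)
    (fun t => (hd t).deriv) 0 (r + ‖x‖)
  simp only [zero_smul, add_zero] at hconst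
  rw [hconst]
  refine image_eq_zero_of_notMem_tsupport fun hmem => ?_
  have h1 : ‖x + (r + ‖x‖) • e‖ < r := by simpa using hball hmem
  have h2 : ‖(r + ‖x‖) • e‖ = r + ‖x‖ := by
    rw [norm_smul, Real.norm_of_nonneg (by positivity)]
    simp [e]
  have h3 := norm_sub_le (x + (r + ‖x‖) • e) x
  rw [add_sub_cancel_left, h2] at h3
  linarith

/-- Test functions form an infinite dimensional space: there is a test function all of whose
products with polynomials in one coordinate are different. -/
theorem exists_test_polynomial (hΩ : IsOpen Ω) (hne : Ω.Nonempty) (i : Fin n) :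
    ∃ φ, IsTest Ω φ ∧ ∀ p : Polynomial ℝ, (fun x => φ x * p.eval (x i)) = 0 → p = 0 := by
  obtain ⟨x₀, hx₀⟩ := hne
  obtain ⟨ε, hε, hball⟩ := Metric.isOpen_iff.1 hΩ x₀ hx₀
  let f : ContDiffBump x₀ := ⟨ε / 4, ε / 2, by positivity, by linarith⟩
  refine ⟨f, ⟨f.contDiff, f.hasCompactSupport, ?_⟩, fun p hp => ?_⟩
  · rw [f.tsupport_eq]
    exact (Metric.closedBall_subset_ball (by simp only [f]; linarith)).trans hball
  · refine Polynomial.eq_zero_of_infinite_isRoot p ?_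
    -- The bump is positive on a segment in direction `i`, so every coordinate value on it is a root
    -- of `p`.
    refine Set.Infinite.mono (s := Set.Ioo (x₀ i) (x₀ i + ε / 4)) (fun t ht => ?_)
      (Set.Ioo_infinite (by linarith))
    let x : Pt n := x₀ + (t - x₀ i) • EuclideanSpace.single i 1
    have hx : x i = t := by simp [x]
    have hmem : x ∈ Metric.ball x₀ (ε / 2) := by
      rw [mem_ball_iff_norm, add_sub_cancel_left, norm_smul, Real.norm_of_nonneg (by linarith [ht.1])]
      simp only [PiLp.norm_single, norm_one, mul_one]
      linarith [ht.2]
    have h1 : f x ≠ 0 := (f.pos_of_mem_ball hmem).ne'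
    have h2 := congrFun hp x
    simp only [Pi.zero_apply, mul_eq_zero, h1, false_or, hx] at h2
    exact h2

theorem contDiff_eval_coord (p : Polynomial ℝ) (i : Fin n) :
    ContDiff ℝ ∞ fun x : Pt n => p.eval (x i) :=
  p.contDiff_aeval ∞ |>.comp (EuclideanSpace.proj i : Pt n →L[ℝ] ℝ).contDiff

theorem vecField_add (φ ψ : Pt n → ℝ) (i : Fin n) :
    vecField (fun x => φ x + ψ x) i = vecField φ i + vecField ψ i := by
  funext x
  ext l
  by_cases hl : l = i <;> simp [vecField, hl]

theorem vecField_smul (c : ℝ) (φ : Pt n → ℝ) (i : Fin n) :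
    vecField (fun x => c * φ x) i = (c : ℂ) • vecField φ i := by
  funext x
  ext l
  by_cases hl : l = i <;> simp [vecField, hl]

/-- A linear operator that does not annihilate any rotated gradient has infinite rank. -/
theorem not_finiteDimensional_range (hΩ : IsOpen Ω) (hne : Ω.Nonempty) {i j : Fin n} (hij : i ≠ j)
    {T : VecL2 Ω →L[ℂ] VecL2 Ω}
    (hT : ∀ (φ : Pt n → ℝ) (h : IsTest Ω φ), T (curlL h i j) = 0 → curlL h i j = 0) :
    ¬ FiniteDimensional ℂ (LinearMap.range (T : VecL2 Ω →ₗ[ℂ] VecL2 Ω)) := by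
  intro hfin
  obtain ⟨φ, hφ, hinj⟩ := exists_test_polynomial hΩ hne i
  have ht : ∀ p : Polynomial ℝ, IsTest Ω fun x => φ x * p.eval (x i) := fun p =>
    hφ.mul (contDiff_eval_coord p i)
  have hadd : ∀ (p q : Polynomial ℝ) (k : Fin n),
      pderiv k (fun x => φ x * (p + q).eval (x i)) = fun x =>
        pderiv k (fun x => φ x * p.eval (x i)) x + pderiv k (fun x => φ x * q.eval (x i)) x := by
    intro p q k
    funext x
    have e : (fun x => φ x * (p + q).eval (x i)) =
        fun x => φ x * p.eval (x i) + φ x * q.eval (x i) := by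
      funext x; rw [Polynomial.eval_add, mul_add]
    unfold pderiv
    rw [e, fderiv_fun_add ((ht p).smooth.differentiable (by simp)).differentiableAt
      ((ht q).smooth.differentiable (by simp)).differentiableAt, add_apply]
  have hsmul : ∀ (c : ℝ) (p : Polynomial ℝ) (k : Fin n),
      pderiv k (fun x => φ x * (c • p).eval (x i)) = fun x =>
        c * pderiv k (fun x => φ x * p.eval (x i)) x := by
    intro c p k
    funext x
    have e : (fun x => φ x * (c • p).eval (x i)) = fun x => c * (φ x * p.eval (x i)) := by
      funext x; rw [Polynomial.eval_smul, smul_eq_mul]; ring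
    unfold pderiv
    rw [e, fderiv_const_mul ((ht p).smooth.differentiable (by simp)).differentiableAt, smul_apply,
      smul_eq_mul]
  have hVadd : ∀ (p q : Polynomial ℝ) (k l : Fin n),
      (((ht (p + q)).pderiv k).memLp_vecField l).toLp =
      (((ht p).pderiv k).memLp_vecField l).toLp + (((ht q).pderiv k).memLp_vecField l).toLp := by
    intro p q k l
    rw [← MemLp.toLp_add]
    exact MemLp.toLp_congr _ _ (Eventually.of_forall fun x => by
      rw [hadd p q k, vecField_add])
  have hVsmul : ∀ (c : ℝ) (p : Polynomial ℝ) (k l : Fin n),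
      (((ht (c • p)).pderiv k).memLp_vecField l).toLp =
      (c : ℂ) • (((ht p).pderiv k).memLp_vecField l).toLp := by
    intro c p k l
    rw [← MemLp.toLp_const_smul]
    exact MemLp.toLp_congr _ _ (Eventually.of_forall fun x => by
      rw [hsmul c p k, vecField_smul])
  -- Real polynomials embed into the range by sending `p` to the image of the rotated gradient of `φ
  -- p`, and they form an infinite-dimensional space.
  let A : Polynomial ℝ →ₗ[ℝ] LinearMap.range (T : VecL2 Ω →ₗ[ℂ] VecL2 Ω) :=
    { toFun := fun p => ⟨T (curlL (ht p) i j), ⟨_, rfl⟩⟩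
      map_add' := fun p q => Subtype.ext <| by
        change T (curlL (ht (p + q)) i j) = T (curlL (ht p) i j) + T (curlL (ht q) i j)
        rw [← map_add, curlL, curlL, curlL, hVadd, hVadd]
        congr 1
        abel
      map_smul' := fun c p => Subtype.ext <| by
        change T (curlL (ht (c • p)) i j) = (c : ℂ) • T (curlL (ht p) i j)
        rw [← map_smul, curlL, curlL, hVsmul, hVsmul, smul_sub] }
  have hA : Function.Injective A := by
    refine (injective_iff_map_eq_zero A).2 fun p hp => ?_
    have h1 : T (curlL (ht p) i j) = 0 := congrArg Subtype.val hp
    exact hinj p (eq_zero_of_curlL_eq_zero hΩ (ht p) hij (hT _ _ h1))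
  have hfinR : FiniteDimensional ℝ (LinearMap.range (T : VecL2 Ω →ₗ[ℂ] VecL2 Ω)) :=
    FiniteDimensional.complexToReal _
  have := FiniteDimensional.of_injective A hA
  exact Polynomial.not_finite this

end Oseen

/-! ### Compactness and the Hilbert-Schmidt property of the solution operator. -/

namespace Oseen

variable {n : ℕ} {Ω : Set (Pt n)}

theorem graphPt_injective : Function.Injective (graphPt : TenL2 Ω → _) :=
  fun σ σ' h => by rw [← graphPt_fst σ, h, graphPt_fst]

variable [IsFiniteMeasure (volume.restrict Ω)]

/-- The solution operator is compact, and its square is a Hilbert-Schmidt operator. -/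
theorem exists_hilbertSchmidt (hn : n ≠ 0) (hn4 : n < 4) (hne : volume Ω ≠ 0)
    (hΩ : Bornology.IsBounded Ω) (hm : MeasurableSet Ω) {B : VecL2 Ω →L[ℂ] TenL2 Ω}
    (hP : SaddlePoint.IsPerturbation (devL Ω) B) {ν γ b : ℝ} (hν : 0 < ν) (hγ : 0 < γ)
    (hinf : SaddlePoint.InfSup (divGraph0 Ω) γ) (hb : ∀ u, ‖B u‖ ≤ b * ‖u‖) (hb0 : 0 ≤ b)
    (hbγ : b < γ * ν) {T : VecL2 Ω →L[ℂ] VecL2 Ω}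
    (hT : ∀ f, ∃ p, SaddlePoint.IsSol (divGraph0 Ω) (devL Ω) ν B f p (T f)) :
    IsCompactOperator T ∧ ∃ C : ℝ, 0 ≤ C ∧ ∀ (d : ℕ) (e : Fin d → VecL2 Ω), Orthonormal ℂ e →
      ∑ i, ‖T (T (e i))‖ ^ 2 ≤ C ^ 2 := by
  obtain ⟨w, C, hC, hframe, hsm⟩ := exists_smoothing hn hne hΩ hm
  set δ : ℝ := γ * ν - b with hδ
  have hδ0 : 0 < δ := sub_pos.2 hbγ
  -- The a priori estimates `‖g‖ ≤ ‖f‖ / δ` and `‖u‖ ≤ ‖f‖ / (γ δ)`, inserted in the smoothing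
  -- bound.
  set M : ℝ := √(((γ * δ) ^ 2)⁻¹ + C * (δ ^ 2)⁻¹) with hM
  have hM2 : M ^ 2 = ((γ * δ) ^ 2)⁻¹ + C * (δ ^ 2)⁻¹ := Real.sq_sqrt (by positivity)
  have hf1 : ∀ k : Fin n → ℤ, 0 ≤ freqSq k := fun k => zero_le_one.trans (one_le_freqSq k)
  have hbound : ∀ (f : VecL2 Ω) (S : Finset (Fin n × (Fin n → ℤ))),
      ∑ q ∈ S, √(freqSq q.2) ^ 2 * ‖(inner ℂ (w q) (T f) : ℂ)‖ ^ 2 ≤ M ^ 2 * ‖f‖ ^ 2 := by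
    intro f S
    obtain ⟨p, hp⟩ := hT f
    obtain ⟨h1, h2⟩ := hp.norm_grad_le hP hν hγ hinf hb hb0 rfl
    obtain ⟨y, hy, hy1, hy2⟩ : ∃ y ∈ SaddlePoint.gradSpace (divGraph0 Ω) (devL Ω),
        y.fst = (ν : ℂ)⁻¹ • (devL Ω p.fst + B (T f)) ∧ y.snd = T f :=
      ⟨_, hp.grad_mem hP hν, rfl, rfl⟩
    rw [← hy1, ← hy2] at h1
    rw [← hy1] at h2
    have h3 := hsm y hy S
    simp_rw [Real.sq_sqrt (hf1 _)]
    rw [← hy2]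
    refine h3.trans ?_
    have h4 : ‖y.fst‖ ≤ ‖f‖ / δ := by rw [le_div_iff₀ hδ0, mul_comm]; exact h2
    have h5 : ‖y.snd‖ ≤ ‖f‖ / (γ * δ) := by
      rw [← div_div, div_right_comm, le_div_iff₀ hγ, mul_comm]
      exact h1.trans h4
    calc ‖y.snd‖ ^ 2 + C * ‖y.fst‖ ^ 2 ≤ (‖f‖ / (γ * δ)) ^ 2 + C * (‖f‖ / δ) ^ 2 := by gcongr
      _ = M ^ 2 * ‖f‖ ^ 2 := by rw [hM2]; field_simp
  have hsum : Summable fun q : Fin n × (Fin n → ℤ) => (√(freqSq q.2) ^ 4)⁻¹ := by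
    have e : ∀ k : Fin n → ℤ, √(freqSq k) ^ 4 = freqSq k ^ 2 := fun k => by
      rw [show 4 = 2 * 2 from rfl, pow_mul, Real.sq_sqrt (hf1 k)]
    simp_rw [e]
    rw [summable_prod_of_nonneg fun q => by have := hf1 q.2; positivity]
    exact ⟨fun _ => summable_freqSq hn4, (hasSum_fintype _).summable⟩
  have hw1 : ∀ q : Fin n × (Fin n → ℤ), 1 ≤ √(freqSq q.2) := fun q =>
    Real.one_le_sqrt.2 (one_le_freqSq q.2)
  -- The summable inverse weights tend to zero, so only finitely many weights lie below any bound.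
  have hfin : ∀ R : ℝ, {q : Fin n × (Fin n → ℤ) | √(freqSq q.2) ≤ R}.Finite := by
    intro R
    have h1 := hsum.tendsto_cofinite_zero.eventually
      (gt_mem_nhds (show (0 : ℝ) < ((|R| + 1) ^ 4)⁻¹ by positivity))
    refine (Filter.eventually_cofinite.1 h1).subset fun q hq => ?_
    have h2 : 0 < √(freqSq q.2) := one_pos.trans_le (hw1 q)
    rw [Set.mem_ofPred_eq, not_lt]
    refine inv_anti₀ (by positivity) ?_
    gcongr
    exact (hq.trans (le_abs_self R)).trans (by linarith)
  exact ⟨CompactOp.isCompactOperator_of_frame hframe (Real.sqrt_nonneg _) hbound hfin, _,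
    by positivity, fun d e he => CompactOp.hilbertSchmidt_sq_of_frame hframe hw1 hbound hsum d e he⟩

theorem eq_graphPt (hΩ : IsOpen Ω) {p : WithLp 2 (TenL2 Ω × VecL2 Ω)} (hp : p ∈ divGraph0 Ω) :
    p = graphPt p.fst :=
  (congrArg (fun v => WithLp.toLp 2 (p.fst, v)) (exists_of_mem_divGraph0 hΩ hp).2).symm

theorem exists_isSource (hΩ : IsOpen Ω) {ν : ℝ} (hν : 0 < ν) {β : Pt n → Pt n}
    (hβ : MemLp β ⊤ (volume.restrict Ω)) {f u : VecL2 Ω}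
    (h : ∃ p, SaddlePoint.IsSol (divGraph0 Ω) (devL Ω) ν (convL hβ) f p u) :
    ∃ σ, IsSource Ω ν β f σ u := by
  obtain ⟨p, hp⟩ := h
  have e := eq_graphPt hΩ hp.mem
  rw [e] at hp
  exact ⟨p.fst, (isSource_iff hΩ hν hβ).2 hp⟩

theorem exists_isAdjointSource (hΩ : IsOpen Ω) {ν : ℝ} (hν : 0 < ν) {β : Pt n → Pt n}
    (hβ : MemLp β ⊤ (volume.restrict Ω)) {f u : VecL2 Ω}
    (h : ∃ p, SaddlePoint.IsSol (divGraph0 Ω) (devL Ω) ν (-convL hβ) f p u) :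
    ∃ σ, IsAdjointSource Ω ν β f σ u := by
  obtain ⟨p, hp⟩ := h
  have e := eq_graphPt hΩ hp.mem
  rw [e] at hp
  exact ⟨p.fst, (isAdjointSource_iff hΩ hν hβ).2 hp⟩

end Oseen

/-! ### The spectral characterization. -/

set_option maxHeartbeats 1600000 in
theorem mainTheorem2 (n : ℕ) (hn : n = 2 ∨ n = 3)
    (Ω : Set (Oseen.Pt n)) (hΩ : Oseen.IsLipschitzDomain Ω)
    (ν : ℝ) (hν : 0 < ν)
    (β : Oseen.Pt n → Oseen.Pt n) (hβ : Oseen.IsSolenoidalLipschitz Ω β)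
    (hsmall : Oseen.supNorm Ω β < Oseen.infSupConst Ω * min ν (Oseen.coercivityConst Ω)) :
    -- both source problems are uniquely solvable
    (∀ f : Oseen.VecL2 Ω, ∃! p : Oseen.TenL2 Ω × Oseen.VecL2 Ω,
      Oseen.IsSource Ω ν β f p.1 p.2) ∧
    (∀ f : Oseen.VecL2 Ω, ∃! p : Oseen.TenL2 Ω × Oseen.VecL2 Ω,
      Oseen.IsAdjointSource Ω ν β f p.1 p.2) ∧
    -- the solution operators are bounded and adjoint to each other
    ∃ T Tstar : Oseen.VecL2 Ω →L[ℂ] Oseen.VecL2 Ω,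
      (∀ f, ∃ σ, Oseen.IsSource Ω ν β f σ (T f)) ∧
      (∀ f, ∃ σ, Oseen.IsAdjointSource Ω ν β f σ (Tstar f)) ∧
      Tstar = ContinuousLinearMap.adjoint T ∧
      -- the spectrum of the adjoint solution operator
      (∃ κ : ℕ → ℂ,
        (∀ k, κ k ≠ 0 ∧ Module.End.HasEigenvalue
          (Tstar : Oseen.VecL2 Ω →ₗ[ℂ] Oseen.VecL2 Ω) (κ k)) ∧
        Tendsto κ atTop (𝓝 0) ∧
        spectrum ℂ Tstar = {0} ∪ Set.range κ ∧
        ∀ μ : ℂ, μ ≠ 0 → FiniteDimensional ℂ (Oseen.rootSpace Tstar μ) ∧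
          {k | κ k = μ}.encard = (Module.finrank ℂ (Oseen.rootSpace Tstar μ) : ℕ∞)) ∧
      -- the eigenvalues of the two operators, with their multiplicities
      (∀ κ : ℂ,
        (Module.End.HasEigenvalue (T : Oseen.VecL2 Ω →ₗ[ℂ] Oseen.VecL2 Ω) κ ↔
          Module.End.HasEigenvalue (Tstar : Oseen.VecL2 Ω →ₗ[ℂ] Oseen.VecL2 Ω) (conj κ)) ∧
        Module.rank ℂ (Oseen.rootSpace T κ) = Module.rank ℂ (Oseen.rootSpace Tstar (conj κ)) ∧
        Module.rank ℂ (Oseen.eigSpace T κ) =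
          Module.rank ℂ (Oseen.eigSpace Tstar (conj κ))) := by
  have hn0 : n ≠ 0 := by rcases hn with h | h <;> omega
  have hn4 : n < 4 := by rcases hn with h | h <;> omega
  have hopen := hΩ.isOpen
  have hvol : volume Ω ≠ 0 := (hopen.measure_pos volume hΩ.isConnected.nonempty).ne'
  have hfm : IsFiniteMeasure (volume.restrict Ω) :=
    isFiniteMeasure_restrict.2 hΩ.isBounded.measure_lt_top.ne
  obtain ⟨γ, c, hγ, hc, hbγ, hinf, hcoer⟩ := Oseen.exists_constants hopen hν hsmall
  have hb0 : 0 ≤ Oseen.supNorm Ω β := ENNReal.toReal_nonneg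
  set B := Oseen.convL hβ.1 with hB
  have hP : SaddlePoint.IsPerturbation (Oseen.devL Ω) B := Oseen.isPerturbation hn0 hβ.1
  have hP' : SaddlePoint.IsPerturbation (Oseen.devL Ω) (-B) :=
    ⟨hP.symm, hP.idem, fun u => by rw [neg_apply, map_neg, hP.range]⟩
  have hb : ∀ u, ‖B u‖ ≤ Oseen.supNorm Ω β * ‖u‖ := Oseen.norm_convL_le hn0 hβ.1
  have hb' : ∀ u, ‖(-B) u‖ ≤ Oseen.supNorm Ω β * ‖u‖ := fun u => by
    rw [neg_apply, norm_neg]; exact hb u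
  obtain ⟨T, hT⟩ := SaddlePoint.exists_solution_operator hP hν hγ hinf hb hb0 hbγ hc hcoer
    Oseen.isClosed_divGraph0
  obtain ⟨S, hS⟩ := SaddlePoint.exists_solution_operator hP' hν hγ hinf hb' hb0 hbγ hc hcoer
    Oseen.isClosed_divGraph0
  have hSadj : S = ContinuousLinearMap.adjoint T := by
    rw [ContinuousLinearMap.eq_adjoint_iff]
    intro g f
    obtain ⟨p, hp⟩ := hT f
    obtain ⟨q, hq⟩ := hS g
    exact Oseen.inner_solution hn0 hvol hν hβ hp hq
  have hTs : ∀ f, ∃ σ, Oseen.IsSource Ω ν β f σ (T f) := fun f =>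
    Oseen.exists_isSource hopen hν hβ.1 (hT f)
  have hSs : ∀ f, ∃ σ, Oseen.IsAdjointSource Ω ν β f σ (S f) := fun f =>
    Oseen.exists_isAdjointSource hopen hν hβ.1 (hS f)
  -- When the velocity vanishes the convection drops out, so the same stress solves the other
  -- problem, and uniqueness applies.
  have hker : ∀ f, T f = 0 → S f = 0 := fun f hf => by
    obtain ⟨p, hp⟩ := hT f
    obtain ⟨q, hq⟩ := hS f
    rw [hf] at hp
    exact (SaddlePoint.IsSol.unique hP' hν hγ hinf hb' hb0 hbγ hc hcoer hq (hp.of_zero _)).2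
  have hker' : ∀ f, S f = 0 → T f = 0 := fun f hf => by
    obtain ⟨p, hp⟩ := hT f
    obtain ⟨q, hq⟩ := hS f
    rw [hf] at hq
    exact (SaddlePoint.IsSol.unique hP hν hγ hinf hb hb0 hbγ hc hcoer hp (hq.of_zero _)).2
  obtain ⟨hcpt, C, hC, hHS⟩ := Oseen.exists_hilbertSchmidt hn0 hn4 hvol hΩ.isBounded
    hopen.measurableSet hP hν hγ hinf hb hb0 hbγ hT
  have hcptS : IsCompactOperator S := hSadj ▸ CompactOp.isCompactOperator_adjoint hcpt
  have hcos : Real.cos (Real.pi / 16) < 1 := by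
    rw [← Real.cos_zero]
    exact Real.cos_lt_cos_of_nonneg_of_le_pi le_rfl (by linarith [Real.pi_pos])
      (by linarith [Real.pi_pos])
  have hcos0 : 0 ≤ Real.cos (Real.pi / 16) :=
    Real.cos_nonneg_of_mem_Icc ⟨by linarith [Real.pi_pos], by linarith [Real.pi_pos]⟩
  obtain ⟨R, K, hres⟩ := SaddlePoint.exists_resolvent_bound hP hν hb hT hcos0 hcos
  have hrange : ¬ FiniteDimensional ℂ
      (LinearMap.range (T : Oseen.VecL2 Ω →ₗ[ℂ] Oseen.VecL2 Ω)) := by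
    -- Two distinct coordinates are needed, hence `n ≥ 2`. If `T` annihilates a rotated gradient,
    -- the stress has no deviatoric part, so the datum is orthogonal to itself.
    refine Oseen.not_finiteDimensional_range hopen hΩ.isConnected.nonempty
      (i := ⟨0, by omega⟩) (j := ⟨1, by omega⟩) (by simp) fun φ h h0 => ?_
    obtain ⟨p, hp⟩ := hT (Oseen.curlL h ⟨0, by omega⟩ ⟨1, by omega⟩)
    rw [h0] at hp
    refine Oseen.curlL_eq_zero h _ _ hp.map_fst_eq_zero ?_
    rw [← hp.eq₂]
    exact (Oseen.mem_divGraph0.1 hp.mem).1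
  have hinfT : {κ : ℂ | κ ≠ 0 ∧
      Module.End.HasEigenvalue (T : Oseen.VecL2 Ω →ₗ[ℂ] Oseen.VecL2 Ω) κ}.Infinite := fun hfin =>
    hrange (CompactOp.finiteDimensional_range_of_finite_eigenvalues hcpt hC hHS hres hfin)
  have hinfS : {κ : ℂ | κ ≠ 0 ∧
      Module.End.HasEigenvalue (S : Oseen.VecL2 Ω →ₗ[ℂ] Oseen.VecL2 Ω) κ}.Infinite := by
    refine (hinfT.image (star_injective (R := ℂ)).injOn).mono ?_
    rintro _ ⟨κ, ⟨hκ, hev⟩, rfl⟩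
    refine ⟨star_ne_zero.2 hκ, ?_⟩
    rw [hSadj]
    exact (CompactOp.hasEigenvalue_adjoint_iff hcpt hκ).1 hev
  -- The value `κ = 0` escapes the Fredholm argument, but there the eigenspaces of both operators
  -- coincide, and so do the root spaces by semisimplicity.
  have hroot : Oseen.rootSpace T 0 = Oseen.rootSpace S 0 ∧
      Oseen.eigSpace T 0 = Oseen.eigSpace S 0 := by
    have h1 : Oseen.eigSpace T 0 = Oseen.eigSpace S 0 := by
      ext x
      rw [Module.End.mem_eigenspace_iff, Module.End.mem_eigenspace_iff, zero_smul]
      exact ⟨hker x, hker' x⟩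
    refine ⟨?_, h1⟩
    have h2 : Oseen.rootSpace T 0 = Oseen.eigSpace T 0 :=
      CompactOp.maxGenEigenspace_zero_of_ker_eq (hSadj ▸ hker)
    have h3 : Oseen.rootSpace S 0 = Oseen.eigSpace S 0 :=
      CompactOp.maxGenEigenspace_zero_of_ker_eq (by
        rw [hSadj, ContinuousLinearMap.adjoint_adjoint, ← hSadj]
        exact hker')
    rw [h2, h3, h1]
  refine ⟨fun f => ?_, fun f => ?_, T, S, hTs, hSs, hSadj,
    CompactOp.exists_eigenvalue_sequence hcptS hinfS, fun κ => ?_⟩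
  · obtain ⟨σ, hσ⟩ := hTs f
    refine ⟨(σ, T f), hσ, fun p hp => ?_⟩
    have h := SaddlePoint.IsSol.unique hP hν hγ hinf hb hb0 hbγ hc hcoer
      ((Oseen.isSource_iff hopen hν hβ.1).1 hp) ((Oseen.isSource_iff hopen hν hβ.1).1 hσ)
    exact Prod.ext (Oseen.graphPt_injective h.1) h.2
  · obtain ⟨σ, hσ⟩ := hSs f
    refine ⟨(σ, S f), hσ, fun p hp => ?_⟩
    have h := SaddlePoint.IsSol.unique hP' hν hγ hinf hb' hb0 hbγ hc hcoer
      ((Oseen.isAdjointSource_iff hopen hν hβ.1).1 hp)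
      ((Oseen.isAdjointSource_iff hopen hν hβ.1).1 hσ)
    exact Prod.ext (Oseen.graphPt_injective h.1) h.2
  · rcases eq_or_ne κ 0 with rfl | hκ
    · rw [map_zero]
      refine ⟨?_, by rw [hroot.1], by rw [hroot.2]⟩
      rw [Module.End.hasEigenvalue_iff, Module.End.hasEigenvalue_iff]
      exact not_congr (by
        change Oseen.eigSpace T 0 = ⊥ ↔ Oseen.eigSpace S 0 = ⊥
        rw [hroot.2])
    · rw [hSadj]
      exact ⟨CompactOp.hasEigenvalue_adjoint_iff hcpt hκ,
        CompactOp.rank_maxGenEigenspace_adjoint hcpt hκ, CompactOp.rank_eigenspace_adjoint hcpt hκ⟩
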